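/- Fix a smooth function $u:\mathbb R\to\mathbb R$ with $\operatorname{supp}(u)\subset[1/2,3]$, $0\le u\le 1$, and $u(x)=1$ for $x\in[1,2]$. For positive integers $m$, $q$ and $k>2$ and a Dirichlet character $\chi$ modulo $q$ with $\chi(-1)=(-1)^k$, let $$P_{k,m,q,\chi}(z)=\sum_{\gamma\in\Gamma_\infty\backslash\Gamma_0(q)}\overline{\chi}(\gamma)\,j(\gamma,z)^{-k}e^{2\pi i m\gamma z}\qquad(z\in\mathbb H)$$ be the Poincaré series, where $\Gamma_\infty=\{\pm\begin{pmatrix}1&n\\0&1\end{pmatrix}:n\in\mathbb Z\}$ and, for $\gamma=\begin{pmatrix}a&b\\c&d\end{pmatrix}$, $\chi(\gamma)=\chi(d)$ and $j(\gamma,z)=cz+d$. Let $$\widetilde P_{k,m,q,\chi}=\left(\frac{\Gamma(k-1)}{(4\pi m)^{k-1}}\right)^{-1/2}P_{k,m,q,\chi},\qquad \|F\|_2^2=\int_{\Gamma_0(q)\backslash\mathbb H}|F(z)|^2y^k\,\frac{dx\,dy}{y^2},$$ and for $M\ge1$ put $$\sigma_M^2=\frac1M\sum_{m\ge1}u\left(\frac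 mM\right)\left(\|\widetilde P_{k,m,q,\chi}\|_2^2-1\right)^2.$$ Let $f(q)$ denote the largest square divisor of $q$. **Proposition 3.2.** Let $k>2$ and $q$ be positive integers, let $M\ge1$ be a real number with $M\le k^{1000}$, and let $\chi$ be a character modulo $q$ with $\chi(-1)=(-1)^k$. Then for every $\epsilon>0$, $$\sigma_M^2\ll_{\epsilon}\frac{M^{1/2+\epsilon}f(q)^{1/2}}{k^{3/2}q}+\frac{M^{1+\epsilon}f(q)}{k^{5/2}q^2}+k^{-1000},$$ where the implied constant depends only on $\epsilon$ and on the fixed function $u$ (not on $k$, $q$, $\chi$ or $M$). -/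

import Mathlib

open scoped MatrixGroups ContDiff UpperHalfPlane

noncomputable section

namespace PoincareMoment

open UpperHalfPlane MeasureTheory

/-- The stabilizer `Γ_∞ = {± [1, n; 0, 1] : n ∈ ℤ}` of the cusp `i∞` in `SL(2, ℤ)`. -/
def GammaInf : Subgroup SL(2, ℤ) where
  carrier := {γ | ∃ n : ℤ, γ = ModularGroup.T ^ n ∨ γ = -ModularGroup.T ^ n}
  one_mem' := ⟨0, Or.inl (by simp)⟩
  mul_mem' := by
    rintro a b ⟨n, rfl | rfl⟩ ⟨l, rfl | rfl⟩ <;> refine ⟨n + l, ?_⟩ <;> simp [zpow_add]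
  inv_mem' := by
    have hneg : ∀ g : SL(2, ℤ), (-g)⁻¹ = -g⁻¹ := fun g =>
      inv_eq_of_mul_eq_one_right (by simp)
    rintro a ⟨n, rfl | rfl⟩ <;> refine ⟨-n, ?_⟩ <;> simp [hneg]

/-- The set `Γ_∞ \ Γ₀(q)` of right cosets `Γ_∞ γ`, `γ ∈ Γ₀(q)`. -/
abbrev CosetsInf (q : ℕ) : Type :=
  Quotient (QuotientGroup.rightRel (GammaInf.subgroupOf (CongruenceSubgroup.Gamma0 q)))

/-- The summand `χ̄(γ) j(γ, z)^{-k} e(m γ z)` of the Poincaré series, where `χ(γ) = χ(d)` and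
`j(γ, z) = c z + d` for `γ = [a, b; c, d]`. -/
def poincareTerm (k m q : ℕ) (χ : DirichletCharacter ℂ q) (z : ℍ) (γ : SL(2, ℤ)) : ℂ :=
  (starRingEnd ℂ) (χ ((γ 1 1 : ℤ) : ZMod q))
    * (((γ 1 0 : ℤ) : ℂ) * (z : ℂ) + ((γ 1 1 : ℤ) : ℂ)) ^ (-(k : ℤ))
    * Complex.exp (2 * Real.pi * Complex.I * m * ((γ • z : ℍ) : ℂ))

/-- Under the parity condition the summand depends only on the coset `Γ_∞ γ`, so that the choice
of representatives in `poincareSeries` does not matter. -/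
theorem poincareTerm_mul_left (k m q : ℕ) (χ : DirichletCharacter ℂ q)
    (hχ : χ (-1) = (-1) ^ k) (z : ℍ) (δ γ : SL(2, ℤ)) (hδ : δ ∈ GammaInf) :
    poincareTerm k m q χ z (δ * γ) = poincareTerm k m q χ z γ := by
  have hneg : ∀ g : SL(2, ℤ), poincareTerm k m q χ z (-g) = poincareTerm k m q χ z g := by
    intro g
    have h1 : χ (-((g 1 1 : ℤ) : ZMod q)) = (-1) ^ k * χ ((g 1 1 : ℤ) : ZMod q) := by
      rw [← hχ, ← map_mul]; simp
    have h2 : (-(((g 1 0 : ℤ) : ℂ) * (z : ℂ)) + -((g 1 1 : ℤ) : ℂ)) ^ (-(k : ℤ))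
        = (-1) ^ k * (((g 1 0 : ℤ) : ℂ) * (z : ℂ) + ((g 1 1 : ℤ) : ℂ)) ^ (-(k : ℤ)) := by
      rw [← neg_add, neg_eq_neg_one_mul, mul_zpow]
      congr 1
      rw [zpow_neg, zpow_natCast, ← inv_pow]; norm_num
    simp only [poincareTerm, Matrix.SpecialLinearGroup.coe_neg, Matrix.neg_apply, Int.cast_neg,
      neg_mul, h1, h2, map_mul, map_pow, map_neg, map_one, ModularGroup.SL_neg_smul]
    have h3 : ((-1 : ℂ) ^ k) * (-1) ^ k = 1 := by rw [← mul_pow]; norm_num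
    linear_combination (starRingEnd ℂ) (χ ((g 1 1 : ℤ) : ZMod q))
      * (((g 1 0 : ℤ) : ℂ) * (z : ℂ) + ((g 1 1 : ℤ) : ℂ)) ^ (-(k : ℤ))
      * Complex.exp (2 * Real.pi * Complex.I * m * ((g • z : ℍ) : ℂ)) * h3
  have hT : ∀ n : ℤ, poincareTerm k m q χ z (ModularGroup.T ^ n * γ)
      = poincareTerm k m q χ z γ := by
    intro n
    have h0 : (ModularGroup.T ^ n * γ) 1 = γ 1 := ModularGroup.T_pow_mul_apply_one n γ
    simp only [poincareTerm, h0, mul_smul, ModularGroup.coe_T_zpow_smul_eq]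
    congr 1
    rw [mul_add, Complex.exp_add]
    have : Complex.exp (2 * Real.pi * Complex.I * m * (n : ℂ)) = 1 := by
      rw [Complex.exp_eq_one_iff]
      exact ⟨m * n, by push_cast; ring⟩
    rw [this, mul_one]
  obtain ⟨n, rfl | rfl⟩ := hδ
  · exact hT n
  · rw [neg_mul, hneg, hT]

/-- The Poincaré series
`P_{k,m,q,χ}(z) = ∑_{γ ∈ Γ_∞ \ Γ₀(q)} χ̄(γ) j(γ, z)^{-k} e(m γ z)`. -/
def poincareSeries (k m q : ℕ) (χ : DirichletCharacter ℂ q) (z : ℍ) : ℂ :=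
  ∑' γ : CosetsInf q, poincareTerm k m q χ z (γ.out : CongruenceSubgroup.Gamma0 q)

/-- The renormalized Poincaré series `(Γ(k-1) / (4πm)^{k-1})^{-1/2} P_{k,m,q,χ}`. -/
def normalizedPoincareSeries (k m q : ℕ) (χ : DirichletCharacter ℂ q) (z : ℍ) : ℂ :=
  (((Real.Gamma ((k : ℝ) - 1) / (4 * Real.pi * m) ^ ((k : ℝ) - 1)) ^ (-(1 / 2) : ℝ) : ℝ) : ℂ)
    * poincareSeries k m q χ z

/-- The Ford fundamental domain of `Γ₀(q)`: the points of the strip `|Re z| ≤ 1/2` which have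
maximal height in their `Γ₀(q)`-orbit. Its `Γ₀(q)`-translates cover `ℍ`, and translates by
elements that differ by more than a sign overlap in a null set, so that the integral over
`Γ₀(q) \ ℍ` of an invariant function is its integral over this set. -/
def fordDomain (q : ℕ) : Set ℍ :=
  {z | |z.re| ≤ 1 / 2 ∧ ∀ γ ∈ CongruenceSubgroup.Gamma0 q, (γ • z).im ≤ z.im}

/-- The squared Petersson norm `∫_{Γ₀(q) \ ℍ} |F(z)|² y^k dx dy / y²`; the measure on `ℍ`
is the invariant measure `dx dy / y²`. -/
def peterssonNormSq (k q : ℕ) (F : ℍ → ℂ) : ℝ :=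
  ∫ z in fordDomain q, ‖F z‖ ^ 2 * z.im ^ k

/-- The smoothed second moment
`σ_M² = (1/M) ∑_m u(m/M) (‖P̃_{k,m,q,χ}‖² - 1)²`. For `u` supported in `[1/2, 3]` and `M > 0`
only the finitely many `m` with `M/2 ≤ m ≤ 3M` contribute. -/
def sigmaSq (u : ℝ → ℝ) (k q : ℕ) (χ : DirichletCharacter ℂ q) (M : ℝ) : ℝ :=
  1 / M * ∑' m : ℕ, u (m / M) *
    (peterssonNormSq k q (normalizedPoincareSeries k m q χ) - 1) ^ 2

/-- The largest square divisor `f(q)` of `q ≥ 1`. -/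
def largestSquareDivisor (q : ℕ) : ℕ :=
  (q.divisors.filter fun d => IsSquare d).sup id

end PoincareMoment

end

open scoped MatrixGroups ContDiff UpperHalfPlane

noncomputable section

namespace PoincareMoment

open MeasureTheory intervalIntegral Set

/-! ### Oscillatory integrals -/

/-! The Petersson formula expresses ‖P̃‖² − 1 through the sum over moduli c = qn of S(m,m;c)/c ·
J_ν(4πm/c), where ν = k − 1 and S is the Kloosterman sum twisted by the conjugate character. It is
proved by unfolding over a Ford domain and integrating each term over ℍ (`exists_hasSum_petersson`).
So σ_M² is bounded by a mean square of such sums over M/2 ≤ m ≤ 3M. No bound for individual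
Kloosterman sums beyond |S| ≤ c is used: the saving comes from the average over m, through a large
sieve in which the Bessel function is part of the test vectors.

Sorting residues x by a ≡ x + x⁻¹ writes S as a sum of e(ma/c) with coefficients `traceWeight`. On
the other hand J_ν(4πm/c) is, up to the factor m/ν and constants, the Fourier transform at m of the
wave t ↦ sin(ν arccos(t/R)) with R = 2/c (`integral_wave_mul_exp`). Hence each term is m/ν times the
Fourier transform at the integer m of a wave centred at a/c, with coefficient `traceWeight`/c.
Bessel's inequality and Schur's test bound the mean square by the row sums of the Gram matrix of the
waves.

Two waves with centres p₁ ≠ p₂ and radii at most R have correlation O(√(R³/(ν|p₁ − p₂|))): the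
difference of their angles has a single stationary point (`abs_integral_wave_mul_wave_le_sqrt`).
Counting fractions a'/(qn') near a given a/(qn), with n and n' in a dyadic block [Y, 2Y), gives row
sums O((gcd(a,n) + Y/√ν)/(qY)). The gcd is harmless: residues x with e ∣ x + x⁻¹ satisfy x² ≡ −1
modulo e, so the second moment of the trace counts weighted by the gcd is still at most 8c·τ(c)⁴
(`sum_traceCount_sq_mul_gcd_le`).

The moduli fall into three ranges. For kc ≥ 200M the Bessel function is of size e^{−k}, and M ≤
k^1000 turns this into k^{−1000}. A dyadic block of moduli near c contributes, up to divisor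
factors, M²/(k²qc) + M²/(k^{5/2}q²); divided by M the second term is the second main term, and the
first term is the first main term exactly when c is of order D = √M/√k. For c ≤ D/10 one uses
Cauchy–Schwarz, J_ν(x) ≪ x^{−1/2} for x ≥ 2ν, and orthogonality over full periods of m. Divisor
functions, logarithms and the number of blocks cost M^ε. The resulting bound contains no f(q); the
factors of the theorem are inserted by f(q) ≥ 1. -/

/-- Integration by parts with a weight of bounded variation. -/
lemma norm_integral_exp_le_of_variation {ψ ψ' w w' : ℝ → ℝ} {a b K V : ℝ} (hab : a ≤ b)
    (hψ : ∀ t ∈ Icc a b, HasDerivAt ψ (ψ' t) t) (hw : ∀ t ∈ Icc a b, HasDerivAt w (w' t) t)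
    (hψc : ContinuousOn ψ' (Icc a b)) (hwc : ContinuousOn w' (Icc a b))
    (hinv : ∀ t ∈ Icc a b, w t * ψ' t = 1)
    (hK : ∀ t ∈ Icc a b, |w t| ≤ K) (hV : ∫ t in a..b, |w' t| ≤ V) {ν : ℝ} (hν : 0 < ν) :
    ‖∫ t in a..b, Complex.exp (Complex.I * (ν * ψ t : ℝ))‖ ≤ (2 * K + V) / ν := by
  have hu : uIcc a b = Icc a b := uIcc_of_le hab
  set v : ℝ → ℂ := fun t => Complex.exp (Complex.I * (ν * ψ t : ℝ)) with hv
  have hvd : ∀ t ∈ Icc a b, HasDerivAt v (v t * (Complex.I * (ν * ψ' t : ℝ))) t := by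
    intro t ht
    have h1 : HasDerivAt (fun t => ((ν * ψ t : ℝ) : ℂ)) ((ν * ψ' t : ℝ) : ℂ) t :=
      ((hψ t ht).const_mul ν).ofReal_comp
    exact (h1.const_mul Complex.I).cexp
  have hvn : ∀ t, ‖v t‖ = 1 := by
    intro t; rw [hv]; simp only; rw [mul_comm]; exact Complex.norm_exp_ofReal_mul_I _
  have hvc : ContinuousOn v (Icc a b) := fun t ht => (hvd t ht).continuousAt.continuousWithinAt
  have hwd : ∀ t ∈ Icc a b, HasDerivAt (fun t => ((w t : ℝ) : ℂ)) ((w' t : ℝ) : ℂ) t :=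
    fun t ht => (hw t ht).ofReal_comp
  have hwc0 : ContinuousOn (fun t => ((w' t : ℝ) : ℂ)) (Icc a b) :=
    Complex.continuous_ofReal.comp_continuousOn hwc
  have hi1 : IntervalIntegrable (fun t => ((w' t : ℝ) : ℂ)) volume a b :=
    (hu ▸ hwc0 : ContinuousOn _ (uIcc a b)).intervalIntegrable
  have hi2 : IntervalIntegrable (fun t => v t * (Complex.I * (ν * ψ' t : ℝ))) volume a b := by
    refine ContinuousOn.intervalIntegrable ?_
    rw [hu]
    refine hvc.mul (continuousOn_const.mul ?_)
    exact Complex.continuous_ofReal.comp_continuousOn (continuousOn_const.mul hψc)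
  -- Since wψ' = 1, the exponential is w·v'/(iν). The boundary terms cost at most K each and the
  -- remaining integral at most V.
  have hparts := integral_mul_deriv_eq_deriv_mul (a := a) (b := b)
    (u := fun t => ((w t : ℝ) : ℂ)) (v := v) (u' := fun t => ((w' t : ℝ) : ℂ))
    (v' := fun t => v t * (Complex.I * (ν * ψ' t : ℝ)))
    (fun t ht => hwd t (hu ▸ ht)) (fun t ht => hvd t (hu ▸ ht)) hi1 hi2
  have hleft : ∫ t in a..b, ((w t : ℝ) : ℂ) * (v t * (Complex.I * (ν * ψ' t : ℝ)))
      = (Complex.I * ν) * ∫ t in a..b, v t := by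
    rw [← intervalIntegral.integral_const_mul]
    refine integral_congr fun t ht => ?_
    have h := hinv t (hu ▸ ht)
    have h' : ((w t : ℝ) : ℂ) * ((ψ' t : ℝ) : ℂ) = 1 := by exact_mod_cast h
    simp only [Complex.ofReal_mul]
    linear_combination (v t * Complex.I * ν) * h'
  have hbound : ‖∫ t in a..b, ((w' t : ℝ) : ℂ) * v t‖ ≤ V := by
    refine (intervalIntegral.norm_integral_le_integral_norm hab).trans (le_trans (le_of_eq ?_) hV)
    refine integral_congr fun t _ => ?_
    simp [hvn t]
  rw [hleft] at hparts
  have hn : ν * ‖∫ t in a..b, v t‖ ≤ 2 * K + V := by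
    have : ‖(Complex.I * ν) * ∫ t in a..b, v t‖ = ν * ‖∫ t in a..b, v t‖ := by
      rw [norm_mul, norm_mul, Complex.norm_I, one_mul, Complex.norm_real, Real.norm_of_nonneg hν.le]
    rw [← this, hparts]
    refine (norm_sub_le _ _).trans (add_le_add ((norm_sub_le _ _).trans ?_) hbound)
    have e1 := hK b (right_mem_Icc.2 hab)
    have e2 := hK a (left_mem_Icc.2 hab)
    simp only [norm_mul, hvn, mul_one, Complex.norm_real, Real.norm_eq_abs]
    linarith
  rw [le_div_iff₀ hν, mul_comm]
  exact hn

/-- Cutting out a neighbourhood of a stationary point. -/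
lemma norm_integral_le_of_away {f : ℝ → ℂ} {a b t₀ δ E : ℝ} (hab : a ≤ b) (hδ : 0 ≤ δ)
    (hE : 0 ≤ E) (hf : ContinuousOn f (Icc a b)) (h1 : ∀ t, ‖f t‖ ≤ 1)
    (h : ∀ a' b', a ≤ a' → a' ≤ b' → b' ≤ b → (∀ t ∈ Icc a' b', δ ≤ |t - t₀|) →
      ‖∫ t in a'..b', f t‖ ≤ E) :
    ‖∫ t in a..b, f t‖ ≤ 2 * E + 2 * δ := by
  -- Both cut points are clamped to [a, b], so that a point t₀ near the boundary or outside the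
  -- interval needs no separate treatment; an outer piece may be empty.
  set c := max a (min b (t₀ - δ)) with hc
  set d := max a (min b (t₀ + δ)) with hd
  have hac : a ≤ c := le_max_left _ _
  have hcd : c ≤ d := max_le_max le_rfl (min_le_min le_rfl (by linarith))
  have hdb : d ≤ b := max_le hab (min_le_left _ _)
  have hint : ∀ x y, a ≤ x → x ≤ y → y ≤ b → IntervalIntegrable f volume x y := by
    intro x y hx hxy hy
    refine ContinuousOn.intervalIntegrable ?_
    rw [uIcc_of_le hxy]
    exact hf.mono (Icc_subset_Icc hx hy)
  have hs : ∫ t in a..b, f t = (∫ t in a..c, f t) + (∫ t in c..d, f t) + ∫ t in d..b, f t := by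
    rw [integral_add_adjacent_intervals, integral_add_adjacent_intervals]
    · exact hint _ _ le_rfl (hac.trans hcd) hdb
    · exact hint _ _ (hac.trans hcd) hdb le_rfl
    · exact hint _ _ le_rfl hac (hcd.trans hdb)
    · exact hint _ _ hac hcd hdb
  have e1 : ‖∫ t in a..c, f t‖ ≤ E := by
    rcases hac.eq_or_lt with h0 | h0
    · rw [← h0]; simpa using hE
    · refine h a c le_rfl hac (hcd.trans hdb) fun t ht => ?_
      have : c ≤ t₀ - δ := by
        rcases max_cases a (min b (t₀ - δ)) with h' | h'
        · rw [← hc] at h'; linarith [h'.1]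
        · rw [hc, h'.1]; exact min_le_right _ _
      rw [abs_sub_comm]
      exact le_trans (by linarith [ht.2]) (le_abs_self _)
  have e3 : ‖∫ t in d..b, f t‖ ≤ E := by
    rcases hdb.eq_or_lt with h0 | h0
    · rw [h0]; simpa using hE
    · refine h d b (hac.trans hcd) hdb le_rfl fun t ht => ?_
      have : t₀ + δ ≤ d := by
        have : min b (t₀ + δ) ≤ d := le_max_right _ _
        rcases min_cases b (t₀ + δ) with h' | h'
        · linarith [h'.1]
        · linarith [h'.1]
      exact le_trans (by linarith [ht.1]) (le_abs_self _)
  have e2 : ‖∫ t in c..d, f t‖ ≤ 2 * δ := by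
    have := norm_integral_le_of_norm_le_const (a := c) (b := d) (f := f) (C := 1)
      (fun t _ => h1 t)
    rw [one_mul, abs_of_nonneg (by linarith)] at this
    refine this.trans ?_
    have h3 : d ≤ c + 2 * δ := by
      refine max_le (by linarith) ?_
      rcases min_cases b (t₀ - δ) with h' | h'
      · have : b ≤ c := by rw [hc, h'.1]; exact le_max_right _ _
        linarith [min_le_left b (t₀ + δ)]
      · have : t₀ - δ ≤ c := by rw [hc, h'.1]; exact le_max_right _ _
        linarith [min_le_right b (t₀ + δ)]
    linarith
  rw [hs]
  refine (norm_add_le _ _).trans ?_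
  have := norm_add_le (∫ t in a..c, f t) (∫ t in c..d, f t)
  linarith

/-! ### Angles and heights on half circles -/

/-- The angle of the point above `t` on the half circle with centre `p` and radius `R`. -/
def angle (p R t : ℝ) : ℝ := Real.arccos ((t - p) / R)

/-- The height of the point above `t` on the half circle with centre `p` and radius `R`. -/
def height (p R t : ℝ) : ℝ := √(R ^ 2 - (t - p) ^ 2)

lemma continuous_angle (p R : ℝ) : Continuous (angle p R) := by
  unfold angle; fun_prop

lemma sq_sub_pos {p R t : ℝ} (h : |t - p| < R) : 0 < R ^ 2 - (t - p) ^ 2 := by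
  have := abs_lt.1 h
  nlinarith

lemma height_pos {p R t : ℝ} (h : |t - p| < R) : 0 < height p R t :=
  Real.sqrt_pos.2 (sq_sub_pos h)

lemma height_sq {p R t : ℝ} (h : |t - p| < R) : height p R t ^ 2 = R ^ 2 - (t - p) ^ 2 :=
  Real.sq_sqrt (sq_sub_pos h).le

lemma height_le {p R t : ℝ} (hR : 0 ≤ R) : height p R t ≤ R :=
  Real.sqrt_le_iff.2 ⟨hR, by nlinarith [sq_nonneg (t - p)]⟩

lemma hasDerivAt_height {p R t : ℝ} (h : |t - p| < R) :
    HasDerivAt (height p R) (-(t - p) / height p R t) t := by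
  have h1 : HasDerivAt (fun t => R ^ 2 - (t - p) ^ 2) (-(2 * (t - p))) t := by
    have := (((hasDerivAt_id t).sub_const p).pow 2).const_sub (R ^ 2)
    simpa using this
  have h2 := h1.sqrt (sq_sub_pos h).ne'
  convert! h2 using 1
  unfold height
  ring

lemma hasDerivAt_angle {p R t : ℝ} (h : |t - p| < R) :
    HasDerivAt (angle p R) (-(1 / height p R t)) t := by
  have hR : 0 < R := (abs_nonneg _).trans_lt h
  have hlt := abs_lt.1 h
  have h1 : HasDerivAt (fun t => (t - p) / R) (1 / R) t :=
    ((hasDerivAt_id t).sub_const p).div_const R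
  have hl : (t - p) / R ≠ -1 := by
    intro h'; rw [div_eq_iff hR.ne'] at h'; linarith
  have hr : (t - p) / R ≠ 1 := by
    intro h'; rw [div_eq_iff hR.ne'] at h'; linarith
  have h2 := (Real.hasDerivAt_arccos hl hr).comp t h1
  convert! h2 using 1
  have : √(1 - ((t - p) / R) ^ 2) = height p R t / R := by
    unfold height
    rw [eq_div_iff hR.ne', ← Real.sqrt_sq hR.le, ← Real.sqrt_mul' _ (sq_nonneg R), Real.sqrt_sq hR.le]
    congr 1
    field_simp
  rw [this]
  have := (height_pos h).ne'
  field_simp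

lemma continuousOn_inv_height {p R a b : ℝ} (h : ∀ t ∈ Icc a b, |t - p| < R) :
    ContinuousOn (fun t => 1 / height p R t) (Icc a b) :=
  fun t ht => ((continuousAt_const.div (hasDerivAt_height (h t ht)).continuousAt
    (height_pos (h t ht)).ne')).continuousWithinAt

/-- The integrand is minus the derivative of the angle, whose values lie in [0, π]. This uniform
bound controls the variation of the weights below although the heights vanish at the ends of the
half circles. -/
lemma integral_inv_height_le {p R a b : ℝ} (hab : a ≤ b) (h : ∀ t ∈ Icc a b, |t - p| < R) :
    ∫ t in a..b, 1 / height p R t ≤ Real.pi := by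
  have hu : uIcc a b = Icc a b := uIcc_of_le hab
  have h1 := integral_eq_sub_of_hasDerivAt (a := a) (b := b) (f := fun t => -angle p R t)
    (f' := fun t => 1 / height p R t)
    (fun t ht => by simpa using! (hasDerivAt_angle (h t (hu ▸ ht))).neg)
    (ContinuousOn.intervalIntegrable (hu ▸ continuousOn_inv_height h))
  rw [h1]
  have := Real.arccos_le_pi ((a - p) / R)
  have := Real.arccos_nonneg ((b - p) / R)
  simp only [angle]
  linarith

/-- The oscillatory integral with the sum of two angles in the phase. -/
lemma norm_integral_exp_angle_add_le {p₁ p₂ R₁ R₂ R a b ν : ℝ} (hab : a ≤ b)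
    (h₁ : ∀ t ∈ Icc a b, |t - p₁| < R₁) (h₂ : ∀ t ∈ Icc a b, |t - p₂| < R₂)
    (hR₁ : R₁ ≤ R) (hR₂ : R₂ ≤ R) (hν : 0 < ν) :
    ‖∫ t in a..b, Complex.exp (Complex.I * (ν * (angle p₁ R₁ t + angle p₂ R₂ t) : ℝ))‖
      ≤ 10 * R / ν := by
  have hu : uIcc a b = Icc a b := uIcc_of_le hab
  have hRpos : 0 < R := ((abs_nonneg _).trans_lt (h₁ a (left_mem_Icc.2 hab))).trans_le hR₁
  set x := height p₁ R₁ with hx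
  set y := height p₂ R₂ with hy
  have hxp : ∀ t ∈ Icc a b, 0 < x t := fun t ht => height_pos (h₁ t ht)
  have hyp : ∀ t ∈ Icc a b, 0 < y t := fun t ht => height_pos (h₂ t ht)
  have hxR : ∀ t ∈ Icc a b, x t ≤ R := fun t ht =>
    (height_le ((abs_nonneg _).trans_lt (h₁ t ht)).le).trans hR₁
  have hyR : ∀ t ∈ Icc a b, y t ≤ R := fun t ht =>
    (height_le ((abs_nonneg _).trans_lt (h₂ t ht)).le).trans hR₂
  have hxd : ∀ t ∈ Icc a b, HasDerivAt x (-(t - p₁) / x t) t :=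
    fun t ht => hasDerivAt_height (h₁ t ht)
  have hyd : ∀ t ∈ Icc a b, HasDerivAt y (-(t - p₂) / y t) t :=
    fun t ht => hasDerivAt_height (h₂ t ht)
  have hxc : ContinuousOn x (Icc a b) := fun t ht => (hxd t ht).continuousAt.continuousWithinAt
  have hyc : ContinuousOn y (Icc a b) := fun t ht => (hyd t ht).continuousAt.continuousWithinAt
  -- Both angles decrease, so the phase has no stationary point: its derivative is −(1/x + 1/y),
  -- with reciprocal −xy/(x + y) bounded by R.
  set w : ℝ → ℝ := fun t => -(x t * y t / (x t + y t)) with hw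
  set w' : ℝ → ℝ := fun t => ((t - p₁) * y t ^ 2 / x t + (t - p₂) * x t ^ 2 / y t)
    / (x t + y t) ^ 2 with hw'
  have hV : ∫ t in a..b, |w' t| ≤ R * Real.pi + R * Real.pi := by
    have hi : ∀ (p r : ℝ), (∀ t ∈ Icc a b, |t - p| < r) →
        IntervalIntegrable (fun t => 1 / height p r t) volume a b := fun p r h =>
      ContinuousOn.intervalIntegrable (hu ▸ continuousOn_inv_height h)
    have hcw : ContinuousOn w' (Icc a b) := by
      refine ContinuousOn.div ?_ (by fun_prop) ?_
      · refine ContinuousOn.add (ContinuousOn.div (by fun_prop) hxc fun t ht => (hxp t ht).ne')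
          (ContinuousOn.div (by fun_prop) hyc fun t ht => (hyp t ht).ne')
      · intro t ht
        have := hxp t ht; have := hyp t ht; positivity
    calc ∫ t in a..b, |w' t| ≤ ∫ t in a..b, (R * (1 / x t) + R * (1 / y t)) := by
          refine integral_mono_on hab ?_ ?_ ?_
          · exact ContinuousOn.intervalIntegrable (hu ▸ hcw.abs)
          · exact ((hi _ _ h₁).const_mul R).add ((hi _ _ h₂).const_mul R)
          · intro t ht
            have hx0 := hxp t ht
            have hy0 := hyp t ht
            have a1 : |t - p₁| ≤ R := (h₁ t ht).le.trans hR₁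
            have a2 : |t - p₂| ≤ R := (h₂ t ht).le.trans hR₂
            simp only [hw']
            rw [abs_div, abs_of_pos (by positivity : 0 < (x t + y t) ^ 2), div_le_iff₀ (by positivity)]
            refine (abs_add_le _ _).trans ?_
            rw [abs_div, abs_div, abs_mul, abs_mul, abs_of_pos hx0, abs_of_pos hy0,
              abs_of_pos (pow_pos hx0 2), abs_of_pos (pow_pos hy0 2)]
            have e1 : |t - p₁| * y t ^ 2 / x t ≤ R * (1 / x t) * (x t + y t) ^ 2 := by
              rw [mul_div_assoc, mul_assoc, one_div_mul_eq_div]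
              gcongr
              linarith
            have e2 : |t - p₂| * x t ^ 2 / y t ≤ R * (1 / y t) * (x t + y t) ^ 2 := by
              rw [mul_div_assoc, mul_assoc, one_div_mul_eq_div]
              gcongr
              linarith
            linarith
      _ = R * (∫ t in a..b, 1 / x t) + R * ∫ t in a..b, 1 / y t := by
          rw [intervalIntegral.integral_add ((hi _ _ h₁).const_mul R) ((hi _ _ h₂).const_mul R),
            intervalIntegral.integral_const_mul, intervalIntegral.integral_const_mul]
      _ ≤ _ := by
          gcongr
          · exact integral_inv_height_le hab h₁
          · exact integral_inv_height_le hab h₂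
  have hmain := norm_integral_exp_le_of_variation (ψ := fun t => angle p₁ R₁ t + angle p₂ R₂ t)
    (ψ' := fun t => -(1 / x t) + -(1 / y t)) (w := w) (w' := w') (K := R) (ν := ν) hab
    (fun t ht => (hasDerivAt_angle (h₁ t ht)).add (hasDerivAt_angle (h₂ t ht)))
    ?_ ?_ ?_ ?_ ?_ hV hν
  · refine hmain.trans ?_
    gcongr
    -- The boundary terms and the variation give 2R + 2πR ≤ 10R.
    nlinarith [Real.pi_lt_four]
  · intro t ht
    have hx0 := (hxp t ht).ne'
    have hy0 := (hyp t ht).ne'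
    have hxy : x t + y t ≠ 0 := by have := hxp t ht; have := hyp t ht; positivity
    have := (((hxd t ht).mul (hyd t ht)).div ((hxd t ht).add (hyd t ht)) hxy).neg
    convert! this using 1
    simp only [hw', Pi.add_apply, Pi.mul_apply]
    field_simp
    ring
  · exact ((continuousOn_inv_height h₁).neg).add (continuousOn_inv_height h₂).neg
  · refine ContinuousOn.div ?_ (by fun_prop) ?_
    · refine ContinuousOn.add (ContinuousOn.div (by fun_prop) hxc fun t ht => (hxp t ht).ne')
          (ContinuousOn.div (by fun_prop) hyc fun t ht => (hyp t ht).ne')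
    · intro t ht
      have := hxp t ht; have := hyp t ht; positivity
  · intro t ht
    have hx0 := hxp t ht
    have hy0 := hyp t ht
    simp only [hw]
    field_simp
    ring
  · intro t ht
    have hx0 := hxp t ht
    have hy0 := hyp t ht
    simp only [hw]
    rw [abs_neg, abs_of_nonneg (by positivity), div_le_iff₀ (by positivity)]
    nlinarith [hxR t ht]

end PoincareMoment

end


open scoped MatrixGroups ContDiff UpperHalfPlane

noncomputable section

namespace PoincareMoment

open MeasureTheory intervalIntegral Set

/-! ### Phases given by a difference of angles -/

/-- The oscillatory integral with the difference of two angles in the phase, away from the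
stationary point. -/
lemma norm_integral_exp_angle_sub_le_of_away {p₁ p₂ R₁ R₂ R a b ν t₀ δ : ℝ} (hab : a ≤ b)
    (h₁ : ∀ t ∈ Icc a b, |t - p₁| < R₁) (h₂ : ∀ t ∈ Icc a b, |t - p₂| < R₂)
    (hR₁ : R₁ ≤ R) (hR₂ : R₂ ≤ R) (hν : 0 < ν) (hp : p₁ ≠ p₂) (hδ : 0 < δ)
    (ht₀ : ∀ t, R₁ ^ 2 - (t - p₁) ^ 2 - (R₂ ^ 2 - (t - p₂) ^ 2) = 2 * (p₁ - p₂) * (t - t₀))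
    (haway : ∀ t ∈ Icc a b, δ ≤ |t - t₀|) :
    ‖∫ t in a..b, Complex.exp (Complex.I * (ν * (angle p₁ R₁ t - angle p₂ R₂ t) : ℝ))‖
      ≤ 12 * R ^ 3 / (|p₁ - p₂| * δ) / ν := by
  have hu : uIcc a b = Icc a b := uIcc_of_le hab
  have hRpos : 0 < R := ((abs_nonneg _).trans_lt (h₁ a (left_mem_Icc.2 hab))).trans_le hR₁
  have hΔ : 0 < |p₁ - p₂| := abs_pos.2 (sub_ne_zero.2 hp)
  have hba : b - a ≤ 2 * R := by
    have e1 := abs_lt.1 (h₁ a (left_mem_Icc.2 hab))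
    have e2 := abs_lt.1 (h₁ b (right_mem_Icc.2 hab))
    linarith
  set x := height p₁ R₁ with hx
  set y := height p₂ R₂ with hy
  have hxp : ∀ t ∈ Icc a b, 0 < x t := fun t ht => height_pos (h₁ t ht)
  have hyp : ∀ t ∈ Icc a b, 0 < y t := fun t ht => height_pos (h₂ t ht)
  have hxR : ∀ t ∈ Icc a b, x t ≤ R := fun t ht =>
    (height_le ((abs_nonneg _).trans_lt (h₁ t ht)).le).trans hR₁
  have hyR : ∀ t ∈ Icc a b, y t ≤ R := fun t ht =>
    (height_le ((abs_nonneg _).trans_lt (h₂ t ht)).le).trans hR₂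
  have hxd : ∀ t ∈ Icc a b, HasDerivAt x (-(t - p₁) / x t) t :=
    fun t ht => hasDerivAt_height (h₁ t ht)
  have hyd : ∀ t ∈ Icc a b, HasDerivAt y (-(t - p₂) / y t) t :=
    fun t ht => hasDerivAt_height (h₂ t ht)
  have hxc : ContinuousOn x (Icc a b) := fun t ht => (hxd t ht).continuousAt.continuousWithinAt
  have hyc : ContinuousOn y (Icc a b) := fun t ht => (hyd t ht).continuousAt.continuousWithinAt
  have hne : ∀ t ∈ Icc a b, t - t₀ ≠ 0 := fun t ht => abs_pos.1 (hδ.trans_le (haway t ht))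
  -- The phase derivative is 1/y − 1/x = (x² − y²)/(xy(x + y)). Its numerator x² − y² is affine in t
  -- by `ht₀`, so there is one stationary point t₀ and the reciprocal is N/D with N = xy(x + y).
  set D : ℝ → ℝ := fun t => 2 * (p₁ - p₂) * (t - t₀) with hD
  have hDne : ∀ t ∈ Icc a b, D t ≠ 0 := fun t ht =>
    mul_ne_zero (mul_ne_zero two_ne_zero (sub_ne_zero.2 hp)) (hne t ht)
  have hDabs : ∀ t ∈ Icc a b, 2 * |p₁ - p₂| * δ ≤ |D t| := by
    intro t ht
    simp only [hD, abs_mul, abs_two]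
    gcongr
    exact haway t ht
  have hxy : ∀ t ∈ Icc a b, x t ^ 2 - y t ^ 2 = D t := by
    intro t ht
    rw [hx, hy, height_sq (h₁ t ht), height_sq (h₂ t ht), ht₀ t]
  set N : ℝ → ℝ := fun t => x t * y t * (x t + y t) with hN
  set N' : ℝ → ℝ := fun t => -(2 * (t - p₁) * y t) - x t ^ 2 * (t - p₂) / y t
    - y t ^ 2 * (t - p₁) / x t - 2 * (t - p₂) * x t with hN'
  have hNd : ∀ t ∈ Icc a b, HasDerivAt N (N' t) t := by
    intro t ht
    have hx0 := (hxp t ht).ne'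
    have hy0 := (hyp t ht).ne'
    have := ((hxd t ht).mul (hyd t ht)).mul ((hxd t ht).add (hyd t ht))
    convert! this using 1
    simp only [hN', Pi.add_apply, Pi.mul_apply]
    field_simp
    ring
  have hNabs : ∀ t ∈ Icc a b, |N t| ≤ 2 * R ^ 3 := by
    intro t ht
    have hx0 := hxp t ht
    have hy0 := hyp t ht
    simp only [hN]
    rw [abs_of_nonneg (by positivity)]
    calc x t * y t * (x t + y t) ≤ R * R * (R + R) := by
          gcongr
          · exact hxR t ht
          · exact hyR t ht
          · exact hxR t ht
          · exact hyR t ht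
      _ = _ := by ring
  have hN'c : ContinuousOn N' (Icc a b) := by
    refine ((ContinuousOn.sub (by fun_prop) ?_).sub ?_).sub (by fun_prop)
    · exact ContinuousOn.div (by fun_prop) hyc fun t ht => (hyp t ht).ne'
    · exact ContinuousOn.div (by fun_prop) hxc fun t ht => (hxp t ht).ne'
  have hN'abs : ∀ t ∈ Icc a b,
      |N' t| ≤ 4 * R ^ 2 + (R ^ 3 * (1 / x t) + R ^ 3 * (1 / y t)) := by
    intro t ht
    have hx0 := hxp t ht
    have hy0 := hyp t ht
    have a1 : |t - p₁| ≤ R := (h₁ t ht).le.trans hR₁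
    have a2 : |t - p₂| ≤ R := (h₂ t ht).le.trans hR₂
    have e1 : |2 * (t - p₁) * y t| ≤ 2 * R ^ 2 := by
      rw [abs_mul, abs_mul, abs_two, abs_of_pos hy0]
      calc 2 * |t - p₁| * y t ≤ 2 * R * R := by gcongr; exact hyR t ht
        _ = _ := by ring
    have e2 : |2 * (t - p₂) * x t| ≤ 2 * R ^ 2 := by
      rw [abs_mul, abs_mul, abs_two, abs_of_pos hx0]
      calc 2 * |t - p₂| * x t ≤ 2 * R * R := by gcongr; exact hxR t ht
        _ = _ := by ring
    have e3 : |x t ^ 2 * (t - p₂) / y t| ≤ R ^ 3 * (1 / y t) := by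
      rw [abs_div, abs_mul, abs_of_pos hy0, abs_of_pos (pow_pos hx0 2), mul_one_div]
      gcongr
      calc x t ^ 2 * |t - p₂| ≤ R ^ 2 * R := by gcongr; exact hxR t ht
        _ = _ := by ring
    have e4 : |y t ^ 2 * (t - p₁) / x t| ≤ R ^ 3 * (1 / x t) := by
      rw [abs_div, abs_mul, abs_of_pos hx0, abs_of_pos (pow_pos hy0 2), mul_one_div]
      gcongr
      calc y t ^ 2 * |t - p₁| ≤ R ^ 2 * R := by gcongr; exact hyR t ht
        _ = _ := by ring
    simp only [hN']
    rw [abs_le] at *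
    constructor <;> linarith [e1.1, e1.2, e2.1, e2.2, e3.1, e3.2, e4.1, e4.2]
  set w : ℝ → ℝ := fun t => N t / D t with hw
  set w' : ℝ → ℝ := fun t => N' t / D t - N t * (2 * (p₁ - p₂)) / D t ^ 2 with hw'
  have hDd : ∀ t, HasDerivAt D (2 * (p₁ - p₂)) t := by
    intro t
    simpa using ((hasDerivAt_id t).sub_const t₀).const_mul (2 * (p₁ - p₂))
  have hDc : Continuous D := by fun_prop
  have hNc : ContinuousOn N (Icc a b) := fun t ht => (hNd t ht).continuousAt.continuousWithinAt
  have hw'c : ContinuousOn w' (Icc a b) := by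
    refine ContinuousOn.sub (hN'c.div hDc.continuousOn hDne)
      (ContinuousOn.div (by fun_prop) (by fun_prop) fun t ht => pow_ne_zero 2 (hDne t ht))
  have hsq : ∫ t in a..b, 1 / (t - t₀) ^ 2 ≤ 2 / δ := by
    have hc : ContinuousOn (fun t : ℝ => 1 / (t - t₀) ^ 2) (Icc a b) :=
      ContinuousOn.div (by fun_prop) (by fun_prop) fun t ht => pow_ne_zero 2 (hne t ht)
    have h1 := integral_eq_sub_of_hasDerivAt (a := a) (b := b) (f := fun t => -(t - t₀)⁻¹)
      (f' := fun t => 1 / (t - t₀) ^ 2)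
      (fun t ht => by
        have := (((hasDerivAt_id t).sub_const t₀).inv (hne t (hu ▸ ht))).neg
        convert! this using 1
        simp [neg_div])
      (ContinuousOn.intervalIntegrable (hu ▸ hc))
    rw [h1]
    have e1 : |(b - t₀)⁻¹| ≤ 1 / δ := by
      rw [abs_inv, ← one_div]
      exact one_div_le_one_div_of_le hδ (haway b (right_mem_Icc.2 hab))
    have e2 : |(a - t₀)⁻¹| ≤ 1 / δ := by
      rw [abs_inv, ← one_div]
      exact one_div_le_one_div_of_le hδ (haway a (left_mem_Icc.2 hab))
    have : 2 / δ = 1 / δ + 1 / δ := by ring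
    rw [this]
    linarith [(abs_le.1 e1).1, (abs_le.1 e2).2]
  have hi : ∀ (p r : ℝ), (∀ t ∈ Icc a b, |t - p| < r) →
      IntervalIntegrable (fun t => 1 / height p r t) volume a b := fun p r h =>
    ContinuousOn.intervalIntegrable (hu ▸ continuousOn_inv_height h)
  have hi3 : IntervalIntegrable (fun t => 1 / (t - t₀) ^ 2) volume a b := by
    refine ContinuousOn.intervalIntegrable ?_
    rw [hu]
    exact ContinuousOn.div (by fun_prop) (by fun_prop) fun t ht => pow_ne_zero 2 (hne t ht)
  set E := |p₁ - p₂| * δ with hE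
  have hEpos : 0 < E := mul_pos hΔ hδ
  -- Quotient rule: N'/D is controlled by the integrals of the inverse heights, and ND'/D² by ∫ (t −
  -- t₀)⁻² ≤ 2/δ. Together they give 4 + π + 2 ≤ 10.
  have hV : ∫ t in a..b, |w' t| ≤ 10 * R ^ 3 / E := by
    have hi4 : IntervalIntegrable (fun t => 4 * R ^ 2 + (R ^ 3 * (1 / x t) + R ^ 3 * (1 / y t)))
        volume a b :=
      (intervalIntegrable_const).add (((hi _ _ h₁).const_mul _).add ((hi _ _ h₂).const_mul _))
    calc ∫ t in a..b, |w' t|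
        ≤ ∫ t in a..b, (1 / (2 * E) * (4 * R ^ 2 + (R ^ 3 * (1 / x t) + R ^ 3 * (1 / y t)))
            + R ^ 3 / |p₁ - p₂| * (1 / (t - t₀) ^ 2)) := by
          refine integral_mono_on hab ?_ ?_ ?_
          · exact ContinuousOn.intervalIntegrable (hu ▸ hw'c.abs)
          · exact (hi4.const_mul _).add (hi3.const_mul _)
          · intro t ht
            have hDa := hDabs t ht
            simp only [hw']
            refine (abs_sub _ _).trans (add_le_add ?_ ?_)
            · rw [abs_div, one_div_mul_eq_div]
              refine div_le_div₀ (by have := hxp t ht; have := hyp t ht; positivity)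
                (hN'abs t ht) (by positivity) (by rw [hE]; linarith)
            · have hne' := hne t ht
              have : D t ^ 2 = 4 * |p₁ - p₂| ^ 2 * (t - t₀) ^ 2 := by
                rw [sq_abs]; simp only [hD]; ring
              rw [this, abs_div, abs_mul (N t), abs_mul 2, abs_two,
                abs_of_nonneg (by positivity : 0 ≤ 4 * |p₁ - p₂| ^ 2 * (t - t₀) ^ 2),
                div_mul_div_comm, mul_one]
              have ht2 : 0 < (t - t₀) ^ 2 := by positivity
              rw [div_le_div_iff₀ (by positivity) (by positivity)]
              calc |N t| * (2 * |p₁ - p₂|) * (|p₁ - p₂| * (t - t₀) ^ 2)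
                  ≤ 2 * R ^ 3 * (2 * |p₁ - p₂|) * (|p₁ - p₂| * (t - t₀) ^ 2) := by
                    gcongr; exact hNabs t ht
                _ = _ := by ring
      _ = 1 / (2 * E) * ((b - a) * (4 * R ^ 2) + (R ^ 3 * (∫ t in a..b, 1 / x t)
            + R ^ 3 * ∫ t in a..b, 1 / y t))
            + R ^ 3 / |p₁ - p₂| * ∫ t in a..b, 1 / (t - t₀) ^ 2 := by
          rw [intervalIntegral.integral_add (hi4.const_mul _) (hi3.const_mul _),
            intervalIntegral.integral_const_mul, intervalIntegral.integral_const_mul,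
            intervalIntegral.integral_add intervalIntegrable_const
              (((hi _ _ h₁).const_mul _).add ((hi _ _ h₂).const_mul _)),
            intervalIntegral.integral_add ((hi _ _ h₁).const_mul _) ((hi _ _ h₂).const_mul _)]
          simp only [intervalIntegral.integral_const_mul, intervalIntegral.integral_const,
            smul_eq_mul]
          ring
      _ ≤ 1 / (2 * E) * ((2 * R) * (4 * R ^ 2) + (R ^ 3 * Real.pi + R ^ 3 * Real.pi))
            + R ^ 3 / |p₁ - p₂| * (2 / δ) := by
          gcongr
          · exact integral_inv_height_le hab h₁
          · exact integral_inv_height_le hab h₂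
      _ = R ^ 3 * (4 + Real.pi + 2) / E := by
          rw [hE]; field_simp; ring
      _ ≤ _ := by
          rw [mul_comm 10]
          gcongr
          linarith [Real.pi_lt_four]
  have hmain := norm_integral_exp_le_of_variation (ψ := fun t => angle p₁ R₁ t - angle p₂ R₂ t)
    (ψ' := fun t => -(1 / x t) - -(1 / y t)) (w := w) (w' := w') (K := R ^ 3 / E) (ν := ν) hab
    (fun t ht => (hasDerivAt_angle (h₁ t ht)).sub (hasDerivAt_angle (h₂ t ht)))
    ?_ ?_ hw'c ?_ ?_ hV hν
  · refine hmain.trans (le_of_eq ?_)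
    ring
  · intro t ht
    have := (hNd t ht).div (hDd t) (hDne t ht)
    convert! this using 1
    simp only [hw']
    have := hDne t ht
    field_simp
  · exact ((continuousOn_inv_height h₁).neg).sub (continuousOn_inv_height h₂).neg
  · intro t ht
    have hx0 := hxp t ht
    have hy0 := hyp t ht
    have hD0 := hDne t ht
    simp only [hw, hN]
    rw [← hxy t ht] at hD0 ⊢
    field_simp
    ring
  · intro t ht
    simp only [hw]
    rw [abs_div, div_le_div_iff₀ (abs_pos.2 (hDne t ht)) hEpos]
    calc |N t| * E ≤ 2 * R ^ 3 * E := by gcongr; exact hNabs t ht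
      _ = R ^ 3 * (2 * |p₁ - p₂| * δ) := by rw [hE]; ring
      _ ≤ _ := by gcongr; exact hDabs t ht

/-- Excising |t − t₀| < δ costs 2δ, and each outer piece costs 12R³/(ν|p₁ − p₂|δ). The choice of δ
makes each outer piece 12δ, whence 2·12 + 2 = 26. -/
lemma norm_integral_exp_angle_sub_le {p₁ p₂ R₁ R₂ R a b ν : ℝ} (hab : a ≤ b)
    (h₁ : ∀ t ∈ Icc a b, |t - p₁| < R₁) (h₂ : ∀ t ∈ Icc a b, |t - p₂| < R₂)
    (hR₁ : R₁ ≤ R) (hR₂ : R₂ ≤ R) (hν : 0 < ν) (hp : p₁ ≠ p₂) :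
    ‖∫ t in a..b, Complex.exp (Complex.I * (ν * (angle p₁ R₁ t - angle p₂ R₂ t) : ℝ))‖
      ≤ 26 * √(R ^ 3 / (ν * |p₁ - p₂|)) := by
  have hRpos : 0 < R := ((abs_nonneg _).trans_lt (h₁ a (left_mem_Icc.2 hab))).trans_le hR₁
  have hΔ : 0 < |p₁ - p₂| := abs_pos.2 (sub_ne_zero.2 hp)
  set δ := √(R ^ 3 / (ν * |p₁ - p₂|)) with hδ
  have hδpos : 0 < δ := Real.sqrt_pos.2 (by positivity)
  have hδsq : δ ^ 2 = R ^ 3 / (ν * |p₁ - p₂|) := Real.sq_sqrt (by positivity)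
  -- The abscissa at which the squares of the two heights agree, on the radical axis of the two
  -- circles.
  set t₀ := (R₂ ^ 2 - R₁ ^ 2 + p₁ ^ 2 - p₂ ^ 2) / (2 * (p₁ - p₂)) with ht₀
  have hE : 12 * R ^ 3 / (|p₁ - p₂| * δ) / ν = 12 * δ := by
    have : 12 * R ^ 3 / (|p₁ - p₂| * δ) / ν = 12 * (R ^ 3 / (ν * |p₁ - p₂|)) / δ := by
      field_simp
    rw [this, ← hδsq]
    field_simp
  have hcont : Continuous fun t =>
      Complex.exp (Complex.I * (ν * (angle p₁ R₁ t - angle p₂ R₂ t) : ℝ)) := by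
    have := continuous_angle p₁ R₁
    have := continuous_angle p₂ R₂
    fun_prop
  have := norm_integral_le_of_away (t₀ := t₀) (δ := δ) (E := 12 * δ) hab hδpos.le (by positivity)
    hcont.continuousOn
    (fun t => by rw [mul_comm]; exact (Complex.norm_exp_ofReal_mul_I _).le)
    (fun a' b' ha' hab' hb' haway => by
      rw [← hE]
      have hsub : Icc a' b' ⊆ Icc a b := Icc_subset_Icc ha' hb'
      refine norm_integral_exp_angle_sub_le_of_away hab' (fun t ht => h₁ t (hsub ht))
        (fun t ht => h₂ t (hsub ht)) hR₁ hR₂ hν hp hδpos (fun t => ?_) haway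
      have := sub_ne_zero.2 hp
      rw [ht₀]
      field_simp
      ring)
  linarith

/-! ### Waves on half circles and their correlations -/

/-- The wave `sin (ν φ)` along the half circle with centre `p` and radius `R`; it vanishes outside
the interval `[p - R, p + R]`. -/
def wave (ν : ℕ) (p R t : ℝ) : ℝ := Real.sin (ν * angle p R t)

lemma continuous_wave (ν : ℕ) (p R : ℝ) : Continuous (wave ν p R) := by
  have := continuous_angle p R
  unfold wave
  fun_prop

lemma abs_wave_le_one (ν : ℕ) (p R t : ℝ) : |wave ν p R t| ≤ 1 := Real.abs_sin_le_one _

/-- `Real.arccos` is constantly 0 or π outside [−1, 1], and sin(νπ) = 0 because ν is an integer. So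
the wave extends continuously by zero without any cutoff. -/
lemma wave_eq_zero {ν : ℕ} {p R t : ℝ} (hR : 0 < R) (h : R ≤ |t - p|) : wave ν p R t = 0 := by
  unfold wave angle
  rcases le_abs.1 h with h | h
  · rw [Real.arccos_of_one_le ((one_le_div hR).2 h)]
    simp
  · rw [Real.arccos_of_le_neg_one]
    · exact Real.sin_nat_mul_pi ν
    · rw [div_le_iff₀ hR]; linarith

lemma integral_wave_mul_wave_eq (ν : ℕ) {p₁ p₂ R₁ R₂ : ℝ} (hR₁ : 0 < R₁) (hR₂ : 0 < R₂)
    {a b : ℝ} (hab : a ≤ b) (ha : a = max (p₁ - R₁) (p₂ - R₂))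
    (hb : b = min (p₁ + R₁) (p₂ + R₂)) :
    ∫ t, wave ν p₁ R₁ t * wave ν p₂ R₂ t = ∫ t in a..b, wave ν p₁ R₁ t * wave ν p₂ R₂ t := by
  rw [intervalIntegral.integral_of_le hab, ← integral_Icc_eq_integral_Ioc,
    setIntegral_eq_integral_of_forall_compl_eq_zero]
  intro t ht
  by_contra hne
  apply ht
  have e1 : |t - p₁| < R₁ := by
    by_contra h'
    exact hne (by rw [wave_eq_zero hR₁ (not_lt.1 h'), zero_mul])
  have e2 : |t - p₂| < R₂ := by
    by_contra h'
    exact hne (by rw [wave_eq_zero hR₂ (not_lt.1 h'), mul_zero])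
  rw [abs_lt] at e1 e2
  rw [ha, hb]
  exact ⟨max_le (by linarith [e1.1]) (by linarith [e2.1]), le_min (by linarith [e1.2])
    (by linarith [e2.2])⟩

lemma wave_mul_wave_eq_zero {ν : ℕ} {p₁ p₂ R₁ R₂ R : ℝ} (hR₁ : 0 < R₁) (hR₂ : 0 < R₂)
    (h₁ : R₁ ≤ R) (h₂ : R₂ ≤ R) (h : 2 * R ≤ |p₁ - p₂|) (t : ℝ) :
    wave ν p₁ R₁ t * wave ν p₂ R₂ t = 0 := by
  by_cases e1 : R₁ ≤ |t - p₁|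
  · rw [wave_eq_zero hR₁ e1, zero_mul]
  · rw [wave_eq_zero hR₂, mul_zero]
    have := abs_sub_abs_le_abs_sub (p₁ - p₂) (p₁ - t)
    have e : p₁ - p₂ - (p₁ - t) = t - p₂ := by ring
    rw [e, abs_sub_comm p₁ t] at this
    linarith [not_le.1 e1]

lemma abs_integral_wave_mul_wave_le (ν : ℕ) {p₁ p₂ R₁ R₂ R : ℝ} (hR₁ : 0 < R₁) (hR₂ : 0 < R₂)
    (h₁ : R₁ ≤ R) (h₂ : R₂ ≤ R) :
    |∫ t, wave ν p₁ R₁ t * wave ν p₂ R₂ t| ≤ 2 * R := by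
  by_cases hp : 2 * R ≤ |p₁ - p₂|
  · simp only [wave_mul_wave_eq_zero hR₁ hR₂ h₁ h₂ hp, integral_zero, abs_zero]
    linarith
  · set a := max (p₁ - R₁) (p₂ - R₂) with ha
    set b := min (p₁ + R₁) (p₂ + R₂) with hb
    by_cases hab : a ≤ b
    · rw [integral_wave_mul_wave_eq ν hR₁ hR₂ hab ha hb, ← Real.norm_eq_abs]
      have := norm_integral_le_of_norm_le_const (a := a) (b := b)
        (f := fun t => wave ν p₁ R₁ t * wave ν p₂ R₂ t) (C := 1) (fun t _ => by
          rw [norm_mul, Real.norm_eq_abs, Real.norm_eq_abs]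
          exact mul_le_one₀ (abs_wave_le_one _ _ _ _) (abs_nonneg _) (abs_wave_le_one _ _ _ _))
      refine this.trans ?_
      rw [one_mul, abs_of_nonneg (by linarith)]
      have := le_max_left (p₁ - R₁) (p₂ - R₂)
      have := min_le_left (p₁ + R₁) (p₂ + R₂)
      linarith
    · have : ∀ t, wave ν p₁ R₁ t * wave ν p₂ R₂ t = 0 := by
        intro t
        by_contra hne
        apply hab
        have e1 : |t - p₁| < R₁ := by
          by_contra h'
          exact hne (by rw [wave_eq_zero hR₁ (not_lt.1 h'), zero_mul])
        have e2 : |t - p₂| < R₂ := by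
          by_contra h'
          exact hne (by rw [wave_eq_zero hR₂ (not_lt.1 h'), mul_zero])
        rw [abs_lt] at e1 e2
        refine (max_le (by linarith [e1.1]) (by linarith [e2.1]) : a ≤ t).trans
          (le_min (by linarith [e1.2]) (by linarith [e2.2]))
      simp only [this, integral_zero, abs_zero]
      linarith

/-- The product of sines is half the difference of the cosines of the difference and of the sum of
the angles. The sum phase gives 10R/ν, which is absorbed since ν ≥ 1 and |p₁ − p₂| ≤ 2R; altogether
26/2 + (10/2)(8/5) = 21. -/
lemma abs_integral_wave_mul_wave_le_of_interior {ν : ℕ} (hν : 0 < ν) {p₁ p₂ R₁ R₂ R a b : ℝ}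
    (hab : a ≤ b)
    (h₁ : ∀ t ∈ Icc a b, |t - p₁| < R₁) (h₂ : ∀ t ∈ Icc a b, |t - p₂| < R₂)
    (hR₁ : R₁ ≤ R) (hR₂ : R₂ ≤ R) (hp : p₁ ≠ p₂) :
    |∫ t in a..b, wave ν p₁ R₁ t * wave ν p₂ R₂ t| ≤ 21 * √(R ^ 3 / (ν * |p₁ - p₂|)) := by
  have hν' : (1 : ℝ) ≤ ν := by exact_mod_cast hν
  have hRpos : 0 < R := ((abs_nonneg _).trans_lt (h₁ a (left_mem_Icc.2 hab))).trans_le hR₁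
  have hΔ : 0 < |p₁ - p₂| := abs_pos.2 (sub_ne_zero.2 hp)
  have hΔR : |p₁ - p₂| ≤ 2 * R := by
    have e1 := h₁ a (left_mem_Icc.2 hab)
    have e2 := h₂ a (left_mem_Icc.2 hab)
    have := abs_sub_le p₁ a p₂
    rw [abs_sub_comm p₁ a] at this
    linarith
  have c1 := continuous_angle p₁ R₁
  have c2 := continuous_angle p₂ R₂
  have hcos : ∀ g : ℝ → ℝ, Continuous g → |∫ t in a..b, Real.cos (ν * g t)| ≤
      ‖∫ t in a..b, Complex.exp (Complex.I * (ν * g t : ℝ))‖ := by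
    intro g hg
    have : ∫ t in a..b, Real.cos (ν * g t)
        = (∫ t in a..b, Complex.exp (Complex.I * (ν * g t : ℝ))).re := by
      have hi : IntervalIntegrable (fun t => Complex.exp (Complex.I * (ν * g t : ℝ))) volume a b :=
        Continuous.intervalIntegrable (by fun_prop) _ _
      rw [← Complex.reCLM_apply, ← Complex.reCLM.intervalIntegral_comp_comm hi]
      refine integral_congr fun t _ => ?_
      simp only [Complex.reCLM_apply]
      rw [mul_comm Complex.I, Complex.exp_ofReal_mul_I_re]
    rw [this]
    exact Complex.abs_re_le_norm _
  have hprod : ∫ t in a..b, wave ν p₁ R₁ t * wave ν p₂ R₂ t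
      = 1 / 2 * (∫ t in a..b, Real.cos (ν * (angle p₁ R₁ t - angle p₂ R₂ t)))
        - 1 / 2 * ∫ t in a..b, Real.cos (ν * (angle p₁ R₁ t + angle p₂ R₂ t)) := by
    rw [← intervalIntegral.integral_const_mul, ← intervalIntegral.integral_const_mul,
      ← intervalIntegral.integral_sub]
    · refine integral_congr fun t _ => ?_
      simp only [wave, mul_sub, mul_add, Real.cos_sub, Real.cos_add]
      ring
    · exact Continuous.intervalIntegrable (by fun_prop) _ _
    · exact Continuous.intervalIntegrable (by fun_prop) _ _
  have b1 := (hcos _ (c1.sub c2)).trans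
    (norm_integral_exp_angle_sub_le (ν := ν) hab h₁ h₂ hR₁ hR₂ (by linarith) hp)
  have b2 := (hcos _ (c1.add c2)).trans
    (norm_integral_exp_angle_add_le (ν := ν) hab h₁ h₂ hR₁ hR₂ (by linarith))
  simp only [Pi.sub_apply, Pi.add_apply] at b1 b2
  have b3 : R / ν ≤ 8 / 5 * √(R ^ 3 / (ν * |p₁ - p₂|)) := by
    have : R / ν ≤ √(2 * (R ^ 3 / (ν * |p₁ - p₂|))) := by
      apply Real.le_sqrt_of_sq_le
      rw [div_pow, ← mul_div_assoc, div_le_div_iff₀ (by positivity) (by positivity)]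
      have : (0:ℝ) < ν := by linarith
      calc R ^ 2 * (ν * |p₁ - p₂|) ≤ R ^ 2 * (ν * (2 * R)) := by gcongr
        _ = 2 * R ^ 3 * ν := by ring
        _ ≤ 2 * R ^ 3 * ν ^ 2 := by
          gcongr
          nlinarith
    refine this.trans ?_
    rw [Real.sqrt_mul zero_le_two]
    gcongr
    rw [Real.sqrt_le_left (by norm_num)]
    norm_num
  rw [hprod]
  have e : 10 * R / (ν : ℝ) = 10 * (R / ν) := by ring
  rw [e] at b2
  rw [abs_le] at b1 b2 ⊢
  have hs : 0 ≤ √(R ^ 3 / (ν * |p₁ - p₂|)) := Real.sqrt_nonneg _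
  constructor <;> linarith [b1.1, b1.2, b2.1, b2.2]

/-- The correlation of two waves decays with the distance of the centres. -/
theorem abs_integral_wave_mul_wave_le_sqrt {ν : ℕ} (hν : 0 < ν) {p₁ p₂ R₁ R₂ R : ℝ}
    (hR₁ : 0 < R₁) (hR₂ : 0 < R₂) (h₁ : R₁ ≤ R) (h₂ : R₂ ≤ R) (hp : p₁ ≠ p₂) :
    |∫ t, wave ν p₁ R₁ t * wave ν p₂ R₂ t| ≤ 21 * √(R ^ 3 / (ν * |p₁ - p₂|)) := by
  set a := max (p₁ - R₁) (p₂ - R₂) with ha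
  set b := min (p₁ + R₁) (p₂ + R₂) with hb
  have hcont : Continuous fun t => wave ν p₁ R₁ t * wave ν p₂ R₂ t :=
    (continuous_wave _ _ _).mul (continuous_wave _ _ _)
  by_cases hab : a < b
  · rw [integral_wave_mul_wave_eq ν hR₁ hR₂ hab.le ha hb]
    set c := (a + b) / 2 with hc
    -- At the ends of the common support a height vanishes and the angle is not differentiable. The
    -- estimate is applied to [a + s, b − s], uniformly in s, and then s → 0.
    have key : ∀ s ∈ Ioo (0 : ℝ) ((b - a) / 2),
        |∫ t in (a + s)..(b - s), wave ν p₁ R₁ t * wave ν p₂ R₂ t|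
          ≤ 21 * √(R ^ 3 / (ν * |p₁ - p₂|)) := by
      intro s hs
      have i1 := le_max_left (p₁ - R₁) (p₂ - R₂)
      have i2 := le_max_right (p₁ - R₁) (p₂ - R₂)
      have i3 := min_le_left (p₁ + R₁) (p₂ + R₂)
      have i4 := min_le_right (p₁ + R₁) (p₂ + R₂)
      refine abs_integral_wave_mul_wave_le_of_interior hν (by linarith [hs.2]) ?_ ?_ h₁ h₂ hp
      · intro t ht
        rw [abs_lt]
        constructor <;> linarith [ht.1, ht.2, hs.1]
      · intro t ht
        rw [abs_lt]
        constructor <;> linarith [ht.1, ht.2, hs.1]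
    have hlim : Filter.Tendsto
        (fun s => |∫ t in (a + s)..(b - s), wave ν p₁ R₁ t * wave ν p₂ R₂ t|)
        (nhdsWithin 0 (Ioi 0)) (nhds |∫ t in a..b, wave ν p₁ R₁ t * wave ν p₂ R₂ t|) := by
      have hF : Continuous fun s : ℝ => |∫ t in (a + s)..(b - s), wave ν p₁ R₁ t * wave ν p₂ R₂ t| := by
        have hP := continuous_primitive (μ := volume) (fun x y => hcont.intervalIntegrable x y) c
        have : (fun s : ℝ => ∫ t in (a + s)..(b - s), wave ν p₁ R₁ t * wave ν p₂ R₂ t)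
            = fun s => (∫ t in c..(b - s), wave ν p₁ R₁ t * wave ν p₂ R₂ t)
              - ∫ t in c..(a + s), wave ν p₁ R₁ t * wave ν p₂ R₂ t := by
          funext s
          rw [integral_interval_sub_left] <;> exact hcont.intervalIntegrable _ _
        refine Continuous.abs ?_
        rw [this]
        exact (hP.comp (by fun_prop)).sub (hP.comp (by fun_prop))
      have := hF.tendsto 0
      simp only [add_zero, sub_zero] at this
      exact this.mono_left nhdsWithin_le_nhds
    refine le_of_tendsto hlim ?_
    have : Ioo (0 : ℝ) ((b - a) / 2) ∈ nhdsWithin 0 (Ioi 0) := Ioo_mem_nhdsGT (by linarith)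
    filter_upwards [this] with s hs using key s hs
  · have : ∀ t, wave ν p₁ R₁ t * wave ν p₂ R₂ t = 0 := by
      intro t
      by_contra hne
      apply hab
      have e1 : |t - p₁| < R₁ := by
        by_contra h'
        exact hne (by rw [wave_eq_zero hR₁ (not_lt.1 h'), zero_mul])
      have e2 : |t - p₂| < R₂ := by
        by_contra h'
        exact hne (by rw [wave_eq_zero hR₂ (not_lt.1 h'), mul_zero])
      rw [abs_lt] at e1 e2
      refine (max_lt (by linarith [e1.1]) (by linarith [e2.1]) : a < t).trans
        (lt_min (by linarith [e1.2]) (by linarith [e2.2]))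
    simp only [this, integral_zero, abs_zero]
    positivity

end PoincareMoment

end


open scoped MatrixGroups ContDiff UpperHalfPlane

noncomputable section

namespace PoincareMoment

open MeasureTheory intervalIntegral Set

/-! ### The Bessel integral -/

/-- The Bessel integral `∫_0^π cos (ν φ) e^{i x cos φ} dφ = π i^ν J_ν(x)`. -/
def besselInt (ν : ℕ) (x : ℝ) : ℂ :=
  ∫ φ in (0 : ℝ)..Real.pi, (Real.cos (ν * φ) : ℂ) * Complex.exp (Complex.I * (x * Real.cos φ : ℝ))

/-- The stationary point φ₀ = arcsin(s/x) lies within π/6 of 0. On [0, π/2] the phase derivative has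
size at least x|t − φ₀|/π, so excising a neighbourhood of radius x^{−1/2} gives the bound. On this
half of the range the second zero of the derivative is avoided, and the cosine is nonnegative, which
makes the reciprocal of the phase derivative monotone on each remaining piece. -/
lemma norm_integral_exp_cos_half_le {x s : ℝ} (hx : 0 < x) (hs : 2 * |s| ≤ x) :
    ‖∫ φ in (0 : ℝ)..(Real.pi / 2), Complex.exp (Complex.I * (x * Real.cos φ + s * φ : ℝ))‖
      ≤ 40 / √x := by
  have hpi := Real.pi_pos
  have hsx : |s / x| ≤ 1 / 2 := by
    rw [abs_div, abs_of_pos hx, div_le_iff₀ hx]; linarith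
  have hsx' := abs_le.1 hsx
  set φ₀ := Real.arcsin (s / x) with hφ₀
  have hsin : Real.sin φ₀ = s / x := Real.sin_arcsin (by linarith) (by linarith)
  have hφl : -(Real.pi / 6) ≤ φ₀ := by
    rw [hφ₀, Real.le_arcsin_iff_sin_le' ⟨by linarith, by linarith⟩, Real.sin_neg,
      Real.sin_pi_div_six]
    linarith
  have hφu : φ₀ ≤ Real.pi / 6 := by
    rw [hφ₀, Real.arcsin_le_iff_le_sin' ⟨by linarith, by linarith⟩, Real.sin_pi_div_six]
    linarith
  have hlow : ∀ t ∈ Icc (0 : ℝ) (Real.pi / 2), x * |t - φ₀| / Real.pi ≤ |s - x * Real.sin t| := by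
    intro t ht
    have e : s - x * Real.sin t = -(x * (Real.sin t - Real.sin φ₀)) := by
      rw [hsin]; field_simp; ring
    rw [e, abs_neg, abs_mul, abs_of_pos hx, Real.sin_sub_sin, abs_mul, abs_mul, abs_two, mul_div_assoc]
    gcongr
    -- The point (t + φ₀)/2 lies in [−π/12, π/3].
    have hc : 1 / 2 ≤ Real.cos ((t + φ₀) / 2) := by
      rw [← Real.cos_pi_div_three, ← Real.cos_abs ((t + φ₀) / 2)]
      refine Real.cos_le_cos_of_nonneg_of_le_pi (abs_nonneg _) (by linarith) ?_
      rw [abs_le]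
      constructor <;> linarith [ht.1, ht.2]
    have hs : 2 / Real.pi * |(t - φ₀) / 2| ≤ |Real.sin ((t - φ₀) / 2)| := by
      refine Real.mul_abs_le_abs_sin ?_
      rw [abs_le]
      constructor <;> linarith [ht.1, ht.2]
    rw [abs_of_nonneg (by linarith : 0 ≤ Real.cos ((t + φ₀) / 2))]
    calc |t - φ₀| / Real.pi = 2 * (2 / Real.pi * |(t - φ₀) / 2|) * (1 / 2) := by
          rw [abs_div, abs_two]; field_simp
      _ ≤ _ := by gcongr
  set δ := 1 / √x with hδ
  have hsq : 0 < √x := Real.sqrt_pos.2 hx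
  have hδpos : 0 < δ := by positivity
  have hxδ : x * δ = √x := by
    rw [hδ, mul_one_div, Real.div_sqrt]
  set E := 4 * (Real.pi / √x) with hE
  have hmain := norm_integral_le_of_away (a := 0) (b := Real.pi / 2) (t₀ := φ₀) (δ := δ) (E := E)
    (f := fun φ => Complex.exp (Complex.I * (x * Real.cos φ + s * φ : ℝ)))
    (by linarith) hδpos.le (by positivity) (by fun_prop)
    (fun t => by rw [mul_comm]; exact (Complex.norm_exp_ofReal_mul_I _).le) ?_
  · refine hmain.trans ?_
    rw [hE, hδ, show (40 : ℝ) / √x = (40 : ℝ) * (1 / √x) by ring,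
      show 2 * (4 * (Real.pi / √x)) + 2 * (1 / √x) = (8 * Real.pi + 2) * (1 / √x) by ring]
    gcongr
    linarith [Real.pi_lt_four]
  · intro a b ha hab hb haway
    have hu : uIcc a b = Icc a b := uIcc_of_le hab
    have hsub : ∀ t ∈ Icc a b, t ∈ Icc (0 : ℝ) (Real.pi / 2) := fun t ht => Icc_subset_Icc ha hb ht
    have hlow' : ∀ t ∈ Icc a b, √x / Real.pi ≤ |s - x * Real.sin t| := by
      intro t ht
      refine le_trans ?_ (hlow t (hsub t ht))
      rw [← hxδ]
      gcongr
      exact haway t ht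
    have hpos : 0 < √x / Real.pi := by positivity
    have hne : ∀ t ∈ Icc a b, s - x * Real.sin t ≠ 0 := fun t ht =>
      abs_pos.1 (hpos.trans_le (hlow' t ht))
    have hinv : ∀ t ∈ Icc a b, |(s - x * Real.sin t)⁻¹| ≤ Real.pi / √x := by
      intro t ht
      rw [abs_inv, ← inv_div]
      exact inv_anti₀ hpos (hlow' t ht)
    have hd : ∀ t ∈ Icc a b, HasDerivAt (fun t => (s - x * Real.sin t)⁻¹)
        (x * Real.cos t / (s - x * Real.sin t) ^ 2) t := by
      intro t ht
      have := (((Real.hasDerivAt_sin t).const_mul x).const_sub s).inv (hne t ht)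
      convert! this using 1
      ring
    have hc : ContinuousOn (fun t => x * Real.cos t / (s - x * Real.sin t) ^ 2) (Icc a b) :=
      ContinuousOn.div (by fun_prop) (by fun_prop) fun t ht => pow_ne_zero 2 (hne t ht)
    have hV : ∫ t in a..b, |x * Real.cos t / (s - x * Real.sin t) ^ 2| ≤ 2 * (Real.pi / √x) := by
      have e : ∫ t in a..b, |x * Real.cos t / (s - x * Real.sin t) ^ 2|
          = ∫ t in a..b, x * Real.cos t / (s - x * Real.sin t) ^ 2 := by
        refine integral_congr fun t ht => abs_of_nonneg ?_
        have ht' := hsub t (hu ▸ ht)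
        have : 0 ≤ Real.cos t := Real.cos_nonneg_of_mem_Icc ⟨by linarith [ht'.1], ht'.2⟩
        positivity
      rw [e, integral_eq_sub_of_hasDerivAt (fun t ht => hd t (hu ▸ ht))
        (ContinuousOn.intervalIntegrable (hu ▸ hc))]
      have := (abs_le.1 (hinv b (right_mem_Icc.2 hab))).2
      have := (abs_le.1 (hinv a (left_mem_Icc.2 hab))).1
      linarith
    have := norm_integral_exp_le_of_variation (ψ := fun t => x * Real.cos t + s * t)
      (ψ' := fun t => s - x * Real.sin t) (w := fun t => (s - x * Real.sin t)⁻¹)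
      (w' := fun t => x * Real.cos t / (s - x * Real.sin t) ^ 2) (K := Real.pi / √x) (ν := 1) hab
      (fun t ht => by
        have := ((Real.hasDerivAt_cos t).const_mul x).add ((hasDerivAt_id t).const_mul s)
        convert! this using 1
        ring) hd (by fun_prop) hc (fun t ht => inv_mul_cancel₀ (hne t ht)) hinv hV one_pos
    simp only [one_mul, div_one] at this
    rw [hE]
    linarith

/-- The reflection φ ↦ π − φ conjugates the integrand up to a constant of modulus one, so both
halves obey the same bound. -/
lemma norm_integral_exp_cos_le {x s : ℝ} (hx : 0 < x) (hs : 2 * |s| ≤ x) :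
    ‖∫ φ in (0 : ℝ)..Real.pi, Complex.exp (Complex.I * (x * Real.cos φ + s * φ : ℝ))‖
      ≤ 80 / √x := by
  have hc : Continuous fun φ : ℝ => Complex.exp (Complex.I * (x * Real.cos φ + s * φ : ℝ)) := by
    fun_prop
  rw [← integral_add_adjacent_intervals (b := Real.pi / 2) (hc.intervalIntegrable _ _)
    (hc.intervalIntegrable _ _)]
  have h1 := norm_integral_exp_cos_half_le hx hs
  have h2 : ‖∫ φ in (Real.pi / 2)..Real.pi, Complex.exp (Complex.I * (x * Real.cos φ + s * φ : ℝ))‖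
      ≤ 40 / √x := by
    have e := intervalIntegral.integral_comp_sub_left (a := 0) (b := Real.pi / 2)
      (fun φ : ℝ => Complex.exp (Complex.I * (x * Real.cos φ + s * φ : ℝ))) Real.pi
    rw [sub_zero, show Real.pi - Real.pi / 2 = Real.pi / 2 by ring] at e
    rw [← e]
    have e2 : ∀ φ : ℝ, Complex.exp (Complex.I * (x * Real.cos (Real.pi - φ) + s * (Real.pi - φ) : ℝ))
        = Complex.exp (Complex.I * (s * Real.pi : ℝ)) *
          (starRingEnd ℂ) (Complex.exp (Complex.I * (x * Real.cos φ + s * φ : ℝ))) := by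
      intro φ
      rw [← Complex.exp_conj, ← Complex.exp_add, Real.cos_pi_sub]
      congr 1
      simp only [map_mul, Complex.conj_I, Complex.conj_ofReal]
      push_cast
      ring
    simp only [e2]
    rw [intervalIntegral.integral_const_mul, norm_mul, mul_comm Complex.I,
      Complex.norm_exp_ofReal_mul_I, one_mul]
    have e3 : ∫ φ in (0 : ℝ)..(Real.pi / 2), (starRingEnd ℂ)
        (Complex.exp (Complex.I * (x * Real.cos φ + s * φ : ℝ)))
        = (starRingEnd ℂ) (∫ φ in (0 : ℝ)..(Real.pi / 2),
          Complex.exp (Complex.I * (x * Real.cos φ + s * φ : ℝ))) := by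
      simp only [intervalIntegral, integral_conj, map_sub]
    rw [e3, RCLike.norm_conj]
    exact h1
  refine (norm_add_le _ _).trans ?_
  have : 80 / √x = 40 / √x + 40 / √x := by ring
  linarith

/-- This serves the small moduli. The cosine splits into e^{±iνφ}, and x ≥ 2ν keeps the stationary
points of both phases nondegenerate. -/
theorem norm_besselInt_le {ν : ℕ} {x : ℝ} (hx : 0 < x) (h : 2 * (ν : ℝ) ≤ x) :
    ‖besselInt ν x‖ ≤ 80 / √x := by
  have e : besselInt ν x = 1 / 2 *
      (∫ φ in (0 : ℝ)..Real.pi, Complex.exp (Complex.I * (x * Real.cos φ + (ν : ℝ) * φ : ℝ)))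
      + 1 / 2 *
      ∫ φ in (0 : ℝ)..Real.pi, Complex.exp (Complex.I * (x * Real.cos φ + (-ν : ℝ) * φ : ℝ)) := by
    rw [← intervalIntegral.integral_const_mul, ← intervalIntegral.integral_const_mul,
      ← intervalIntegral.integral_add]
    · refine integral_congr fun φ _ => ?_
      simp only [Complex.ofReal_cos, Complex.cos]
      push_cast
      simp only [mul_add, Complex.exp_add]
      rw [show Complex.I * (-(ν : ℂ) * φ) = -(ν * φ) * Complex.I by ring,
        show Complex.I * ((ν : ℂ) * φ) = (ν * φ) * Complex.I by ring]
      ring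
    · exact Continuous.intervalIntegrable (by fun_prop) _ _
    · exact Continuous.intervalIntegrable (by fun_prop) _ _
  have b1 := norm_integral_exp_cos_le (x := x) (s := ν) hx (by rwa [Nat.abs_cast])
  have b2 := norm_integral_exp_cos_le (x := x) (s := -ν) hx (by rwa [abs_neg, Nat.abs_cast])
  rw [e]
  refine (norm_add_le _ _).trans ?_
  rw [norm_mul, norm_mul]
  have : ‖(1 / 2 : ℂ)‖ = 1 / 2 := by norm_num
  rw [this]
  linarith

/-- The Fourier transform of a wave. -/
theorem integral_wave_mul_exp (ν : ℕ) {p R m : ℝ} (hR : 0 < R) (hm : m ≠ 0) :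
    ∫ t, (wave ν p R t : ℂ) * Complex.exp (2 * Real.pi * Complex.I * m * t)
      = R * Complex.exp (2 * Real.pi * Complex.I * m * p) *
        (ν / (Complex.I * (2 * Real.pi * m * R : ℝ)) * besselInt ν (2 * Real.pi * m * R)) := by
  set x := 2 * Real.pi * m * R with hx
  have hx0 : x ≠ 0 := by rw [hx]; have := Real.pi_ne_zero; positivity
  have hcw : Continuous fun t : ℝ =>
      (wave ν p R t : ℂ) * Complex.exp (2 * Real.pi * Complex.I * m * t) := by
    have := continuous_wave ν p R
    fun_prop
  have h1 : ∫ t, (wave ν p R t : ℂ) * Complex.exp (2 * Real.pi * Complex.I * m * t)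
      = ∫ t in (p - R)..(p + R),
        (wave ν p R t : ℂ) * Complex.exp (2 * Real.pi * Complex.I * m * t) := by
    rw [intervalIntegral.integral_of_le (by linarith), ← integral_Icc_eq_integral_Ioc,
      setIntegral_eq_integral_of_forall_compl_eq_zero]
    intro t ht
    rw [wave_eq_zero hR, Complex.ofReal_zero, zero_mul]
    by_contra h'
    have := abs_lt.1 (not_le.1 h')
    exact ht ⟨by linarith [this.1], by linarith [this.2]⟩
  have h2 := integral_deriv_smul_comp (a := 0) (b := Real.pi) (f := fun φ => p + R * Real.cos φ)
    (f' := fun φ => -(R * Real.sin φ))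
    (g := fun t => (wave ν p R t : ℂ) * Complex.exp (2 * Real.pi * Complex.I * m * t))
    (fun φ _ => by simpa using ((Real.hasDerivAt_cos φ).const_mul R).const_add p)
    (by fun_prop) hcw
  have h3 : ∫ φ in (0 : ℝ)..Real.pi, (-(R * Real.sin φ)) •
        ((fun t => (wave ν p R t : ℂ) * Complex.exp (2 * Real.pi * Complex.I * m * t)) ∘
          fun φ => p + R * Real.cos φ) φ
      = -(R * Complex.exp (2 * Real.pi * Complex.I * m * p)) *
        ∫ φ in (0 : ℝ)..Real.pi, (Real.sin (ν * φ) : ℂ) *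
          (Real.sin φ * Complex.exp (Complex.I * (x * Real.cos φ : ℝ))) := by
    rw [← intervalIntegral.integral_const_mul]
    refine integral_congr fun φ hφ => ?_
    rw [uIcc_of_le Real.pi_pos.le] at hφ
    have ha : wave ν p R (p + R * Real.cos φ) = Real.sin (ν * φ) := by
      unfold wave angle
      rw [show (p + R * Real.cos φ - p) / R = Real.cos φ by field_simp; ring,
        Real.arccos_cos hφ.1 hφ.2]
    have hexp : Complex.exp (2 * Real.pi * Complex.I * m * ((p + R * Real.cos φ : ℝ) : ℂ))
        = Complex.exp (2 * Real.pi * Complex.I * m * p) *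
          Complex.exp (Complex.I * (x * Real.cos φ : ℝ)) := by
      rw [← Complex.exp_add, hx]
      congr 1
      push_cast
      ring
    simp only [Function.comp_apply, ha, hexp, Complex.real_smul]
    push_cast
    ring
  -- The factor sin φ · e^{ix cos φ} is a derivative. Integration by parts turns sin νφ into ν cos
  -- νφ, and the boundary terms vanish because ν is an integer.
  have h4 : ∫ φ in (0 : ℝ)..Real.pi, (Real.sin (ν * φ) : ℂ) *
          (Real.sin φ * Complex.exp (Complex.I * (x * Real.cos φ : ℝ)))
      = ν / (Complex.I * x) * besselInt ν x := by
    have hIx : Complex.I * (x : ℂ) ≠ 0 :=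
      mul_ne_zero Complex.I_ne_zero (Complex.ofReal_ne_zero.2 hx0)
    have hp := integral_mul_deriv_eq_deriv_mul (a := 0) (b := Real.pi)
      (u := fun φ : ℝ => (Real.sin (ν * φ) : ℂ)) (u' := fun φ : ℝ => (ν * Real.cos (ν * φ) : ℂ))
      (v := fun φ : ℝ => -(1 / (Complex.I * x)) * Complex.exp (Complex.I * (x * Real.cos φ : ℝ)))
      (v' := fun φ : ℝ => (Real.sin φ * Complex.exp (Complex.I * (x * Real.cos φ : ℝ)) : ℂ))
      (fun φ _ => by
        have h : HasDerivAt (fun φ : ℝ => Real.sin (ν * φ)) (ν * Real.cos (ν * φ)) φ := by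
          have := (Real.hasDerivAt_sin (ν * φ)).comp φ ((hasDerivAt_id φ).const_mul (ν : ℝ))
          convert! this using 1
          simp [mul_comm]
        have := h.ofReal_comp
        convert! this using 1
        push_cast
        rfl)
      (fun φ _ => by
        have h : HasDerivAt (fun φ : ℝ => ((x * Real.cos φ : ℝ) : ℂ)) ((-(x * Real.sin φ) : ℝ) : ℂ) φ := by
          have := ((Real.hasDerivAt_cos φ).const_mul x).ofReal_comp
          convert! this using 1
          push_cast
          ring
        have := ((h.const_mul Complex.I).cexp).const_mul (-(1 / (Complex.I * (x : ℂ))))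
        convert! this using 1
        push_cast
        have hx' : (x : ℂ) ≠ 0 := Complex.ofReal_ne_zero.2 hx0
        have hI := Complex.I_ne_zero
        field_simp)
      (Continuous.intervalIntegrable (by fun_prop) _ _)
      (Continuous.intervalIntegrable (by fun_prop) _ _)
    rw [hp, Real.sin_nat_mul_pi]
    simp only [mul_zero, Real.sin_zero, Complex.ofReal_zero, zero_mul, sub_zero, zero_sub]
    unfold besselInt
    rw [← intervalIntegral.integral_const_mul, ← intervalIntegral.integral_neg]
    refine integral_congr fun φ _ => ?_
    ring
  rw [h1]
  -- As φ goes from 0 to π, the variable p + R cos φ descends from p + R to p − R; this accounts for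
  -- the sign.
  simp only [Real.cos_zero, Real.cos_pi, mul_one, mul_neg] at h2
  rw [← sub_eq_add_neg, intervalIntegral.integral_symm (p - R)] at h2
  rw [← neg_inj, ← h2, h3, h4]
  ring

end PoincareMoment

end


open scoped MatrixGroups ContDiff UpperHalfPlane

noncomputable section

namespace PoincareMoment

/-! ### Counting solutions of congruences -/

/-- Elements of `[0, c)` in one residue class modulo a divisor `l` of `c`. -/
lemma card_le_of_congruent {c l : ℕ} (hl : l ∣ c) (hc : 0 < c) (S : Finset ℕ)
    (hS : ∀ x ∈ S, x < c) (h : ∀ x ∈ S, ∀ y ∈ S, (l : ℤ) ∣ (x : ℤ) - y) : S.card ≤ c / l := by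
  have hl0 : 0 < l := Nat.pos_of_dvd_of_pos hl hc
  calc S.card ≤ (Finset.range (c / l)).card := by
        refine Finset.card_le_card_of_injOn (fun x => x / l) ?_ ?_
        · intro x hx
          simp only [Finset.coe_range, Set.mem_Iio]
          exact Nat.div_lt_div_of_lt_of_dvd hl (hS x hx)
        · intro x hx y hy hxy
          have hmod : x % l = y % l := by
            have := (Nat.modEq_iff_dvd.2 (h y hy x hx) : x ≡ y [MOD l])
            exact this
          have hxy' : x / l = y / l := hxy
          rw [← Nat.div_add_mod x l, ← Nat.div_add_mod y l, hmod, hxy']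
    _ = c / l := Finset.card_range _

/-- Elements of `[0, c)` with prescribed set of residues modulo a divisor `l` of `c`. -/
lemma card_le_mul_card_image_mod {c l : ℕ} (hl : l ∣ c) (hc : 0 < c) (S : Finset ℕ)
    (hS : ∀ x ∈ S, x < c) : S.card ≤ c / l * (S.image (· % l)).card := by
  refine Finset.card_le_mul_card_image S _ fun r _ => ?_
  refine card_le_of_congruent hl hc _ (fun x hx => hS x (Finset.mem_filter.1 hx).1) ?_
  intro x hx y hy
  have hx' := (Finset.mem_filter.1 hx).2
  have hy' := (Finset.mem_filter.1 hy).2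
  exact Nat.modEq_iff_dvd.1 ((hy'.trans hx'.symm : y % l = x % l))

/-- If `n` divides a product, some divisor `u` of `n` divides the first factor and `n / u` the
second. -/
lemma exists_dvd_and_div_dvd {n : ℕ} (hn : 0 < n) {a b : ℤ} (h : (n : ℤ) ∣ a * b) :
    ∃ u ∈ n.divisors, (u : ℤ) ∣ a ∧ ((n / u : ℕ) : ℤ) ∣ b := by
  refine ⟨Int.gcd a n, ?_, Int.gcd_dvd_left .., ?_⟩
  · rw [Nat.mem_divisors]
    exact ⟨by exact_mod_cast Int.gcd_dvd_right a (n : ℤ), hn.ne'⟩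
  · have hg : Int.gcd a n ∣ n := by exact_mod_cast Int.gcd_dvd_right a (n : ℤ)
    have hg0 : 0 < Int.gcd a n := Nat.pos_of_dvd_of_pos hg hn
    obtain ⟨a', ha'⟩ := Int.gcd_dvd_left a (n : ℤ)
    have hn' : (n : ℤ) = Int.gcd a n * ((n / Int.gcd a n : ℕ) : ℤ) := by
      exact_mod_cast (Nat.mul_div_cancel' hg).symm
    have hcop : IsCoprime ((n / Int.gcd a n : ℕ) : ℤ) a' := by
      have := Int.gcd_div_gcd_div_gcd (i := a) (j := n) hg0
      rw [Int.isCoprime_iff_gcd_eq_one, Int.gcd_comm]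
      have e1 : a / (Int.gcd a n : ℤ) = a' := by
        exact Int.ediv_eq_of_eq_mul_right (by exact_mod_cast hg0.ne') ha'
      have e2 : (n : ℤ) / (Int.gcd a n : ℤ) = ((n / Int.gcd a n : ℕ) : ℤ) := by push_cast; rfl
      rwa [e1, e2] at this
    refine hcop.dvd_of_dvd_mul_left ?_
    have : (Int.gcd a n : ℤ) * ((n / Int.gcd a n : ℕ) : ℤ) ∣ Int.gcd a n * (a' * b) := by
      rw [← hn', ← mul_assoc, ← ha']; exact h
    exact Int.dvd_of_mul_dvd_mul_left (by exact_mod_cast hg0.ne') this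

lemma lcm_dvd_int {a b : ℕ} {z : ℤ} (ha : (a : ℤ) ∣ z) (hb : (b : ℤ) ∣ z) :
    ((Nat.lcm a b : ℕ) : ℤ) ∣ z := by
  rw [Int.natCast_dvd] at *
  exact Nat.lcm_dvd ha hb

/-- The number of square roots of a unit modulo `n`. -/
lemma card_sqrt_le {n : ℕ} (hn : 0 < n) {s : ℤ} (hs : IsCoprime s (n : ℤ)) :
    ((Finset.range n).filter fun x : ℕ => (n : ℤ) ∣ (x : ℤ) ^ 2 - s).card
      ≤ 2 * n.divisors.card := by
  set S := (Finset.range n).filter fun x : ℕ => (n : ℤ) ∣ (x : ℤ) ^ 2 - s with hS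
  rcases S.eq_empty_or_nonempty with h0 | ⟨x₀, hx₀⟩
  · rw [h0]; simp
  have hcop : ∀ x ∈ S, IsCoprime (x : ℤ) n := by
    intro x hx
    have hd := (Finset.mem_filter.1 hx).2
    have : IsCoprime ((x : ℤ) ^ 2) n := by
      obtain ⟨t, ht⟩ := hd
      have e : (x : ℤ) ^ 2 = s + n * t := by linarith
      rw [e]
      exact hs.add_mul_left_left t
    exact (IsCoprime.pow_left_iff two_pos).1 this
  -- Against one fixed root x₀, every root satisfies n ∣ (x − x₀)(x + x₀). The divisor u records how
  -- n is shared between the two factors.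
  have hsub : S ⊆ n.divisors.biUnion fun u => S.filter fun x : ℕ =>
      (u : ℤ) ∣ (x : ℤ) - x₀ ∧ ((n / u : ℕ) : ℤ) ∣ (x : ℤ) + x₀ := by
    intro x hx
    have h1 := (Finset.mem_filter.1 hx).2
    have h2 := (Finset.mem_filter.1 hx₀).2
    have h3 : (n : ℤ) ∣ ((x : ℤ) - x₀) * ((x : ℤ) + x₀) := by
      have := dvd_sub h1 h2
      convert! this using 1
      ring
    obtain ⟨u, hu, hua, hub⟩ := exists_dvd_and_div_dvd hn h3
    exact Finset.mem_biUnion.2 ⟨u, hu, Finset.mem_filter.2 ⟨hx, hua, hub⟩⟩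
  refine (Finset.card_le_card hsub).trans ?_
  rw [mul_comm]
  refine Finset.card_biUnion_le_card_mul _ _ _ fun u hu => ?_
  have hu' : u ∣ n := Nat.dvd_of_mem_divisors hu
  set T := S.filter fun x : ℕ => (u : ℤ) ∣ (x : ℤ) - x₀ ∧ ((n / u : ℕ) : ℤ) ∣ (x : ℤ) + x₀ with hT
  rcases T.eq_empty_or_nonempty with h0 | ⟨x₁, hx₁⟩
  · rw [h0]; simp
  have huv : u * (n / u) = n := Nat.mul_div_cancel' hu'
  -- A common divisor of u and n/u divides 2x₀, and x₀ is prime to n. Since x is fixed modulo the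
  -- lcm, it has n/lcm = gcd ≤ 2 possible values.
  have hg : Nat.gcd u (n / u) ∣ 2 := by
    have h1 := (Finset.mem_filter.1 hx₁).2
    have hgn : Nat.gcd u (n / u) ∣ n := (Nat.gcd_dvd_left _ _).trans hu'
    have h2 : ((Nat.gcd u (n / u) : ℕ) : ℤ) ∣ 2 * x₀ := by
      have a1 : ((Nat.gcd u (n / u) : ℕ) : ℤ) ∣ (x₁ : ℤ) - x₀ :=
        (Int.natCast_dvd_natCast.2 (Nat.gcd_dvd_left _ _)).trans h1.1
      have a2 : ((Nat.gcd u (n / u) : ℕ) : ℤ) ∣ (x₁ : ℤ) + x₀ :=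
        (Int.natCast_dvd_natCast.2 (Nat.gcd_dvd_right _ _)).trans h1.2
      have := dvd_sub a2 a1
      convert! this using 1
      ring
    have h3 : IsCoprime ((Nat.gcd u (n / u) : ℕ) : ℤ) x₀ :=
      ((hcop x₀ hx₀).symm).of_isCoprime_of_dvd_left (Int.natCast_dvd_natCast.2 hgn)
    exact_mod_cast h3.dvd_of_dvd_mul_right h2
  have hl : Nat.lcm u (n / u) ∣ n := Nat.lcm_dvd hu' (Nat.div_dvd_of_dvd hu')
  have hcard := card_le_of_congruent hl hn T
    (fun x hx => Finset.mem_range.1 (Finset.mem_filter.1 (Finset.mem_filter.1 hx).1).1)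
    (fun x hx y hy => by
      have h1 := (Finset.mem_filter.1 hx).2
      have h2 := (Finset.mem_filter.1 hy).2
      refine lcm_dvd_int ?_ ?_
      · have := dvd_sub h1.1 h2.1
        convert! this using 1
        ring
      · have := dvd_sub h1.2 h2.2
        convert! this using 1
        ring)
  refine hcard.trans ?_
  have hgl : Nat.gcd u (n / u) * Nat.lcm u (n / u) = n := by rw [Nat.gcd_mul_lcm, huv]
  have hl0 : 0 < Nat.lcm u (n / u) := Nat.pos_of_dvd_of_pos hl hn
  have : n / Nat.lcm u (n / u) = Nat.gcd u (n / u) :=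
    Nat.div_eq_of_eq_mul_left hl0 hgl.symm
  rw [this]
  exact Nat.le_of_dvd two_pos hg

/-- The number of pairs `(x, y)` modulo `c` with `x + x⁻¹ = y + y⁻¹` and `e ∣ x + x⁻¹`. -/
theorem mul_card_pairs_le {c e : ℕ} (hc : 0 < c) (he : e ∣ c) :
    e * (((Finset.range c) ×ˢ (Finset.range c)).filter fun p : ℕ × ℕ =>
      (c : ℤ) ∣ ((p.1 : ℤ) - p.2) * ((p.1 : ℤ) * p.2 - 1) ∧ (e : ℤ) ∣ (p.1 : ℤ) ^ 2 + 1).card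
      ≤ 8 * c * c.divisors.card ^ 3 := by
  set S := ((Finset.range c) ×ˢ (Finset.range c)).filter fun p : ℕ × ℕ =>
      (c : ℤ) ∣ ((p.1 : ℤ) - p.2) * ((p.1 : ℤ) * p.2 - 1) ∧ (e : ℤ) ∣ (p.1 : ℤ) ^ 2 + 1 with hS
  set P : ℕ → Finset (ℕ × ℕ) := fun u => S.filter fun p : ℕ × ℕ =>
      (u : ℤ) ∣ (p.1 : ℤ) - p.2 ∧ ((c / u : ℕ) : ℤ) ∣ (p.1 : ℤ) * p.2 - 1 with hP
  have hsub : S ⊆ c.divisors.biUnion P := by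
    intro p hp
    obtain ⟨u, hu, hua, hub⟩ := exists_dvd_and_div_dvd hc (Finset.mem_filter.1 hp).2.1
    exact Finset.mem_biUnion.2 ⟨u, hu, Finset.mem_filter.2 ⟨hp, hua, hub⟩⟩
  have he0 : 0 < e := Nat.pos_of_dvd_of_pos he hc
  have hmono : ∀ {n : ℕ}, n ∣ c → n.divisors.card ≤ c.divisors.card := fun h =>
    Finset.card_le_card (Nat.divisors_subset_of_dvd hc.ne' h)
  -- For v = c/u one has y ≡ x modulo u and y ≡ x⁻¹ modulo v. This leaves w = gcd(u, v) choices of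
  -- y, a loss that the forced condition x² ≡ 1 modulo w recovers.
  have key : ∀ u ∈ c.divisors, e * (P u).card ≤ 8 * c * c.divisors.card ^ 2 := by
    intro u hu
    have hu' : u ∣ c := Nat.dvd_of_mem_divisors hu
    have huv : u * (c / u) = c := Nat.mul_div_cancel' hu'
    set v := c / u with hv
    have hvc : v ∣ c := Dvd.intro_left u huv
    set w := Nat.gcd u v with hw
    have hwc : w ∣ c := (Nat.gcd_dvd_left _ _).trans hu'
    have hw0 : 0 < w := Nat.pos_of_dvd_of_pos hwc hc
    have hl : Nat.lcm u v ∣ c := Nat.lcm_dvd hu' hvc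
    have hl0 : 0 < Nat.lcm u v := Nat.pos_of_dvd_of_pos hl hc
    have hcl : c / Nat.lcm u v = w :=
      Nat.div_eq_of_eq_mul_left hl0 (by rw [hw, Nat.gcd_mul_lcm, huv])
    -- the second coordinate is determined up to `w` choices
    have h1 : (P u).card ≤ w * ((P u).image Prod.fst).card := by
      refine Finset.card_le_mul_card_image _ _ fun x _ => ?_
      set F := (P u).filter fun p => p.1 = x with hF
      have hinj : Set.InjOn Prod.snd (F : Set (ℕ × ℕ)) := by
        intro p hp p' hp' h
        have e1 := (Finset.mem_filter.1 hp).2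
        have e2 := (Finset.mem_filter.1 hp').2
        exact Prod.ext (e1.trans e2.symm) h
      rw [← Finset.card_image_of_injOn hinj, ← hcl]
      refine card_le_of_congruent hl hc _ ?_ ?_
      · intro y hy
        obtain ⟨p, hp, rfl⟩ := Finset.mem_image.1 hy
        have := (Finset.mem_filter.1 (Finset.mem_filter.1 (Finset.mem_filter.1 hp).1).1).1
        exact Finset.mem_range.1 (Finset.mem_product.1 this).2
      · intro y hy y' hy'
        obtain ⟨p, hp, rfl⟩ := Finset.mem_image.1 hy
        obtain ⟨p', hp', rfl⟩ := Finset.mem_image.1 hy'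
        have a1 := (Finset.mem_filter.1 (Finset.mem_filter.1 hp).1).2
        have a2 := (Finset.mem_filter.1 (Finset.mem_filter.1 hp').1).2
        rw [(Finset.mem_filter.1 hp).2] at a1
        rw [(Finset.mem_filter.1 hp').2] at a2
        refine lcm_dvd_int ?_ ?_
        · have := dvd_sub a2.1 a1.1
          convert! this using 1
          ring
        · have h3 : (v : ℤ) ∣ x * ((p.2 : ℤ) - p'.2) := by
            have := dvd_sub a1.2 a2.2
            convert! this using 1
            ring
          have h4 : IsCoprime (v : ℤ) x := by
            obtain ⟨t, ht⟩ := a1.2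
            exact ⟨-t, p.2, by linear_combination ht⟩
          exact h4.dvd_of_dvd_mul_left h3
    -- the first coordinate
    set X := (P u).image Prod.fst with hX
    have hXprop : ∀ x ∈ X, x < c ∧ (w : ℤ) ∣ (x : ℤ) ^ 2 - 1 ∧ (e : ℤ) ∣ (x : ℤ) ^ 2 + 1 := by
      intro x hx
      obtain ⟨p, hp, rfl⟩ := Finset.mem_image.1 hx
      have a0 := (Finset.mem_filter.1 (Finset.mem_filter.1 hp).1)
      have a1 := (Finset.mem_filter.1 hp).2
      refine ⟨Finset.mem_range.1 (Finset.mem_product.1 a0.1).1, ?_, a0.2.2⟩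
      have b1 : (w : ℤ) ∣ (p.1 : ℤ) - p.2 :=
        (Int.natCast_dvd_natCast.2 (Nat.gcd_dvd_left _ _)).trans a1.1
      have b2 : (w : ℤ) ∣ (p.1 : ℤ) * p.2 - 1 :=
        (Int.natCast_dvd_natCast.2 (Nat.gcd_dvd_right _ _)).trans a1.2
      have := dvd_add (b1.mul_left (p.1 : ℤ)) b2
      convert! this using 1
      ring
    rcases X.eq_empty_or_nonempty with hXe | ⟨x₁, hx₁⟩
    · have : (P u).card = 0 := by
        have := h1
        rw [hXe] at this
        simpa using this
      rw [this]; simp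
    -- Since x is a square root of 1 modulo w and of −1 modulo e, it lies in at most 2τ(w)·2τ(e)
    -- classes modulo L.
    set L := Nat.lcm w e with hL
    have hLc : L ∣ c := Nat.lcm_dvd hwc he
    have hL0 : 0 < L := Nat.pos_of_dvd_of_pos hLc hc
    have h2 : X.card ≤ c / L * (X.image (· % L)).card :=
      card_le_mul_card_image_mod hLc hc X fun x hx => (hXprop x hx).1
    have h3 : (X.image (· % L)).card ≤ (2 * w.divisors.card) * (2 * e.divisors.card) := by
      refine le_trans ?_ (Nat.mul_le_mul (card_sqrt_le hw0 (s := 1) isCoprime_one_left)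
        (card_sqrt_le he0 (s := -1) (isCoprime_one_left.neg_left)))
      rw [← Finset.card_product]
      have hmodeq : ∀ (n x : ℕ), ((n : ℤ)) ∣ ((x % n : ℕ) : ℤ) - x := fun n x =>
        Nat.modEq_iff_dvd.1 (Nat.mod_modEq x n).symm
      refine Finset.card_le_card_of_injOn (fun x => (x % w, x % e)) ?_ ?_
      · intro z hz
        obtain ⟨x, hx, rfl⟩ := Finset.mem_image.1 hz
        obtain ⟨-, b1, b2⟩ := hXprop x hx
        have ew : x % L % w = x % w := Nat.mod_mod_of_dvd x (Nat.dvd_lcm_left w e)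
        have ee : x % L % e = x % e := Nat.mod_mod_of_dvd x (Nat.dvd_lcm_right w e)
        simp only [Finset.coe_product, Set.mem_prod, Finset.mem_coe, Finset.mem_filter,
          Finset.mem_range, ew, ee]
        refine ⟨⟨Nat.mod_lt _ hw0, ?_⟩, Nat.mod_lt _ he0, ?_⟩
        · have := dvd_add ((hmodeq w x).mul_right (((x % w : ℕ) : ℤ) + x)) b1
          convert! this using 1
          ring
        · have := dvd_add ((hmodeq e x).mul_right (((x % e : ℕ) : ℤ) + x)) b2
          convert! this using 1
          ring
      · intro z hz z' hz' h
        obtain ⟨x, -, rfl⟩ := Finset.mem_image.1 hz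
        obtain ⟨x', -, rfl⟩ := Finset.mem_image.1 hz'
        simp only [Prod.mk.injEq] at h
        have b1 := Nat.modEq_iff_dvd.1 (show x % L ≡ x' % L [MOD w] from h.1)
        have b2 := Nat.modEq_iff_dvd.1 (show x % L ≡ x' % L [MOD e] from h.2)
        have b3 : x % L ≡ x' % L [MOD L] := Nat.modEq_iff_dvd.2 (lcm_dvd_int b1 b2)
        have : x % L % L = x' % L % L := b3
        simpa using this
    -- A common divisor of w and e divides both x² − 1 and x² + 1. Hence we = gcd(w, e)·L ≤ 2L,
    -- which pays for both factors e and w.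
    have hg2 : Nat.gcd w e ≤ 2 := by
      refine Nat.le_of_dvd two_pos ?_
      obtain ⟨-, b1, b2⟩ := hXprop x₁ hx₁
      have c1 := (Int.natCast_dvd_natCast.2 (Nat.gcd_dvd_left w e)).trans b1
      have c2 := (Int.natCast_dvd_natCast.2 (Nat.gcd_dvd_right w e)).trans b2
      have := dvd_sub c2 c1
      ring_nf at this
      exact_mod_cast this
    have hgL : Nat.gcd w e * L = w * e := Nat.gcd_mul_lcm w e
    have hcL : c / L * L = c := Nat.div_mul_cancel hLc
    calc e * (P u).card ≤ e * (w * (c / L * ((2 * w.divisors.card) * (2 * e.divisors.card)))) := by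
          gcongr
          exact h1.trans (Nat.mul_le_mul_left _ (h2.trans (Nat.mul_le_mul_left _ h3)))
      _ = (w * e) * (c / L) * 4 * (w.divisors.card * e.divisors.card) := by ring
      _ = Nat.gcd w e * (c / L * L) * 4 * (w.divisors.card * e.divisors.card) := by
          rw [← hgL]; ring
      _ ≤ 2 * c * 4 * (c.divisors.card * c.divisors.card) := by
          rw [hcL]
          gcongr
      _ = _ := by ring
  calc e * S.card ≤ e * ∑ u ∈ c.divisors, (P u).card := by
        gcongr
        exact (Finset.card_le_card hsub).trans Finset.card_biUnion_le
    _ = ∑ u ∈ c.divisors, e * (P u).card := Finset.mul_sum _ _ _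
    _ ≤ ∑ u ∈ c.divisors, 8 * c * c.divisors.card ^ 2 := Finset.sum_le_sum key
    _ = _ := by rw [Finset.sum_const, smul_eq_mul]; ring

/-! ### The distribution of the traces x + x⁻¹ -/

/-- The residue modulo `c` of `x + x⁻¹`, for `x` prime to `c`. -/
def resTrace (c x : ℕ) : ℕ := (x + ((x : ZMod c)⁻¹).val) % c

/-- The reduced residues modulo `c`. -/
def unitRes (c : ℕ) : Finset ℕ := (Finset.range c).filter fun x => Nat.Coprime x c

/-- The number of reduced residues modulo `c` with trace `a`. -/
def traceCount (c a : ℕ) : ℕ := ((unitRes c).filter fun x => resTrace c x = a).card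

lemma mem_unitRes {c x : ℕ} : x ∈ unitRes c ↔ x < c ∧ Nat.Coprime x c := by
  rw [unitRes, Finset.mem_filter, Finset.mem_range]

lemma resTrace_lt {c : ℕ} (hc : 0 < c) (x : ℕ) : resTrace c x < c := Nat.mod_lt _ hc

lemma dvd_mul_resTrace_sub {c x : ℕ} (hc : 0 < c) (hx : Nat.Coprime x c) :
    (c : ℤ) ∣ (x : ℤ) * resTrace c x - ((x : ℤ) ^ 2 + 1) := by
  have : NeZero c := ⟨hc.ne'⟩
  rw [← ZMod.intCast_zmod_eq_zero_iff_dvd]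
  push_cast
  have h := ZMod.coe_mul_inv_eq_one x hx
  rw [resTrace, ZMod.natCast_mod]
  push_cast
  rw [ZMod.natCast_zmod_val]
  linear_combination h

/-- If x and y have the same trace t, then xt ≡ x² + 1 and yt ≡ y² + 1. Eliminating t gives (x −
y)(xy − 1) ≡ 0 modulo c, and e ∣ t gives x² ≡ −1 modulo e. -/
lemma mul_card_trace_pairs_le {c e : ℕ} (hc : 0 < c) (he : e ∣ c) :
    e * ((unitRes c ×ˢ unitRes c).filter fun p =>
      resTrace c p.1 = resTrace c p.2 ∧ e ∣ resTrace c p.1).card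
      ≤ 8 * c * c.divisors.card ^ 3 := by
  refine le_trans (Nat.mul_le_mul_left e (Finset.card_le_card ?_)) (mul_card_pairs_le hc he)
  rintro ⟨x, y⟩ hxy
  simp only [Finset.mem_filter, Finset.mem_product, mem_unitRes] at hxy
  obtain ⟨⟨⟨hx, hxc⟩, hy, hyc⟩, h1, h2⟩ := hxy
  simp only [Finset.mem_filter, Finset.mem_product, Finset.mem_range]
  have kx := dvd_mul_resTrace_sub hc hxc
  have ky := dvd_mul_resTrace_sub hc hyc
  rw [← h1] at ky
  refine ⟨⟨hx, hy⟩, ?_, ?_⟩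
  · have := dvd_sub (ky.mul_left (x : ℤ)) (kx.mul_left (y : ℤ))
    convert! this using 1
    ring
  · have h3 : (e : ℤ) ∣ (resTrace c x : ℤ) := by exact_mod_cast h2
    have h5 := ((Int.natCast_dvd_natCast.2 he).trans kx)
    have := dvd_sub (h3.mul_left (x : ℤ)) h5
    convert! this using 1
    ring

/-- The second moment of the trace counts, weighted by a greatest common divisor. -/
theorem sum_traceCount_sq_mul_gcd_le {c y : ℕ} (hc : 0 < c) (hy : y ∣ c) :
    ∑ a ∈ Finset.range c, traceCount c a ^ 2 * Nat.gcd a y ≤ 8 * c * c.divisors.card ^ 4 := by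
  have hy0 : 0 < y := Nat.pos_of_dvd_of_pos hy hc
  -- The gcd is itself one of the divisors e of y that divide a. Bounding it by their sum replaces
  -- the weight by divisibility conditions on the trace.
  have h1 : ∀ a : ℕ, Nat.gcd a y ≤ ∑ e ∈ y.divisors, if e ∣ a then e else 0 := by
    intro a
    have hmem : Nat.gcd a y ∈ y.divisors :=
      Nat.mem_divisors.2 ⟨Nat.gcd_dvd_right _ _, hy0.ne'⟩
    calc Nat.gcd a y = if Nat.gcd a y ∣ a then Nat.gcd a y else 0 := by
          rw [if_pos (Nat.gcd_dvd_left _ _)]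
      _ ≤ _ := Finset.single_le_sum (f := fun e => if e ∣ a then e else 0)
          (fun _ _ => Nat.zero_le _) hmem
  have h2 : ∀ e : ℕ, ∑ a ∈ Finset.range c, traceCount c a ^ 2 * (if e ∣ a then e else 0)
      = e * ((unitRes c ×ˢ unitRes c).filter fun p =>
        resTrace c p.1 = resTrace c p.2 ∧ e ∣ resTrace c p.1).card := by
    intro e
    rw [Finset.card_eq_sum_card_fiberwise (f := fun p => resTrace c p.1) (t := Finset.range c)
      (fun _ _ => Finset.mem_coe.2 (Finset.mem_range.2 (resTrace_lt hc _))), Finset.mul_sum]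
    refine Finset.sum_congr rfl fun a _ => ?_
    split_ifs with h
    · rw [mul_comm]
      congr 1
      rw [traceCount, sq, ← Finset.card_product]
      congr 1
      ext ⟨x, x'⟩
      simp only [Finset.mem_product, Finset.mem_filter]
      constructor
      · rintro ⟨⟨k1, rfl⟩, k2, h'⟩
        exact ⟨⟨⟨k1, k2⟩, h'.symm, h⟩, rfl⟩
      · rintro ⟨⟨⟨k1, k2⟩, h', -⟩, rfl⟩
        exact ⟨⟨k1, rfl⟩, k2, h'.symm⟩
    · rw [mul_zero, eq_comm, mul_eq_zero, Finset.card_eq_zero]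
      right
      ext ⟨x, x'⟩
      simp only [Finset.mem_filter, Finset.notMem_empty, iff_false]
      rintro ⟨⟨-, -, h'⟩, rfl⟩
      exact h h'
  calc ∑ a ∈ Finset.range c, traceCount c a ^ 2 * Nat.gcd a y
      ≤ ∑ a ∈ Finset.range c, traceCount c a ^ 2 * ∑ e ∈ y.divisors, (if e ∣ a then e else 0) := by
        gcongr with a
        exact h1 a
    _ = ∑ e ∈ y.divisors, ∑ a ∈ Finset.range c,
          traceCount c a ^ 2 * (if e ∣ a then e else 0) := by
        simp only [Finset.mul_sum]
        rw [Finset.sum_comm]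
    _ ≤ ∑ e ∈ y.divisors, 8 * c * c.divisors.card ^ 3 := by
        refine Finset.sum_le_sum fun e he => ?_
        rw [h2]
        exact mul_card_trace_pairs_le hc ((Nat.dvd_of_mem_divisors he).trans hy)
    _ = y.divisors.card * (8 * c * c.divisors.card ^ 3) := by rw [Finset.sum_const, smul_eq_mul]
    _ ≤ c.divisors.card * (8 * c * c.divisors.card ^ 3) := by
        gcongr
    _ = _ := by ring

/-- The second moment of the trace counts. -/
lemma sum_traceCount_sq_le {c : ℕ} (hc : 0 < c) :
    ∑ a ∈ Finset.range c, traceCount c a ^ 2 ≤ 8 * c * c.divisors.card ^ 4 := by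
  simpa using sum_traceCount_sq_mul_gcd_le hc (one_dvd c)

/-- The divisor bound. -/
theorem exists_card_divisors_le {ε : ℝ} (hε : 0 < ε) :
    ∃ C : ℝ, 0 < C ∧ ∀ n : ℕ, 0 < n → (n.divisors.card : ℝ) ≤ C * (n : ℝ) ^ ε := by
  set a := ε * Real.log 2 with ha
  have ha0 : 0 < a := mul_pos hε (Real.log_pos one_lt_two)
  -- With this K one has e + 1 ≤ K(1 + ae) ≤ K·2^{eε}. Only the primes below P pay the factor K; for
  -- the others p^ε ≥ 2 and e + 1 ≤ 2^e suffices.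
  set K := 1 + 1 / a with hK
  have hK1 : 1 ≤ K := by rw [hK]; have : 0 < 1 / a := by positivity
                         linarith
  set P := ⌈(2 : ℝ) ^ (1 / ε)⌉₊ with hP
  refine ⟨K ^ P, by positivity, fun n hn => ?_⟩
  have hprime : ∀ p ∈ n.primeFactors, ((n.factorization p + 1 : ℕ) : ℝ)
      ≤ (if p < P then K else 1) * ((p : ℝ) ^ (n.factorization p)) ^ ε := by
    intro p hp
    have hp2 : (2 : ℝ) ≤ p := by exact_mod_cast (Nat.prime_of_mem_primeFactors hp).two_le
    set e := n.factorization p with he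
    have hswap : ((p : ℝ) ^ e) ^ ε = ((p : ℝ) ^ ε) ^ e := by
      rw [← Real.rpow_natCast, ← Real.rpow_natCast, ← Real.rpow_mul (by linarith),
        ← Real.rpow_mul (by linarith), mul_comm]
    split_ifs with hpP
    · have h1 : ((2 : ℝ) ^ e) ^ ε ≤ ((p : ℝ) ^ e) ^ ε := by gcongr
      have h2 : 1 + a * e ≤ ((2 : ℝ) ^ e) ^ ε := by
        have : ((2 : ℝ) ^ e) ^ ε = Real.exp (a * e) := by
          rw [← Real.rpow_natCast, ← Real.rpow_mul zero_le_two, Real.rpow_def_of_pos two_pos, ha]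
          congr 1
          ring
        rw [this]
        linarith [Real.add_one_le_exp (a * e)]
      calc ((e + 1 : ℕ) : ℝ) ≤ K * (1 + a * e) := by
            have : K * (1 + a * e) = 1 + 1 / a + a * e + e := by
              rw [hK]; field_simp; ring
            rw [this]
            push_cast
            have : 0 < 1 / a := by positivity
            have : 0 ≤ a * e := by positivity
            linarith
        _ ≤ K * ((p : ℝ) ^ e) ^ ε := by gcongr; exact h2.trans h1
    · rw [one_mul, hswap]
      have h1 : (2 : ℝ) ≤ (p : ℝ) ^ ε := by
        have : (2 : ℝ) ^ (1 / ε) ≤ p := (Nat.le_ceil _).trans (by exact_mod_cast not_lt.1 hpP)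
        calc (2 : ℝ) = ((2 : ℝ) ^ (1 / ε)) ^ ε := by
              rw [← Real.rpow_mul zero_le_two, one_div_mul_cancel hε.ne', Real.rpow_one]
          _ ≤ _ := by gcongr
      calc ((e + 1 : ℕ) : ℝ) ≤ (2 : ℝ) ^ e := by exact_mod_cast Nat.lt_two_pow_self
        _ ≤ _ := by gcongr
  rw [Nat.card_divisors hn.ne']
  push_cast
  calc ∏ p ∈ n.primeFactors, ((n.factorization p : ℝ) + 1)
      ≤ ∏ p ∈ n.primeFactors, ((if p < P then K else 1) * ((p : ℝ) ^ (n.factorization p)) ^ ε) := by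
        refine Finset.prod_le_prod (fun p _ => by positivity) fun p hp => ?_
        exact_mod_cast hprime p hp
    _ = (∏ p ∈ n.primeFactors, if p < P then K else 1) *
          ∏ p ∈ n.primeFactors, ((p : ℝ) ^ (n.factorization p)) ^ ε := Finset.prod_mul_distrib
    _ = (∏ p ∈ n.primeFactors, if p < P then K else 1) * (n : ℝ) ^ ε := by
        rw [Real.finsetProd_rpow _ _ fun p _ => by positivity]
        congr 2
        conv_rhs => rw [← Nat.prod_factorization_pow_eq_self hn.ne']
        rw [Finsupp.prod, Nat.support_factorization]
        push_cast
        rfl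
    _ ≤ _ := by
        gcongr
        rw [Finset.prod_ite, Finset.prod_const, Finset.prod_const_one, mul_one]
        refine pow_le_pow_right₀ hK1 ?_
        calc _ ≤ (Finset.range P).card := Finset.card_le_card fun p hp =>
              Finset.mem_range.2 (Finset.mem_filter.1 hp).2
          _ = P := Finset.card_range _

end PoincareMoment

end


open scoped MatrixGroups ContDiff UpperHalfPlane

noncomputable section

namespace PoincareMoment

open MeasureTheory Set

/-! ### A large sieve for waves -/

/-- The additive character `e(t) = exp (2πit)`. -/
def eChar (t : ℝ) : ℂ := Complex.exp (2 * Real.pi * Complex.I * t)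

lemma norm_eChar (t : ℝ) : ‖eChar t‖ = 1 := by
  rw [eChar, show 2 * (Real.pi : ℂ) * Complex.I * t = ((2 * Real.pi * t : ℝ) : ℂ) * Complex.I by
    push_cast; ring]
  exact Complex.norm_exp_ofReal_mul_I _

lemma eChar_add (s t : ℝ) : eChar (s + t) = eChar s * eChar t := by
  rw [eChar, eChar, eChar, ← Complex.exp_add]
  congr 1
  push_cast
  ring

lemma eChar_intCast (n : ℤ) : eChar n = 1 := by
  rw [eChar, Complex.exp_eq_one_iff]
  exact ⟨n, by push_cast; ring⟩

lemma continuous_eChar : Continuous eChar := by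
  unfold eChar
  fun_prop

/-- Bessel's inequality for the frequencies `m ∈ ℤ` and functions supported in `[-2, 3]`. -/
lemma sum_norm_sq_integral_mul_eChar_le {F : ℝ → ℂ} (hF : Continuous F)
    (hsupp : ∀ t, t ∉ Icc (-2 : ℝ) 3 → F t = 0) (S : Finset ℕ) :
    ∑ m ∈ S, ‖∫ t, F t * eChar (m * t)‖ ^ 2 ≤ 5 * ∫ t, ‖F t‖ ^ 2 := by
  have hab : (-2 : ℝ) < 3 := by norm_num
  have hL2 : MemLp F 2 (volume.restrict (Ioc (-2 : ℝ) 3)) :=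
    (hF.memLp_of_hasCompactSupport
      (HasCompactSupport.intro isCompact_Icc hsupp)).restrict _
  have hs := hasSum_sq_fourierCoeffOn hab hL2
  -- The interval has length 5, so the integer frequency m is the Fourier coefficient of index −5m;
  -- the other coefficients are dropped. The interval contains every wave with centre in [0, 1] and
  -- radius at most 2.
  have hcoef : ∀ m : ℕ, fourierCoeffOn hab F (-(5 * m : ℤ)) = (1 / 5 : ℂ) * ∫ t, F t * eChar (m * t) := by
    intro m
    rw [fourierCoeffOn_eq_integral]
    have e1 : ∫ t, F t * eChar (m * t) = ∫ t in (-2 : ℝ)..3, F t * eChar (m * t) := by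
      rw [intervalIntegral.integral_of_le hab.le, ← integral_Icc_eq_integral_Ioc,
        setIntegral_eq_integral_of_forall_compl_eq_zero]
      intro t ht
      rw [hsupp t ht, zero_mul]
    rw [e1, Complex.real_smul]
    congr 1
    · norm_num
    · refine intervalIntegral.integral_congr fun t _ => ?_
      simp only [fourier_coe_apply, neg_neg, smul_eq_mul]
      rw [mul_comm, eChar]
      congr 2
      push_cast
      ring
  have hsq : ∫ t in (-2 : ℝ)..3, ‖F t‖ ^ 2 = ∫ t, ‖F t‖ ^ 2 := by
    rw [intervalIntegral.integral_of_le hab.le, ← integral_Icc_eq_integral_Ioc,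
      setIntegral_eq_integral_of_forall_compl_eq_zero]
    intro t ht
    rw [hsupp t ht]; simp
  have hinj : Function.Injective fun m : ℕ => -(5 * m : ℤ) := by
    intro a b h
    simp only [neg_inj] at h
    omega
  have hle := sum_le_hasSum (S.map ⟨_, hinj⟩) (fun i _ => by positivity) hs
  rw [Finset.sum_map] at hle
  simp only [Function.Embedding.coeFn_mk, hcoef, norm_mul, mul_pow, ← Finset.mul_sum, hsq,
    smul_eq_mul] at hle
  have e : ‖(1 / 5 : ℂ)‖ ^ 2 = 1 / 25 := by norm_num
  rw [e] at hle
  norm_num at hle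
  linarith

/-- The duality form of the large sieve: the row sums of the Gram matrix control the mean square
of a combination of Fourier transforms at the integers. -/
lemma sum_norm_sq_sum_mul_integral_le {ι : Type*} (J : Finset ι) (f : ι → ℝ → ℝ) (α : ι → ℂ)
    (hf : ∀ j ∈ J, Continuous (f j)) (hsupp : ∀ j ∈ J, ∀ t, t ∉ Icc (-2 : ℝ) 3 → f j t = 0)
    (S : Finset ℕ) :
    ∑ m ∈ S, ‖∑ j ∈ J, α j * ∫ t, (f j t : ℂ) * eChar (m * t)‖ ^ 2
      ≤ 5 * ∑ j ∈ J, ‖α j‖ ^ 2 * ∑ i ∈ J, |∫ t, f j t * f i t| := by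
  set F : ℝ → ℂ := fun t => ∑ j ∈ J, α j * (f j t : ℂ) with hF
  have hcs : ∀ j ∈ J, HasCompactSupport (f j) := fun j hj =>
    HasCompactSupport.intro isCompact_Icc (hsupp j hj)
  have hFc : Continuous F := continuous_finsetSum _ fun j hj => by
    have := hf j hj
    fun_prop
  have hFs : ∀ t, t ∉ Icc (-2 : ℝ) 3 → F t = 0 := fun t ht => by
    simp only [hF]
    refine Finset.sum_eq_zero fun j hj => ?_
    rw [hsupp j hj t ht]; simp
  have h1 := sum_norm_sq_integral_mul_eChar_le hFc hFs S
  have h2 : ∀ m : ℕ, ∫ t, F t * eChar (m * t)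
      = ∑ j ∈ J, α j * ∫ t, (f j t : ℂ) * eChar (m * t) := by
    intro m
    simp only [hF, Finset.sum_mul]
    rw [integral_finsetSum]
    · refine Finset.sum_congr rfl fun j _ => ?_
      rw [← integral_const_mul]
      simp only [mul_assoc]
    · intro j hj
      have hc : Continuous fun t => α j * (f j t : ℂ) * eChar (m * t) := by
        have := hf j hj
        have := continuous_eChar
        fun_prop
      refine hc.integrable_of_hasCompactSupport ?_
      refine HasCompactSupport.intro (K := Icc (-2 : ℝ) 3) isCompact_Icc fun t ht => ?_
      rw [hsupp j hj t ht]; simp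
  simp only [h2] at h1
  refine h1.trans (mul_le_mul_of_nonneg_left ?_ (by norm_num))
  have hprod : ∀ j ∈ J, ∀ i ∈ J, Integrable fun t => f j t * f i t := fun j hj i hi =>
    ((hf j hj).mul (hf i hi)).integrable_of_hasCompactSupport ((hcs j hj).mul_right)
  have h3 : ((∫ t, ‖F t‖ ^ 2 : ℝ) : ℂ)
      = ∑ j ∈ J, ∑ i ∈ J, α j * (starRingEnd ℂ) (α i) * ((∫ t, f j t * f i t : ℝ) : ℂ) := by
    rw [← integral_complex_ofReal]
    have e : ∀ t, ((‖F t‖ ^ 2 : ℝ) : ℂ)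
        = ∑ j ∈ J, ∑ i ∈ J, α j * (starRingEnd ℂ) (α i) * ((f j t * f i t : ℝ) : ℂ) := by
      intro t
      rw [← Complex.normSq_eq_norm_sq, ← Complex.mul_conj]
      simp only [hF, map_sum, map_mul, Complex.conj_ofReal, Finset.sum_mul_sum]
      refine Finset.sum_congr rfl fun j _ => Finset.sum_congr rfl fun i _ => ?_
      push_cast
      ring
    simp only [e]
    rw [integral_finsetSum]
    · refine Finset.sum_congr rfl fun j hj => ?_
      rw [integral_finsetSum]
      · refine Finset.sum_congr rfl fun i hi => ?_
        rw [integral_const_mul, integral_complex_ofReal]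
      · intro i hi
        exact (hprod j hj i hi).ofReal.const_mul _
    · intro j hj
      exact integrable_finsetSum _ fun i hi => (hprod j hj i hi).ofReal.const_mul _
  have h4 : ∫ t, ‖F t‖ ^ 2 ≤ ∑ j ∈ J, ∑ i ∈ J, ‖α j‖ * ‖α i‖ * |∫ t, f j t * f i t| := by
    have hn : 0 ≤ ∫ t, ‖F t‖ ^ 2 := integral_nonneg fun t => by positivity
    calc ∫ t, ‖F t‖ ^ 2 = ‖((∫ t, ‖F t‖ ^ 2 : ℝ) : ℂ)‖ := by
          rw [Complex.norm_real, Real.norm_of_nonneg hn]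
      _ ≤ _ := by
          rw [h3]
          refine (norm_sum_le _ _).trans (Finset.sum_le_sum fun j _ => ?_)
          refine (norm_sum_le _ _).trans (Finset.sum_le_sum fun i _ => ?_)
          rw [norm_mul, norm_mul, RCLike.norm_conj, Complex.norm_real, Real.norm_eq_abs]
  refine h4.trans ?_
  -- Schur's test: 2|α_j α_i| ≤ |α_j|² + |α_i|², and the Gram matrix is symmetric.
  have h5 : ∑ j ∈ J, ∑ i ∈ J, ‖α j‖ * ‖α i‖ * |∫ t, f j t * f i t|
      ≤ ∑ j ∈ J, ∑ i ∈ J, (1 / 2 * (‖α j‖ ^ 2 * |∫ t, f j t * f i t|)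
        + 1 / 2 * (‖α i‖ ^ 2 * |∫ t, f i t * f j t|)) := by
    refine Finset.sum_le_sum fun j _ => Finset.sum_le_sum fun i _ => ?_
    have e : ∫ t, f i t * f j t = ∫ t, f j t * f i t := by simp only [mul_comm]
    rw [e]
    have := two_mul_le_add_sq ‖α j‖ ‖α i‖
    have := abs_nonneg (∫ t, f j t * f i t)
    nlinarith
  refine h5.trans (le_of_eq ?_)
  simp only [Finset.sum_add_distrib, ← Finset.mul_sum]
  rw [Finset.sum_comm (f := fun j i => ‖α i‖ ^ 2 * |∫ t, f i t * f j t|)]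
  simp only [← Finset.mul_sum]
  ring

/-! ### Correlations of waves at fractions with denominators in a dyadic range -/

/-- Elements of a dyadic interval in one residue class. -/
lemma card_le_of_congruent_Ico {Y s : ℕ} (S : Finset ℕ)
    (hS : ∀ x ∈ S, x ∈ Finset.Ico Y (2 * Y))
    (h : ∀ x ∈ S, ∀ y ∈ S, (s : ℤ) ∣ (x : ℤ) - y) : S.card ≤ Y / s + 1 := by
  calc S.card ≤ (Finset.range (Y / s + 1)).card := by
        refine Finset.card_le_card_of_injOn (fun x => (x - Y) / s) ?_ ?_
        · intro x hx
          have := Finset.mem_Ico.1 (hS x hx)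
          simp only [Finset.coe_range, Set.mem_Iio]
          exact Nat.lt_succ_of_le (Nat.div_le_div_right (by omega))
        · intro x hx y hy hxy
          have hx' := Finset.mem_Ico.1 (hS x hx)
          have hy' := Finset.mem_Ico.1 (hS y hy)
          have hmod : (x - Y) % s = (y - Y) % s := by
            have : (x - Y) ≡ (y - Y) [MOD s] := by
              rw [Nat.modEq_iff_dvd, Nat.cast_sub hx'.1, Nat.cast_sub hy'.1]
              have := h y hy x hx
              convert! this using 1
              ring
            exact this
          have hxy' : (x - Y) / s = (y - Y) / s := hxy
          have : x - Y = y - Y := by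
            rw [← Nat.div_add_mod (x - Y) s, ← Nat.div_add_mod (y - Y) s, hmod, hxy']
          omega
    _ = _ := Finset.card_range _

lemma sum_inv_sqrt_le (N : ℕ) : ∑ h ∈ Finset.Icc 1 N, 1 / √(h : ℝ) ≤ 2 * √(N : ℝ) := by
  induction N with
  | zero => simp
  | succ n ih =>
    rw [Finset.sum_Icc_succ_top (by omega)]
    have h1 : 0 ≤ √(n : ℝ) := Real.sqrt_nonneg _
    have h2 : 0 < √((n + 1 : ℕ) : ℝ) := Real.sqrt_pos.2 (by positivity)
    have h3 : √((n + 1 : ℕ) : ℝ) ^ 2 = n + 1 := by rw [Real.sq_sqrt (by positivity)]; push_cast; rfl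
    have h4 : √(n : ℝ) ^ 2 = n := Real.sq_sqrt (by positivity)
    have h5 : 1 / √((n + 1 : ℕ) : ℝ) ≤ 2 * (√((n + 1 : ℕ) : ℝ) - √(n : ℝ)) := by
      rw [div_le_iff₀ h2]
      nlinarith [sq_nonneg (√((n + 1 : ℕ) : ℝ) - √(n : ℝ))]
    linarith

/-- The wave attached to the fraction `a / (q n)`. -/
def fracWave (ν q : ℕ) (j : (_ : ℕ) × ℕ) : ℝ → ℝ :=
  wave ν ((j.2 : ℝ) / (q * j.1 : ℕ)) (2 / (q * j.1 : ℕ))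

/-- The fractions `a / (q n)` with `n` in a dyadic interval. -/
def fracIndex (q Y : ℕ) : Finset ((_ : ℕ) × ℕ) :=
  (Finset.Ico Y (2 * Y)).sigma fun n => Finset.range (q * n)

/-- The bound for the correlation of two waves in terms of the numerator `h` of the difference of
the fractions. -/
def corrBound (ν s : ℕ) (C : ℝ) (h : ℤ) : ℝ :=
  if h = 0 then 4 / C else 84 / C * (√((s : ℝ) / ν) * (1 / √(h.natAbs : ℝ)))

/-- After cancelling g the fractions differ by h/(qsn) with h = bn − a's, and both radii are at most
R = 2/C with C = qY. As n < 2Y, the supports are disjoint once |h| ≥ 8s. For h = 0 the trivial bound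
2R = 4/C is used. For h ≠ 0 one has R³qn ≤ (4/C)², and the correlation bound yields 21·4 = 84. -/
lemma abs_integral_fracWave_le {ν q Y : ℕ} (hν : 0 < ν) (hq : 0 < q) (hY : 0 < Y) {y a n a' : ℕ}
    (hy : y ∈ Finset.Ico Y (2 * Y)) (hn : n ∈ Finset.Ico Y (2 * Y)) {g b s : ℕ}
    (hg : 0 < g) (ha : a = g * b) (hys : y = g * s) :
    |∫ t, fracWave ν q ⟨y, a⟩ t * fracWave ν q ⟨n, a'⟩ t|
      ≤ if ((b : ℤ) * n - a' * s).natAbs < 8 * s then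
          corrBound ν s (q * Y : ℝ) ((b : ℤ) * n - a' * s) else 0 := by
  rw [Finset.mem_Ico] at hy hn
  have hy0 : 0 < y := hY.trans_le hy.1
  have hn0 : 0 < n := hY.trans_le hn.1
  have hs0 : 0 < s := by
    rcases Nat.eq_zero_or_pos s with h | h
    · rw [h] at hys; omega
    · exact h
  set C : ℝ := q * Y with hC
  have hq' : (0 : ℝ) < q := by exact_mod_cast hq
  have hY' : (0 : ℝ) < Y := by exact_mod_cast hY
  have hn' : (0 : ℝ) < n := by exact_mod_cast hn0
  have hy' : (0 : ℝ) < y := by exact_mod_cast hy0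
  have hs' : (0 : ℝ) < s := by exact_mod_cast hs0
  have hg' : (0 : ℝ) < g := by exact_mod_cast hg
  have hν' : (0 : ℝ) < ν := by exact_mod_cast hν
  have hCpos : 0 < C := by positivity
  have hn2 : (n : ℝ) ≤ 2 * Y := by exact_mod_cast hn.2.le
  set h : ℤ := (b : ℤ) * n - a' * s with hh
  have hR : ∀ k : ℕ, Y ≤ k → (2 : ℝ) / (q * k : ℕ) ≤ 2 / C := by
    intro k hk
    have : (Y : ℝ) ≤ k := by exact_mod_cast hk
    rw [hC]
    push_cast
    gcongr
  have hp1 : (0 : ℝ) < 2 / (q * y : ℕ) := by push_cast; positivity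
  have hp2 : (0 : ℝ) < 2 / (q * n : ℕ) := by push_cast; positivity
  have hΔ : (a : ℝ) / (q * y : ℕ) - (a' : ℝ) / (q * n : ℕ) = h / (q * s * n) := by
    rw [hh, ha, hys]
    push_cast
    field_simp
  have habs : |(a : ℝ) / (q * y : ℕ) - (a' : ℝ) / (q * n : ℕ)| = (h.natAbs : ℝ) / (q * s * n) := by
    rw [hΔ, abs_div, abs_of_pos (by positivity : (0 : ℝ) < q * s * n), Nat.cast_natAbs, Int.cast_abs]
  unfold fracWave
  split_ifs with hlt
  · unfold corrBound
    split_ifs with h0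
    · have := abs_integral_wave_mul_wave_le ν (p₁ := (a : ℝ) / (q * y : ℕ))
        (p₂ := (a' : ℝ) / (q * n : ℕ)) hp1 hp2 (hR y hy.1) (hR n hn.1)
      refine this.trans (le_of_eq ?_)
      ring
    · have hna : (0 : ℝ) < h.natAbs := by exact_mod_cast Int.natAbs_pos.2 h0
      have hne : (a : ℝ) / (q * y : ℕ) ≠ (a' : ℝ) / (q * n : ℕ) := by
        rw [← sub_ne_zero, ← abs_pos, habs]
        positivity
      have := abs_integral_wave_mul_wave_le_sqrt hν hp1 hp2 (hR y hy.1) (hR n hn.1) hne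
      refine this.trans ?_
      rw [habs]
      calc 21 * √((2 / C) ^ 3 / (ν * ((h.natAbs : ℝ) / (q * s * n))))
          ≤ 21 * √((4 / C) ^ 2 * ((s : ℝ) / ν) * (1 / h.natAbs)) := by
            gcongr
            have e1 : (2 / C) ^ 3 / (ν * ((h.natAbs : ℝ) / (q * s * n)))
              = 8 * (q * n) / C ^ 3 * ((s : ℝ) / ν) * (1 / h.natAbs) := by
              field_simp
              ring
            have e2 : (4 / C) ^ 2 = 8 * (q * (2 * Y)) / C ^ 3 := by
              rw [hC]; field_simp; ring
            rw [e1, e2]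
            gcongr
        _ = _ := by
            rw [Real.sqrt_mul (by positivity), Real.sqrt_mul (by positivity),
              Real.sqrt_sq (by positivity), Real.sqrt_div zero_le_one, Real.sqrt_one]
            ring
  · have hz : ∀ t, wave ν ((a : ℝ) / (q * y : ℕ)) (2 / (q * y : ℕ)) t *
        wave ν ((a' : ℝ) / (q * n : ℕ)) (2 / (q * n : ℕ)) t = 0 := by
      refine wave_mul_wave_eq_zero hp1 hp2 (hR y hy.1) (hR n hn.1) ?_
      rw [habs, le_div_iff₀ (by positivity)]
      have h8 : (8 * s : ℝ) ≤ h.natAbs := by exact_mod_cast not_lt.1 hlt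
      refine le_trans ?_ h8
      rw [hC]
      have : 2 * (2 / ((q : ℝ) * Y)) * (q * s * n) = 4 * s * (n / Y) := by field_simp; ring
      rw [this]
      have : (n : ℝ) / Y ≤ 2 := by rw [div_le_iff₀ hY']; exact hn2
      nlinarith
    have e : ∫ t, wave ν ((a : ℝ) / (q * y : ℕ)) (2 / (q * y : ℕ)) t *
        wave ν ((a' : ℝ) / (q * n : ℕ)) (2 / (q * n : ℕ)) t = 0 := by
      simp only [hz, integral_zero]
    exact (abs_eq_zero.2 e).le

/-- The row sums of the Gram matrix of the waves. -/
theorem sum_abs_integral_fracWave_le {ν q Y : ℕ} (hν : 0 < ν) (hq : 0 < q) (hY : 0 < Y) {y a : ℕ}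
    (hy : y ∈ Finset.Ico Y (2 * Y)) :
    ∑ i ∈ fracIndex q Y, |∫ t, fracWave ν q ⟨y, a⟩ t * fracWave ν q i t|
      ≤ 1 / (q * Y : ℝ) * (12 * (Nat.gcd a y : ℝ) + 3000 * (Y / √(ν : ℝ))) := by
  have hy' := Finset.mem_Ico.1 hy
  have hy0 : 0 < y := hY.trans_le hy'.1
  set g := Nat.gcd a y with hgdef
  have hg : 0 < g := Nat.gcd_pos_of_pos_right _ hy0
  obtain ⟨b, s, hcop, hab, hys⟩ : ∃ b s : ℕ, Nat.Coprime b s ∧ a = g * b ∧ y = g * s := by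
    refine ⟨a / g, y / g, Nat.coprime_div_gcd_div_gcd hg, ?_, ?_⟩
    · exact (Nat.mul_div_cancel' (Nat.gcd_dvd_left a y)).symm
    · exact (Nat.mul_div_cancel' (Nat.gcd_dvd_right a y)).symm
  have hs0 : 0 < s := by
    rcases Nat.eq_zero_or_pos s with h | h
    · rw [h] at hys; omega
    · exact h
  set C : ℝ := q * Y with hC
  have hq' : (0 : ℝ) < q := by exact_mod_cast hq
  have hY' : (0 : ℝ) < Y := by exact_mod_cast hY
  have hs' : (0 : ℝ) < s := by exact_mod_cast hs0
  have hg' : (0 : ℝ) < g := by exact_mod_cast hg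
  have hν' : (0 : ℝ) < ν := by exact_mod_cast hν
  have hCpos : 0 < C := by positivity
  set η : ((_ : ℕ) × ℕ) → ℤ := fun i => (b : ℤ) * i.1 - i.2 * s with hη
  set H : Finset ℤ := Finset.Icc (-(8 * s : ℤ)) (8 * s) with hH
  have hcb : ∀ h, 0 ≤ corrBound ν s C h := by
    intro h
    unfold corrBound
    split_ifs <;> positivity
  -- For given h the pair is determined by n, and n is determined modulo s because b is prime to s.
  -- As s ≤ 2Y, the count Y/s + 1 is at most 3Y/s.
  have hfib : ∀ h : ℤ, (((fracIndex q Y).filter fun i => η i = h).card : ℝ) ≤ 3 * Y / s := by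
    intro h
    set T := (fracIndex q Y).filter fun i => η i = h with hT
    have hinj : Set.InjOn Sigma.fst (T : Set ((_ : ℕ) × ℕ)) := by
      rintro ⟨n, x⟩ hi ⟨n', x'⟩ hi' hnn
      have e1 := (Finset.mem_filter.1 (Finset.mem_coe.1 hi)).2
      have e2 := (Finset.mem_filter.1 (Finset.mem_coe.1 hi')).2
      simp only at hnn
      subst hnn
      simp only [hη] at e1 e2
      have : (x : ℤ) * s = x' * s := by linarith
      have hx : (x : ℤ) = x' := mul_right_cancel₀ (by exact_mod_cast hs0.ne') this
      rw [Int.natCast_inj.1 hx]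
    have hcard : T.card ≤ Y / s + 1 := by
      rw [← Finset.card_image_of_injOn hinj]
      refine card_le_of_congruent_Ico _ ?_ ?_
      · intro n hn
        obtain ⟨i, hi, rfl⟩ := Finset.mem_image.1 hn
        exact (Finset.mem_sigma.1 (Finset.mem_filter.1 hi).1).1
      · intro n hn n' hn'
        obtain ⟨i, hi, rfl⟩ := Finset.mem_image.1 hn
        obtain ⟨i', hi', rfl⟩ := Finset.mem_image.1 hn'
        have e1 := (Finset.mem_filter.1 hi).2
        have e2 := (Finset.mem_filter.1 hi').2
        simp only [hη] at e1 e2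
        have hc : IsCoprime (s : ℤ) b := (Nat.isCoprime_iff_coprime.2 hcop).symm
        refine hc.dvd_of_dvd_mul_left (Dvd.intro ((i.2 : ℤ) - i'.2) ?_)
        linarith
    have hle : (T.card : ℝ) ≤ Y / s + 1 := by
      have h1 : (T.card : ℝ) ≤ ((Y / s + 1 : ℕ) : ℝ) := by exact_mod_cast hcard
      refine h1.trans ?_
      push_cast
      gcongr
      exact Nat.cast_div_le
    refine hle.trans ?_
    have h2 : (s : ℝ) ≤ 2 * Y := by
      have : s ≤ 2 * Y := (Nat.le_of_dvd hy0 (Dvd.intro_left g hys.symm)).trans hy'.2.le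
      exact_mod_cast this
    have h3 : (1 : ℝ) ≤ 2 * Y / s := by rw [le_div_iff₀ hs']; linarith
    have : 3 * (Y : ℝ) / s = Y / s + 2 * Y / s := by ring
    linarith
  -- The term h = 0 becomes the gcd term after multiplication by 3Y/s. The sum of |h|^{−1/2} up to
  -- 8s is O(√s), so the other terms give O(s/√ν), in which s cancels against 3Y/s.
  have hsum : ∑ h ∈ H, corrBound ν s C h ≤ 4 / C + 1000 / C * (s / √(ν : ℝ)) := by
    have hsplit : ∀ N : ℕ, ∑ h ∈ Finset.Icc (-(N : ℤ)) N, corrBound ν s C h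
        = 4 / C + 2 * ∑ h ∈ Finset.Icc 1 N, 84 / C * (√((s : ℝ) / ν) * (1 / √(h : ℝ))) := by
      intro N
      induction N with
      | zero => simp [corrBound]
      | succ n ih =>
        have hset : Finset.Icc (-((n + 1 : ℕ) : ℤ)) ((n + 1 : ℕ) : ℤ)
            = insert (-((n + 1 : ℕ) : ℤ)) (insert ((n + 1 : ℕ) : ℤ) (Finset.Icc (-(n : ℤ)) n)) := by
          ext x
          simp only [Finset.mem_insert, Finset.mem_Icc]
          push_cast
          omega
        rw [hset, Finset.sum_insert, Finset.sum_insert, ih, Finset.sum_Icc_succ_top (by omega)]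
        · have e1 : corrBound ν s C (-((n + 1 : ℕ) : ℤ))
              = 84 / C * (√((s : ℝ) / ν) * (1 / √((n + 1 : ℕ) : ℝ))) := by
            rw [corrBound, if_neg (by push_cast; omega), Int.natAbs_neg, Int.natAbs_natCast]
          have e2 : corrBound ν s C ((n + 1 : ℕ) : ℤ)
              = 84 / C * (√((s : ℝ) / ν) * (1 / √((n + 1 : ℕ) : ℝ))) := by
            rw [corrBound, if_neg (by push_cast; omega), Int.natAbs_natCast]
          rw [e1, e2]
          ring
        · simp only [Finset.mem_Icc]; push_cast; omega
        · simp only [Finset.mem_insert, Finset.mem_Icc]; push_cast; omega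
    have h8 := hsplit (8 * s)
    push_cast at h8
    rw [hH, h8, ← Finset.mul_sum, ← Finset.mul_sum]
    have h9 := sum_inv_sqrt_le (8 * s)
    have h10 : √((s : ℝ) / ν) * √((8 * s : ℕ) : ℝ) ≤ 3 * (s / √(ν : ℝ)) - s / √(ν : ℝ) / 10 := by
      rw [Real.sqrt_div hs'.le]
      push_cast
      rw [Real.sqrt_mul (by norm_num)]
      have e : √(s : ℝ) / √(ν : ℝ) * (√8 * √(s : ℝ)) = √8 * (√(s : ℝ) ^ 2 / √(ν : ℝ)) := by ring
      rw [e, Real.sq_sqrt hs'.le]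
      have h8 : √(8 : ℝ) ≤ 29 / 10 := by
        rw [Real.sqrt_le_left (by norm_num)]; norm_num
      have : 0 ≤ (s : ℝ) / √(ν : ℝ) := by positivity
      nlinarith
    have h11 : √((s : ℝ) / ν) * ∑ h ∈ Finset.Icc 1 (8 * s), 1 / √(h : ℝ)
        ≤ 29 / 5 * (s / √(ν : ℝ)) := by
      calc _ ≤ √((s : ℝ) / ν) * (2 * √((8 * s : ℕ) : ℝ)) := by gcongr
        _ = 2 * (√((s : ℝ) / ν) * √((8 * s : ℕ) : ℝ)) := by ring
        _ ≤ _ := by linarith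
    have h12 : 2 * (84 / C * (√((s : ℝ) / ν) * ∑ h ∈ Finset.Icc 1 (8 * s), 1 / √(h : ℝ)))
        ≤ 2 * (84 / C * (29 / 5 * (s / √(ν : ℝ)))) := by gcongr
    have h13 : 2 * (84 / C * (29 / 5 * (s / √(ν : ℝ)))) ≤ 1000 / C * (s / √(ν : ℝ)) := by
      have : 2 * (84 / C * (29 / 5 * (s / √(ν : ℝ)))) = (4872 / 5) / C * (s / √(ν : ℝ)) := by ring
      rw [this]
      gcongr
      norm_num
    linarith
  calc ∑ i ∈ fracIndex q Y, |∫ t, fracWave ν q ⟨y, a⟩ t * fracWave ν q i t|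
      ≤ ∑ i ∈ fracIndex q Y, if η i ∈ H then corrBound ν s C (η i) else 0 := by
        refine Finset.sum_le_sum fun i hi => ?_
        have hi' := (Finset.mem_sigma.1 hi).1
        refine (abs_integral_fracWave_le hν hq hY (a' := i.2) hy hi' hg hab hys).trans ?_
        split_ifs with h1 h2 h2
        · exact le_rfl
        · exfalso
          apply h2
          rw [hH, Finset.mem_Icc]
          simp only [hη]
          omega
        · exact hcb _
        · exact le_rfl
    _ = ∑ h ∈ H, ∑ i ∈ (fracIndex q Y).filter (fun i => η i = h), corrBound ν s C h := by
        rw [← Finset.sum_filter]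
        rw [← Finset.sum_fiberwise_of_maps_to (s := (fracIndex q Y).filter fun i => η i ∈ H) (t := H)
          (g := η) (fun i hi => (Finset.mem_filter.1 hi).2)]
        refine Finset.sum_congr rfl fun h hh => ?_
        rw [Finset.filter_filter]
        refine Finset.sum_congr ?_ ?_
        · ext i
          simp only [Finset.mem_filter]
          constructor
          · rintro ⟨h1, -, h3⟩
            exact ⟨h1, h3⟩
          · rintro ⟨h1, h3⟩
            exact ⟨h1, h3 ▸ hh, h3⟩
        · intro i hi
          rw [(Finset.mem_filter.1 hi).2]
    _ ≤ ∑ h ∈ H, 3 * Y / s * corrBound ν s C h := by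
        refine Finset.sum_le_sum fun h _ => ?_
        rw [Finset.sum_const, nsmul_eq_mul]
        exact mul_le_mul_of_nonneg_right (hfib h) (hcb h)
    _ ≤ 3 * Y / s * (4 / C + 1000 / C * (s / √(ν : ℝ))) := by
        rw [← Finset.mul_sum]
        gcongr
    _ = 1 / C * (12 * (Y / s) + 3000 * (Y / √(ν : ℝ))) := by
        have : √(ν : ℝ) ≠ 0 := (Real.sqrt_pos.2 hν').ne'
        field_simp
        ring
    _ ≤ _ := by
        gcongr
        rw [div_le_iff₀ hs']
        have : Y ≤ g * s := hys ▸ hy'.1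
        exact_mod_cast this

end PoincareMoment

end


open scoped MatrixGroups ContDiff UpperHalfPlane

noncomputable section

namespace PoincareMoment

open MeasureTheory Set

/-! ### Sums of Kloosterman sums -/

/-- The twisted Kloosterman sum `∑ w(x) e(m (x + x⁻¹) / c)` over the reduced residues `x`
modulo `c`. -/
def kloosterman (w : ℕ → ℂ) (c m : ℕ) : ℂ :=
  ∑ x ∈ unitRes c, w x * eChar ((m : ℝ) * resTrace c x / c)

/-- The sum of the weights over the reduced residues with trace `a`. -/
def traceWeight (w : ℕ → ℂ) (c a : ℕ) : ℂ :=
  ∑ x ∈ (unitRes c).filter (fun x => resTrace c x = a), w x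

lemma norm_traceWeight_le {w : ℕ → ℂ} (hw : ∀ x, ‖w x‖ ≤ 1) (c a : ℕ) :
    ‖traceWeight w c a‖ ≤ traceCount c a := by
  refine (norm_sum_le _ _).trans ?_
  rw [traceCount]
  calc _ ≤ ∑ _x ∈ (unitRes c).filter (fun x => resTrace c x = a), (1 : ℝ) :=
        Finset.sum_le_sum fun x _ => hw x
    _ = _ := by simp

lemma kloosterman_eq_sum_traceWeight (w : ℕ → ℂ) {c : ℕ} (hc : 0 < c) (m : ℕ) :
    kloosterman w c m
      = ∑ a ∈ Finset.range c, traceWeight w c a * eChar ((m : ℝ) * a / c) := by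
  rw [kloosterman, ← Finset.sum_fiberwise_of_maps_to (t := Finset.range c) (g := resTrace c)
    (fun x _ => Finset.mem_range.2 (resTrace_lt hc x))]
  refine Finset.sum_congr rfl fun a _ => ?_
  rw [traceWeight, Finset.sum_mul]
  refine Finset.sum_congr rfl fun x hx => ?_
  rw [(Finset.mem_filter.1 hx).2]

lemma sum_norm_traceWeight_sq_le {w : ℕ → ℂ} (hw : ∀ x, ‖w x‖ ≤ 1) {c : ℕ} (hc : 0 < c) :
    ∑ a ∈ Finset.range c, ‖traceWeight w c a‖ ^ 2 ≤ 8 * c * (c.divisors.card : ℝ) ^ 4 := by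
  calc ∑ a ∈ Finset.range c, ‖traceWeight w c a‖ ^ 2
      ≤ ∑ a ∈ Finset.range c, ((traceCount c a : ℝ)) ^ 2 := by
        gcongr with a
        exact norm_traceWeight_le hw c a
    _ ≤ _ := by exact_mod_cast sum_traceCount_sq_le hc

lemma sum_norm_traceWeight_sq_mul_gcd_le {w : ℕ → ℂ} (hw : ∀ x, ‖w x‖ ≤ 1) {c y : ℕ}
    (hc : 0 < c) (hy : y ∣ c) :
    ∑ a ∈ Finset.range c, ‖traceWeight w c a‖ ^ 2 * (Nat.gcd a y : ℝ)
      ≤ 8 * c * (c.divisors.card : ℝ) ^ 4 := by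
  calc ∑ a ∈ Finset.range c, ‖traceWeight w c a‖ ^ 2 * (Nat.gcd a y : ℝ)
      ≤ ∑ a ∈ Finset.range c, ((traceCount c a : ℝ)) ^ 2 * (Nat.gcd a y : ℝ) := by
        gcongr with a
        exact norm_traceWeight_le hw c a
    _ ≤ _ := by exact_mod_cast sum_traceCount_sq_mul_gcd_le hc hy

/-- The part of the sum of Kloosterman sums with moduli `q n`, `n ∈ s`. -/
def kloostermanPart (w : ℕ → ℂ) (ν q m : ℕ) (s : Finset ℕ) : ℂ :=
  ∑ n ∈ s, 1 / ((q * n : ℕ) : ℂ) * kloosterman w (q * n) m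
    * besselInt ν (4 * Real.pi * m / (q * n : ℕ))

/-- The radius 2/c is dictated by 2πm·(2/c) = 4πm/c. Placing the centre at a/c supplies the phase
e(ma/c), so the Kloosterman sum and the Bessel factor are absorbed together. -/
lemma kloostermanPart_eq_sum_fracWave (w : ℕ → ℂ) {ν q Y m : ℕ} (hν : 0 < ν) (hq : 0 < q)
    (hY : 0 < Y) (hm : 0 < m) :
    kloostermanPart w ν q m (Finset.Ico Y (2 * Y))
      = (2 * Real.pi * Complex.I * m / ν) *
        ∑ j ∈ fracIndex q Y, traceWeight w (q * j.1) j.2 / ((q * j.1 : ℕ) : ℂ) *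
          ∫ t, (fracWave ν q j t : ℂ) * eChar (m * t) := by
  rw [kloostermanPart, fracIndex, Finset.sum_sigma, Finset.mul_sum]
  refine Finset.sum_congr rfl fun n hn => ?_
  have hn0 : 0 < n := hY.trans_le (Finset.mem_Ico.1 hn).1
  have hc : 0 < q * n := Nat.mul_pos hq hn0
  rw [kloosterman_eq_sum_traceWeight w hc, Finset.mul_sum, Finset.sum_mul, Finset.mul_sum]
  refine Finset.sum_congr rfl fun a _ => ?_
  set c := q * n with hcdef
  have hc' : (0 : ℝ) < c := by exact_mod_cast hc
  have hcc : (c : ℂ) ≠ 0 := by exact_mod_cast hc.ne'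
  have hmm : (m : ℂ) ≠ 0 := by exact_mod_cast hm.ne'
  have hνν : (ν : ℂ) ≠ 0 := by exact_mod_cast hν.ne'
  have hpi : (Real.pi : ℂ) ≠ 0 := by exact_mod_cast Real.pi_ne_zero
  have hI := Complex.I_ne_zero
  have h := integral_wave_mul_exp ν (p := (a : ℝ) / c) (R := 2 / c) (m := m) (by positivity)
    (by exact_mod_cast hm.ne')
  have e1 : ∫ t, (fracWave ν q ⟨n, a⟩ t : ℂ) * eChar (m * t)
      = ∫ t, (wave ν ((a : ℝ) / c) (2 / c) t : ℂ) *
        Complex.exp (2 * Real.pi * Complex.I * (m : ℝ) * t) := by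
    refine integral_congr_ae (Filter.Eventually.of_forall fun t => ?_)
    simp only [fracWave, eChar, ← hcdef]
    push_cast
    ring_nf
  have e2 : 2 * Real.pi * (m : ℝ) * (2 / c) = 4 * Real.pi * m / c := by ring
  have e3 : Complex.exp (2 * Real.pi * Complex.I * (m : ℝ) * ((a : ℝ) / c : ℝ))
      = eChar ((m : ℝ) * a / c) := by
    rw [eChar]
    congr 1
    push_cast
    ring
  rw [e1, h, e2, e3]
  push_cast
  field_simp
  ring

/-- The mean square of the contribution of a dyadic range of moduli. -/
theorem sum_norm_sq_kloostermanPart_dyadic_le {w : ℕ → ℂ} (hw : ∀ x, ‖w x‖ ≤ 1) {ν q Y : ℕ}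
    (hν : 0 < ν) (hq : 0 < q) (hY : 0 < Y) {M T : ℝ} (S : Finset ℕ)
    (hS : ∀ m ∈ S, 0 < m ∧ (m : ℝ) ≤ 3 * M)
    (hT : ∀ n ∈ Finset.Ico Y (2 * Y), ((q * n).divisors.card : ℝ) ≤ T) :
    ∑ m ∈ S, ‖kloostermanPart w ν q m (Finset.Ico Y (2 * Y))‖ ^ 2
      ≤ (6 * Real.pi * M / ν) ^ 2 * (5 * (16 * T ^ 4 * Y / (q * Y : ℝ) ^ 2 *
        (12 + 3000 * (Y / √(ν : ℝ))))) := by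
  have hq' : (0 : ℝ) < q := by exact_mod_cast hq
  have hY' : (0 : ℝ) < Y := by exact_mod_cast hY
  have hν' : (0 : ℝ) < ν := by exact_mod_cast hν
  set C : ℝ := q * Y with hC
  have hCpos : 0 < C := by positivity
  have hT0 : 0 ≤ T := (Nat.cast_nonneg _).trans
    (hT Y (Finset.mem_Ico.2 ⟨le_rfl, by omega⟩))
  set α : ((_ : ℕ) × ℕ) → ℂ := fun j => traceWeight w (q * j.1) j.2 / ((q * j.1 : ℕ) : ℂ) with hα
  have hsieve := sum_norm_sq_sum_mul_integral_le (fracIndex q Y) (fracWave ν q) α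
    (fun j _ => continuous_wave _ _ _)
    (fun j hj t ht => by
      obtain ⟨h1, h2⟩ := Finset.mem_sigma.1 hj
      have hn0 : 0 < j.1 := hY.trans_le (Finset.mem_Ico.1 h1).1
      have hc : 0 < q * j.1 := Nat.mul_pos hq hn0
      have hc' : (1 : ℝ) ≤ (q * j.1 : ℕ) := by exact_mod_cast hc
      have ha : ((j.2 : ℝ)) ≤ (q * j.1 : ℕ) := by exact_mod_cast (Finset.mem_range.1 h2).le
      refine wave_eq_zero (by positivity) ?_
      have p1 : (j.2 : ℝ) / (q * j.1 : ℕ) ≤ 1 := by rw [div_le_one (by linarith)]; exact ha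
      have p0 : 0 ≤ (j.2 : ℝ) / (q * j.1 : ℕ) := by positivity
      have r2 : (2 : ℝ) / (q * j.1 : ℕ) ≤ 2 := div_le_self zero_le_two hc'
      rw [mem_Icc, not_and_or, not_le, not_le] at ht
      rcases ht with ht | ht
      · rw [abs_sub_comm]
        exact le_trans (by linarith) (le_abs_self _)
      · exact le_trans (by linarith) (le_abs_self _)) S
  have hrow : ∑ j ∈ fracIndex q Y, ‖α j‖ ^ 2 *
      ∑ i ∈ fracIndex q Y, |∫ t, fracWave ν q j t * fracWave ν q i t|
      ≤ 16 * T ^ 4 * Y / C ^ 2 * (12 + 3000 * (Y / √(ν : ℝ))) := by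
    rw [fracIndex, Finset.sum_sigma, ← fracIndex]
    calc ∑ n ∈ Finset.Ico Y (2 * Y), ∑ a ∈ Finset.range (q * n), ‖α ⟨n, a⟩‖ ^ 2 *
          ∑ i ∈ fracIndex q Y, |∫ t, fracWave ν q ⟨n, a⟩ t * fracWave ν q i t|
        ≤ ∑ n ∈ Finset.Ico Y (2 * Y), 16 * T ^ 4 / C ^ 2 * (12 + 3000 * (Y / √(ν : ℝ))) := by
          refine Finset.sum_le_sum fun n hn => ?_
          have hn' := Finset.mem_Ico.1 hn
          have hn0 : 0 < n := hY.trans_le hn'.1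
          have hc : 0 < q * n := Nat.mul_pos hq hn0
          have hYn : (Y : ℝ) ≤ n := by exact_mod_cast hn'.1
          have hcC : C ≤ (q * n : ℕ) := by rw [hC]; push_cast; gcongr
          have hnY : (n : ℝ) ≤ 2 * Y := by exact_mod_cast hn'.2.le
          have hcC2 : ((q * n : ℕ) : ℝ) ≤ 2 * C := by
            rw [hC]; push_cast
            nlinarith
          have hτ := hT n hn
          have hτ4 : ((q * n).divisors.card : ℝ) ^ 4 ≤ T ^ 4 := by gcongr
          -- The gcd in the row sums is taken with n, a divisor of the modulus qn, so the weighted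
          -- second moment absorbs it.
          have b1 := sum_norm_traceWeight_sq_mul_gcd_le hw hc (Dvd.intro_left q rfl : n ∣ q * n)
          have b2 := sum_norm_traceWeight_sq_le hw hc
          have b3 : 8 * ((q * n : ℕ) : ℝ) * ((q * n).divisors.card : ℝ) ^ 4 ≤ 8 * (2 * C) * T ^ 4 := by
            gcongr
          calc ∑ a ∈ Finset.range (q * n), ‖α ⟨n, a⟩‖ ^ 2 *
                ∑ i ∈ fracIndex q Y, |∫ t, fracWave ν q ⟨n, a⟩ t * fracWave ν q i t|
              ≤ ∑ a ∈ Finset.range (q * n), (‖traceWeight w (q * n) a‖ ^ 2 / C ^ 2) *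
                (1 / C * (12 * (Nat.gcd a n : ℝ) + 3000 * (Y / √(ν : ℝ)))) := by
                refine Finset.sum_le_sum fun a _ => ?_
                refine mul_le_mul ?_ (sum_abs_integral_fracWave_le hν hq hY hn)
                  (Finset.sum_nonneg fun _ _ => abs_nonneg _) (by positivity)
                rw [hα, norm_div, div_pow, Complex.norm_natCast]
                gcongr
            _ = 1 / C ^ 3 * (12 * ∑ a ∈ Finset.range (q * n),
                  ‖traceWeight w (q * n) a‖ ^ 2 * (Nat.gcd a n : ℝ)
                + 3000 * (Y / √(ν : ℝ)) * ∑ a ∈ Finset.range (q * n),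
                  ‖traceWeight w (q * n) a‖ ^ 2) := by
                rw [Finset.mul_sum, Finset.mul_sum, ← Finset.sum_add_distrib, Finset.mul_sum]
                refine Finset.sum_congr rfl fun a _ => ?_
                field_simp
            _ ≤ 1 / C ^ 3 * (12 * (8 * (2 * C) * T ^ 4)
                + 3000 * (Y / √(ν : ℝ)) * (8 * (2 * C) * T ^ 4)) := by
                gcongr
                · exact b1.trans b3
                · exact b2.trans b3
            _ = _ := by
                field_simp
                ring
      _ = _ := by
          rw [Finset.sum_const, Nat.card_Ico, nsmul_eq_mul, show 2 * Y - Y = Y by omega]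
          ring
  calc ∑ m ∈ S, ‖kloostermanPart w ν q m (Finset.Ico Y (2 * Y))‖ ^ 2
      ≤ ∑ m ∈ S, (6 * Real.pi * M / ν) ^ 2 *
          ‖∑ j ∈ fracIndex q Y, α j * ∫ t, (fracWave ν q j t : ℂ) * eChar (m * t)‖ ^ 2 := by
        refine Finset.sum_le_sum fun m hm => ?_
        obtain ⟨hm0, hmM⟩ := hS m hm
        rw [kloostermanPart_eq_sum_fracWave w hν hq hY hm0, norm_mul, mul_pow]
        gcongr
        rw [norm_div, norm_mul, norm_mul, norm_mul, Complex.norm_I, Complex.norm_real,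
          Complex.norm_natCast, Complex.norm_natCast, Real.norm_of_nonneg Real.pi_pos.le,
          Complex.norm_ofNat, mul_one]
        refine div_le_div_of_nonneg_right ?_ hν'.le
        nlinarith [Real.pi_pos]
    _ = (6 * Real.pi * M / ν) ^ 2 * ∑ m ∈ S,
          ‖∑ j ∈ fracIndex q Y, α j * ∫ t, (fracWave ν q j t : ℂ) * eChar (m * t)‖ ^ 2 := by
        rw [Finset.mul_sum]
    _ ≤ _ := by
        gcongr
        refine hsieve.trans ?_
        gcongr

/-! ### Small moduli: orthogonality over full periods -/

lemma eChar_neg (t : ℝ) : eChar (-t) = (starRingEnd ℂ) (eChar t) := by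
  rw [eChar, eChar, ← Complex.exp_conj]
  congr 1
  simp only [map_mul, map_ofNat, Complex.conj_ofReal, Complex.conj_I]
  push_cast
  ring

lemma eChar_natCast_mul (r : ℕ) (t : ℝ) : eChar (r * t) = eChar t ^ r := by
  rw [eChar, eChar, ← Complex.exp_nat_mul]
  congr 1
  push_cast
  ring

/-- Orthogonality of the additive characters modulo `c`. -/
lemma sum_eChar_mul_conj {c a b : ℕ} (ha : a < c) (hb : b < c) :
    ∑ r ∈ Finset.range c, eChar ((r : ℝ) * a / c) * (starRingEnd ℂ) (eChar ((r : ℝ) * b / c))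
      = if a = b then (c : ℂ) else 0 := by
  have hc : (0 : ℝ) < c := by exact_mod_cast (Nat.zero_le a).trans_lt ha
  set ζ := eChar (((a : ℝ) - b) / c) with hζ
  have hterm : ∀ r : ℕ, eChar ((r : ℝ) * a / c) * (starRingEnd ℂ) (eChar ((r : ℝ) * b / c))
      = ζ ^ r := by
    intro r
    rw [← eChar_neg, ← eChar_add, hζ, ← eChar_natCast_mul]
    congr 1
    ring
  simp only [hterm]
  split_ifs with hab
  · have : ζ = 1 := by
      rw [hζ, hab, sub_self, zero_div]
      simpa using eChar_intCast 0
    rw [this]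
    simp
  · have h1 : ζ ^ c = 1 := by
      rw [hζ, ← eChar_natCast_mul, mul_div_cancel₀ _ hc.ne']
      have := eChar_intCast ((a : ℤ) - b)
      push_cast at this
      exact this
    have h2 : ζ ≠ 1 := by
      intro h
      rw [hζ, eChar, Complex.exp_eq_one_iff] at h
      obtain ⟨n, hn⟩ := h
      have h3 : ((((a : ℝ) - b) / c : ℝ) : ℂ) = n := by
        have hne : (2 * Real.pi * Complex.I : ℂ) ≠ 0 := Complex.two_pi_I_ne_zero
        apply mul_left_cancel₀ hne
        rw [hn]
        ring
      have h4 : ((a : ℝ) - b) / c = n := by exact_mod_cast h3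
      rw [div_eq_iff hc.ne'] at h4
      have h5 : (a : ℤ) - b = n * c := by exact_mod_cast h4
      have h6 : n = 0 := by
        have hac : (a : ℤ) < c := by exact_mod_cast ha
        have hbc : (b : ℤ) < c := by exact_mod_cast hb
        rcases lt_trichotomy n 0 with h | h | h
        · nlinarith
        · exact h
        · nlinarith
      rw [h6] at h5
      omega
    have := mul_geom_sum ζ c
    rw [h1, sub_self, mul_eq_zero] at this
    exact this.resolve_left (sub_ne_zero.2 h2)

/-- Parseval on ℤ/c: as a function of r the Kloosterman sum is the discrete Fourier transform of the
trace weights. -/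
lemma sum_range_norm_sq_kloosterman (w : ℕ → ℂ) {c : ℕ} (hc : 0 < c) :
    ∑ r ∈ Finset.range c, ‖kloosterman w c r‖ ^ 2
      = c * ∑ a ∈ Finset.range c, ‖traceWeight w c a‖ ^ 2 := by
  have key : ∑ r ∈ Finset.range c, kloosterman w c r * (starRingEnd ℂ) (kloosterman w c r)
      = c * ∑ a ∈ Finset.range c, traceWeight w c a * (starRingEnd ℂ) (traceWeight w c a) := by
    simp only [kloosterman_eq_sum_traceWeight w hc, map_sum, map_mul, Finset.sum_mul_sum]
    rw [Finset.sum_comm, Finset.mul_sum]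
    refine Finset.sum_congr rfl fun a ha => ?_
    rw [Finset.sum_comm]
    have : ∀ b ∈ Finset.range c, ∑ r ∈ Finset.range c,
        traceWeight w c a * eChar ((r : ℝ) * a / c) *
          ((starRingEnd ℂ) (traceWeight w c b) * (starRingEnd ℂ) (eChar ((r : ℝ) * b / c)))
        = if a = b then (c : ℂ) * (traceWeight w c a * (starRingEnd ℂ) (traceWeight w c a))
          else 0 := by
      intro b hb
      have h := sum_eChar_mul_conj (Finset.mem_range.1 ha) (Finset.mem_range.1 hb)
      have e : ∀ r : ℕ, traceWeight w c a * eChar ((r : ℝ) * a / c) *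
          ((starRingEnd ℂ) (traceWeight w c b) * (starRingEnd ℂ) (eChar ((r : ℝ) * b / c)))
          = traceWeight w c a * (starRingEnd ℂ) (traceWeight w c b) *
          (eChar ((r : ℝ) * a / c) * (starRingEnd ℂ) (eChar ((r : ℝ) * b / c))) := fun r => by ring
      simp only [e]
      rw [← Finset.mul_sum, h]
      split_ifs with hab
      · rw [hab]; ring
      · ring
    rw [Finset.sum_congr rfl this, Finset.sum_ite_eq, if_pos ha]
  simp only [Complex.mul_conj, Complex.normSq_eq_norm_sq] at key
  exact_mod_cast key

lemma kloosterman_add_mul (w : ℕ → ℂ) {c : ℕ} (hc : 0 < c) (l r : ℕ) :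
    kloosterman w c (c * l + r) = kloosterman w c r := by
  have hc' : (c : ℝ) ≠ 0 := by exact_mod_cast hc.ne'
  refine Finset.sum_congr rfl fun x _ => ?_
  have e : ((c * l + r : ℕ) : ℝ) * resTrace c x / c
      = ((l * resTrace c x : ℕ) : ℤ) + (r : ℝ) * resTrace c x / c := by
    push_cast
    field_simp
  rw [e, eChar_add, eChar_intCast, one_mul]

/-- The sum is c-periodic in m. As c ≤ N, the range up to N is covered by K full periods with Kc ≤
2N. -/
lemma sum_norm_sq_kloosterman_le {w : ℕ → ℂ} (hw : ∀ x, ‖w x‖ ≤ 1) {c : ℕ} (hc : 0 < c) {N : ℝ}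
    (hN : (c : ℝ) ≤ N) (S : Finset ℕ) (hS : ∀ m ∈ S, (m : ℝ) ≤ N) :
    ∑ m ∈ S, ‖kloosterman w c m‖ ^ 2 ≤ 16 * N * (c * (c.divisors.card : ℝ) ^ 4) := by
  have hc' : (0 : ℝ) < c := by exact_mod_cast hc
  have hN0 : 0 ≤ N := hc'.le.trans hN
  have hper : ∀ K : ℕ, ∑ m ∈ Finset.range (c * K), ‖kloosterman w c m‖ ^ 2
      = K * (c * ∑ a ∈ Finset.range c, ‖traceWeight w c a‖ ^ 2) := by
    intro K
    induction K with
    | zero => simp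
    | succ K ih =>
      rw [Nat.mul_succ, Finset.sum_range_add, ih]
      simp only [kloosterman_add_mul w hc, sum_range_norm_sq_kloosterman w hc]
      push_cast
      ring
  set K := ⌊N / c⌋₊ + 1 with hK
  have hsub : S ⊆ Finset.range (c * K) := by
    intro m hm
    rw [Finset.mem_range]
    have h1 := Nat.lt_floor_add_one (N / c)
    rw [div_lt_iff₀ hc'] at h1
    have h2 : (m : ℝ) < (c * K : ℕ) := by
      rw [hK]
      push_cast
      linarith [hS m hm]
    exact_mod_cast h2
  have hKle : (K : ℝ) * c ≤ 2 * N := by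
    have h1 := Nat.floor_le (by positivity : 0 ≤ N / c)
    rw [le_div_iff₀ hc'] at h1
    rw [hK]
    push_cast
    linarith
  calc ∑ m ∈ S, ‖kloosterman w c m‖ ^ 2
      ≤ ∑ m ∈ Finset.range (c * K), ‖kloosterman w c m‖ ^ 2 :=
        Finset.sum_le_sum_of_subset_of_nonneg hsub fun _ _ _ => by positivity
    _ = (K * c) * ∑ a ∈ Finset.range c, ‖traceWeight w c a‖ ^ 2 := by rw [hper]; ring
    _ ≤ (2 * N) * (8 * c * (c.divisors.card : ℝ) ^ 4) := by
        gcongr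
        exact sum_norm_traceWeight_sq_le hw hc
    _ = _ := by ring

/-- The mean square of the contribution of the small moduli. -/
theorem sum_norm_sq_kloostermanPart_small_le {w : ℕ → ℂ} (hw : ∀ x, ‖w x‖ ≤ 1) {ν q : ℕ}
    (hq : 0 < q) {M T D : ℝ} (hM : 0 < M) (S : Finset ℕ)
    (hS : ∀ m ∈ S, M / 2 ≤ m ∧ (m : ℝ) ≤ 3 * M) (s : Finset ℕ) (hs : ∀ n ∈ s, 0 < n)
    (hD : ∀ n ∈ s, ((q * n : ℕ) : ℝ) ≤ D) (hDM : D ≤ 3 * M) (hDν : ν * D ≤ 2 * M)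
    (hT : ∀ n ∈ s, ((q * n).divisors.card : ℝ) ≤ T) :
    ∑ m ∈ S, ‖kloostermanPart w ν q m s‖ ^ 2
      ≤ (∑ n ∈ s, 1 / ((q * n : ℕ) : ℝ)) * (s.card * (60000 * D * T ^ 4)) := by
  -- With m ≥ M/2 and νc ≤ 2M the argument 4πm/c is at least πν, beyond 2ν. The constant: 6400/(2π)
  -- ≤ 1200.
  have hB : ∀ m ∈ S, ∀ n ∈ s, ‖besselInt ν (4 * Real.pi * m / (q * n : ℕ))‖ ^ 2
      ≤ 1200 * (q * n : ℕ) / M := by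
    intro m hm n hn
    have hc : (0 : ℝ) < (q * n : ℕ) := by exact_mod_cast Nat.mul_pos hq (hs n hn)
    have hm0 : (0 : ℝ) < m := by linarith [(hS m hm).1]
    have hpi := Real.pi_gt_three
    set x : ℝ := 4 * Real.pi * m / (q * n : ℕ) with hx
    have hx0 : 0 < x := by positivity
    have hxν : 2 * (ν : ℝ) ≤ x := by
      rw [hx, le_div_iff₀ hc]
      have h1 : (ν : ℝ) * (q * n : ℕ) ≤ ν * D := by gcongr; exact hD n hn
      have h2 := (hS m hm).1
      nlinarith
    have hle := norm_besselInt_le hx0 hxν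
    calc ‖besselInt ν x‖ ^ 2 ≤ (80 / √x) ^ 2 := by gcongr
      _ = 6400 / x := by rw [div_pow, Real.sq_sqrt hx0.le]; norm_num
      _ = 6400 * (q * n : ℕ) / (4 * Real.pi * m) := by rw [hx]; field_simp
      _ ≤ _ := by
          rw [div_le_div_iff₀ (by positivity) hM]
          have h2 := (hS m hm).1
          have h3 : 6400 * M ≤ 1200 * (4 * Real.pi * m) := by nlinarith
          nlinarith
  -- Cauchy–Schwarz with weights 1/c. The c in the Bessel bound cancels the remaining 1/c, which
  -- leaves plain mean squares of Kloosterman sums.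
  have hcs : ∀ m ∈ S, ‖kloostermanPart w ν q m s‖ ^ 2
      ≤ (∑ n ∈ s, 1 / ((q * n : ℕ) : ℝ)) * ∑ n ∈ s, 1200 / M * ‖kloosterman w (q * n) m‖ ^ 2 := by
    intro m hm
    have h1 : ‖kloostermanPart w ν q m s‖ ≤ ∑ n ∈ s, 1 / ((q * n : ℕ) : ℝ) *
        (‖kloosterman w (q * n) m‖ * ‖besselInt ν (4 * Real.pi * m / (q * n : ℕ))‖) := by
      refine (norm_sum_le _ _).trans (le_of_eq (Finset.sum_congr rfl fun n _ => ?_))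
      rw [norm_mul, norm_mul, norm_div, norm_one, Complex.norm_natCast, mul_assoc]
    refine (pow_le_pow_left₀ (norm_nonneg _) h1 2).trans ?_
    refine (Finset.sum_sq_le_sum_mul_sum_of_sq_le_mul s
      (f := fun n => 1 / ((q * n : ℕ) : ℝ))
      (g := fun n => 1 / ((q * n : ℕ) : ℝ) *
        (‖kloosterman w (q * n) m‖ * ‖besselInt ν (4 * Real.pi * m / (q * n : ℕ))‖) ^ 2)
      (fun n _ => by positivity) (fun n _ => by positivity) (fun n _ => le_of_eq (by ring))).trans ?_
    refine mul_le_mul_of_nonneg_left ?_ (Finset.sum_nonneg fun n _ => by positivity)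
    refine Finset.sum_le_sum fun n hn => ?_
    have hc : (0 : ℝ) < (q * n : ℕ) := by exact_mod_cast Nat.mul_pos hq (hs n hn)
    rw [mul_pow]
    calc 1 / ((q * n : ℕ) : ℝ) * (‖kloosterman w (q * n) m‖ ^ 2 *
          ‖besselInt ν (4 * Real.pi * m / (q * n : ℕ))‖ ^ 2)
        ≤ 1 / ((q * n : ℕ) : ℝ) * (‖kloosterman w (q * n) m‖ ^ 2 * (1200 * (q * n : ℕ) / M)) := by
          gcongr
          exact hB m hm n hn
      _ = _ := by field_simp
  calc ∑ m ∈ S, ‖kloostermanPart w ν q m s‖ ^ 2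
      ≤ ∑ m ∈ S, (∑ n ∈ s, 1 / ((q * n : ℕ) : ℝ)) *
          ∑ n ∈ s, 1200 / M * ‖kloosterman w (q * n) m‖ ^ 2 := Finset.sum_le_sum hcs
    _ = (∑ n ∈ s, 1 / ((q * n : ℕ) : ℝ)) *
          ∑ n ∈ s, 1200 / M * ∑ m ∈ S, ‖kloosterman w (q * n) m‖ ^ 2 := by
        rw [← Finset.mul_sum, Finset.sum_comm]
        simp only [Finset.mul_sum]
    _ ≤ (∑ n ∈ s, 1 / ((q * n : ℕ) : ℝ)) * ∑ n ∈ s, 60000 * D * T ^ 4 := by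
        refine mul_le_mul_of_nonneg_left ?_ (Finset.sum_nonneg fun n _ => by positivity)
        refine Finset.sum_le_sum fun n hn => ?_
        have hc : 0 < q * n := Nat.mul_pos hq (hs n hn)
        have hc' : (0 : ℝ) < (q * n : ℕ) := by exact_mod_cast hc
        have hT0 : (0 : ℝ) ≤ ((q * n).divisors.card : ℝ) := Nat.cast_nonneg _
        have hDn := hD n hn
        calc 1200 / M * ∑ m ∈ S, ‖kloosterman w (q * n) m‖ ^ 2
            ≤ 1200 / M * (16 * (3 * M) * ((q * n : ℕ) * ((q * n).divisors.card : ℝ) ^ 4)) := by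
              gcongr
              exact sum_norm_sq_kloosterman_le hw hc (hDn.trans hDM) S fun m hm => (hS m hm).2
          _ = 57600 * ((q * n : ℕ) * ((q * n).divisors.card : ℝ) ^ 4) := by field_simp; ring
          _ ≤ 57600 * (D * T ^ 4) := by
              have hD0 : 0 ≤ D := hc'.le.trans hDn
              have := hT n hn
              gcongr
          _ ≤ _ := by
              have : 0 ≤ D * T ^ 4 := mul_nonneg (hc'.le.trans hDn) (by positivity)
              linarith
    _ = _ := by rw [Finset.sum_const, nsmul_eq_mul]

end PoincareMoment

end


open scoped MatrixGroups ContDiff UpperHalfPlane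

noncomputable section

namespace PoincareMoment

open MeasureTheory Set

/-! ### Series expansions of the Bessel integral -/

/-- Cauchy's formula on the unit circle for the n-th derivative of z ↦ e^{αz} at 0. -/
lemma integral_exp_neg_mul_exp_exp (α : ℂ) (n : ℕ) :
    ∫ φ in (0 : ℝ)..(2 * Real.pi), Complex.exp (-(n * φ * Complex.I)) *
      Complex.exp (α * Complex.exp (φ * Complex.I)) = 2 * Real.pi * (α ^ n / n.factorial) := by
  have h := DifferentiableOn.circleIntegral_one_div_sub_center_pow_smul (c := 0) (R := 1)
    (f := fun z => Complex.exp (α * z)) one_pos n (by fun_prop)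
  rw [iteratedDeriv_cexp_const_mul, circleIntegral] at h
  simp only [deriv_circleMap, circleMap, sub_zero, zero_add, Complex.ofReal_one, one_mul, mul_zero,
    Complex.exp_zero, mul_one, smul_eq_mul] at h
  have e : ∫ φ in (0 : ℝ)..(2 * Real.pi), Complex.exp (φ * Complex.I) * Complex.I *
        (1 / Complex.exp (φ * Complex.I) ^ (n + 1) * Complex.exp (α * Complex.exp (φ * Complex.I)))
      = Complex.I * ∫ φ in (0 : ℝ)..(2 * Real.pi), Complex.exp (-(n * φ * Complex.I)) *
      Complex.exp (α * Complex.exp (φ * Complex.I)) := by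
    rw [← intervalIntegral.integral_const_mul]
    refine intervalIntegral.integral_congr fun φ _ => ?_
    have h1 : Complex.exp (-(n * φ * Complex.I)) = (Complex.exp (φ * Complex.I) ^ n)⁻¹ := by
      rw [← Complex.exp_nat_mul, ← Complex.exp_neg]
      congr 1
      ring
    have h2 := Complex.exp_ne_zero ((φ : ℂ) * Complex.I)
    simp only [h1]
    field_simp
    ring
  rw [e] at h
  apply mul_left_cancel₀ Complex.I_ne_zero
  rw [h]
  ring

/-- The power series of the Bessel integral. -/
theorem hasSum_besselInt (ν : ℕ) (x : ℝ) :
    HasSum (fun j : ℕ => (Real.pi : ℂ) * ((Complex.I * x / 2) ^ (ν + 2 * j) /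
      (j.factorial * (ν + j).factorial))) (besselInt ν x) := by
  set α : ℂ := Complex.I * x / 2 with hα
  -- The reflection φ ↦ 2π − φ folds the circle onto [0, π] and turns e^{−iνφ} into 2 cos νφ.
  have hdouble : ∫ φ in (0 : ℝ)..(2 * Real.pi), Complex.exp (-(ν * φ * Complex.I)) *
      Complex.exp (Complex.I * (x * Real.cos φ : ℝ)) = 2 * besselInt ν x := by
    set g : ℝ → ℂ := fun φ => Complex.exp (-(ν * φ * Complex.I)) *
      Complex.exp (Complex.I * (x * Real.cos φ : ℝ)) with hg
    have hgc : Continuous g := by fun_prop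
    have hgc' : Continuous fun φ => g (2 * Real.pi - φ) := by fun_prop
    have h1 := intervalIntegral.integral_comp_sub_left (a := 0) (b := Real.pi) g (2 * Real.pi)
    rw [sub_zero, show 2 * Real.pi - Real.pi = Real.pi by ring] at h1
    rw [← intervalIntegral.integral_add_adjacent_intervals (b := Real.pi)
      (hgc.intervalIntegrable _ _) (hgc.intervalIntegrable _ _), ← h1,
      ← intervalIntegral.integral_add (hgc.intervalIntegrable _ _)
        (hgc'.intervalIntegrable _ _),
      besselInt, ← intervalIntegral.integral_const_mul]
    refine intervalIntegral.integral_congr fun φ _ => ?_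
    simp only [hg, Real.cos_two_pi_sub]
    have e1 : Complex.exp (-(ν * ((2 * Real.pi - φ : ℝ) : ℂ) * Complex.I))
        = Complex.exp (ν * φ * Complex.I) := by
      rw [Complex.exp_eq_exp_iff_exists_int]
      exact ⟨-ν, by push_cast; ring⟩
    rw [e1]
    have e2 : 2 * ((Real.cos (ν * φ) : ℝ) : ℂ)
        = Complex.exp (ν * φ * Complex.I) + Complex.exp (-(ν * φ * Complex.I)) := by
      rw [Complex.ofReal_cos, Complex.cos]
      push_cast
      rw [neg_mul]
      ring
    rw [← mul_assoc, e2]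
    ring
  -- With α = ix/2 the exponential factors as e^{αe^{iφ}}·e^{αe^{−iφ}}. Only the second factor is
  -- expanded, so each term is a single Cauchy integral.
  have hF : ∀ φ : ℝ, HasSum (fun j : ℕ => (α ^ j / j.factorial) *
      (Complex.exp (-((ν + j : ℕ) * φ * Complex.I)) *
        Complex.exp (α * Complex.exp (φ * Complex.I))))
      (Complex.exp (-(ν * φ * Complex.I)) * Complex.exp (Complex.I * (x * Real.cos φ : ℝ))) := by
    intro φ
    have h1 : HasSum (fun j : ℕ => (α * Complex.exp (-(φ * Complex.I))) ^ j / j.factorial)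
        (Complex.exp (α * Complex.exp (-(φ * Complex.I)))) := by
      rw [Complex.exp_eq_exp_ℂ]
      exact NormedSpace.expSeries_div_hasSum_exp _
    have h2 := h1.mul_left (Complex.exp (-(ν * φ * Complex.I)) *
        Complex.exp (α * Complex.exp (φ * Complex.I)))
    convert! h2 using 1
    · funext j
      rw [mul_pow, ← Complex.exp_nat_mul]
      have : Complex.exp (-((ν + j : ℕ) * φ * Complex.I))
          = Complex.exp (-(ν * φ * Complex.I)) * Complex.exp (j * -(φ * Complex.I)) := by
        rw [← Complex.exp_add]
        congr 1
        push_cast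
        ring
      rw [this]
      ring
    · have e3 : Complex.I * (x * Real.cos φ : ℝ)
          = α * Complex.exp (φ * Complex.I) + α * Complex.exp (-(φ * Complex.I)) := by
        rw [hα]
        push_cast
        rw [Complex.cos, neg_mul]
        ring
      rw [e3, Complex.exp_add]
      ring
  have hint : ∀ j : ℕ, ∫ φ in (0 : ℝ)..(2 * Real.pi), (α ^ j / j.factorial) *
      (Complex.exp (-((ν + j : ℕ) * φ * Complex.I)) *
        Complex.exp (α * Complex.exp (φ * Complex.I)))
      = 2 * ((Real.pi : ℂ) * (α ^ (ν + 2 * j) / (j.factorial * (ν + j).factorial))) := by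
    intro j
    rw [intervalIntegral.integral_const_mul, integral_exp_neg_mul_exp_exp]
    have h1 : (j.factorial : ℂ) ≠ 0 := by exact_mod_cast j.factorial_ne_zero
    have h2 : ((ν + j).factorial : ℂ) ≠ 0 := by exact_mod_cast (ν + j).factorial_ne_zero
    field_simp
    ring
  have hsum := intervalIntegral.hasSum_integral_of_dominated_convergence (μ := volume)
    (a := 0) (b := 2 * Real.pi)
    (F := fun j φ => (α ^ j / j.factorial) *
      (Complex.exp (-((ν + j : ℕ) * φ * Complex.I)) *
        Complex.exp (α * Complex.exp (φ * Complex.I))))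
    (f := fun φ => Complex.exp (-(ν * φ * Complex.I)) *
      Complex.exp (Complex.I * (x * Real.cos φ : ℝ)))
    (fun j _ => ‖α‖ ^ j / j.factorial * Real.exp ‖α‖)
    (fun j => (by fun_prop : Continuous _).aestronglyMeasurable)
    (fun j => Filter.Eventually.of_forall fun φ _ => by
      rw [norm_mul, norm_mul, norm_div, norm_pow, Complex.norm_natCast]
      have h1 : ‖Complex.exp (-((ν + j : ℕ) * φ * Complex.I))‖ = 1 := by
        rw [show -(((ν + j : ℕ) : ℂ) * φ * Complex.I) = ((-((ν + j : ℕ) * φ) : ℝ) : ℂ) * Complex.I by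
          push_cast; ring]
        exact Complex.norm_exp_ofReal_mul_I _
      have h2 : ‖Complex.exp (α * Complex.exp (φ * Complex.I))‖ ≤ Real.exp ‖α‖ := by
        refine (Complex.norm_exp_le_exp_norm _).trans ?_
        rw [norm_mul, Complex.norm_exp_ofReal_mul_I, mul_one]
      rw [h1, one_mul]
      gcongr)
    (Filter.Eventually.of_forall fun φ _ =>
      (Real.summable_pow_div_factorial ‖α‖).mul_right _)
    intervalIntegrable_const
    (Filter.Eventually.of_forall fun φ _ => hF φ)
  simp only [hint, hdouble] at hsum
  have := hsum.mul_left (1 / 2 : ℂ)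
  convert! this using 1
  · funext j
    ring
  · ring

/-- The inequality (ν + j)! ≥ ν!·(ν + 1)^j compares the power series term by term with an
exponential series. -/
lemma norm_besselInt_le_pow (ν : ℕ) {x : ℝ} (hx : 0 ≤ x) :
    ‖besselInt ν x‖ ≤ Real.pi * ((x / 2) ^ ν / ν.factorial * Real.exp ((x / 2) ^ 2 / (ν + 1))) := by
  have hα : ‖Complex.I * x / 2‖ = x / 2 := by
    rw [norm_div, norm_mul, Complex.norm_I, one_mul, Complex.norm_real, Real.norm_of_nonneg hx,
      Complex.norm_ofNat]
  have hexp : HasSum (fun j : ℕ => ((x / 2) ^ 2 / (ν + 1)) ^ j / j.factorial)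
      (Real.exp ((x / 2) ^ 2 / (ν + 1))) := by
    rw [Real.exp_eq_exp_ℝ]
    exact NormedSpace.expSeries_div_hasSum_exp _
  have h2 := hexp.mul_left (Real.pi * ((x / 2) ^ ν / ν.factorial))
  rw [← mul_assoc]
  refine (hasSum_besselInt ν x).norm_le_of_bounded h2 fun j => ?_
  rw [norm_mul, norm_div, norm_pow, hα, norm_mul, Complex.norm_natCast, Complex.norm_natCast,
    Complex.norm_real, Real.norm_of_nonneg Real.pi_pos.le, mul_assoc]
  gcongr
  have hfac : (ν.factorial : ℝ) * (ν + 1) ^ j ≤ (ν + j).factorial := by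
    exact_mod_cast Nat.factorial_mul_pow_le_factorial
  have e : (x / 2) ^ ν / ν.factorial * (((x / 2) ^ 2 / (ν + 1)) ^ j / j.factorial)
      = (x / 2) ^ (ν + 2 * j) / (j.factorial * (ν.factorial * (ν + 1) ^ j)) := by
    rw [div_pow ((x / 2) ^ 2), ← pow_mul, div_div, div_mul_div_comm, ← pow_add]
    congr 1
    ring
  rw [e]
  gcongr

/-- The Bessel integral is tiny below the transition range. -/
theorem norm_besselInt_le_exp {ν : ℕ} (hν : 2 ≤ ν) {x : ℝ} (hx : 0 ≤ x)
    (h : x ≤ (ν + 1) / 5) : ‖besselInt ν x‖ ≤ 1000 * x ^ 2 * Real.exp (-(ν + 1)) := by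
  set k : ℝ := ν + 1 with hk
  have hk0 : 0 < k := by positivity
  refine (norm_besselInt_le_pow ν hx).trans ?_
  rw [← hk]
  have hx2 : x / 2 ≤ k / 10 := by linarith
  have h1 : Real.exp ((x / 2) ^ 2 / k) ≤ Real.exp (k / 100) := by
    apply Real.exp_le_exp.2
    rw [div_le_iff₀ hk0]
    nlinarith
  obtain ⟨μ, rfl⟩ := Nat.exists_eq_add_of_le hν
  -- Two factors x/2 are kept: with x = 4πm/(qn) they supply the n⁻² that makes the tail over the
  -- moduli summable.
  have h2 : (x / 2) ^ (2 + μ) ≤ (x / 2) ^ 2 * (k / 10) ^ μ := by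
    rw [pow_add]
    gcongr
  have h3 : k ^ (2 + μ) / (2 + μ).factorial ≤ Real.exp k := Real.pow_div_factorial_le_exp _ hk0.le _
  have hk3 : 3 ≤ k := by rw [hk]; push_cast; linarith [(Nat.cast_nonneg μ : (0 : ℝ) ≤ μ)]
  have h4 : (k / 10) ^ μ / (2 + μ).factorial ≤ 1000 / 9 * (Real.exp k / 10 ^ (μ + 3)) := by
    have : (k / 10) ^ μ / (2 + μ).factorial = (1000 / k ^ 2) *
        ((k ^ (2 + μ) / (2 + μ).factorial) / 10 ^ (μ + 3)) := by
      rw [div_pow, pow_add, pow_add]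
      field_simp
      norm_num
    rw [this]
    gcongr
    nlinarith
  have h5 : Real.exp k / 10 ^ (μ + 3) * Real.exp (k / 100) ≤ Real.exp (-k) := by
    -- Here x/2 ≤ k/10 pays off: 10^{−k} outweighs e^{k}·e^{k/100} with e^{−k} to spare, because
    -- e^{2.01} < 10.
    have e10 : Real.exp (2.01 * k) ≤ 10 ^ (μ + 3) := by
      have hkμ : k = ((μ + 3 : ℕ) : ℝ) := by rw [hk]; push_cast; ring
      rw [hkμ, mul_comm, Real.exp_nat_mul]
      gcongr
      have h6 : Real.exp 2.01 = Real.exp 1 ^ 2 * Real.exp 0.01 := by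
        rw [← Real.exp_nat_mul, ← Real.exp_add]; norm_num
      have h7 : Real.exp 0.01 ≤ 1.02 := by
        have := Real.exp_bound_div_one_sub_of_interval (x := 0.01) (by norm_num) (by norm_num)
        refine this.trans ?_
        norm_num
      rw [h6]
      have h8 := Real.exp_one_lt_d9
      have h9 := Real.exp_pos 1
      nlinarith
    rw [div_mul_eq_mul_div, div_le_iff₀ (by positivity), ← Real.exp_add]
    calc Real.exp (k + k / 100) = Real.exp (-k) * Real.exp (2.01 * k) := by
          rw [← Real.exp_add]; congr 1; ring
      _ ≤ _ := by gcongr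
  have hpi := Real.pi_lt_four
  calc Real.pi * ((x / 2) ^ (2 + μ) / (2 + μ).factorial * Real.exp ((x / 2) ^ 2 / k))
      ≤ 4 * ((x / 2) ^ 2 * (k / 10) ^ μ / (2 + μ).factorial * Real.exp (k / 100)) := by
        gcongr
    _ = 4 * ((x / 2) ^ 2 * ((k / 10) ^ μ / (2 + μ).factorial) * Real.exp (k / 100)) := by ring
    _ ≤ 4 * ((x / 2) ^ 2 * (1000 / 9 * (Real.exp k / 10 ^ (μ + 3))) * Real.exp (k / 100)) := by
        gcongr
    _ = (1000 / 9) * x ^ 2 * (Real.exp k / 10 ^ (μ + 3) * Real.exp (k / 100)) := by ring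
    _ ≤ 1000 * x ^ 2 * Real.exp (-k) := by
        gcongr
        norm_num

end PoincareMoment

end


open scoped MatrixGroups ContDiff UpperHalfPlane

noncomputable section

namespace PoincareMoment

open MeasureTheory Set

/-! ### Integrals over horizontal lines -/

lemma normSq_add_mul_I' (x y : ℝ) : ‖(x + y * Complex.I : ℂ)‖ ^ 2 = x ^ 2 + y ^ 2 := by
  rw [← Complex.normSq_eq_norm_sq, Complex.normSq_add_mul_I]

lemma le_norm_add_mul_I (x y : ℝ) : y ≤ ‖(x + y * Complex.I : ℂ)‖ := by
  refine le_of_sq_le_sq ?_ (norm_nonneg _)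
  rw [normSq_add_mul_I']
  nlinarith [sq_nonneg x]

lemma add_mul_I_ne_zero (x : ℝ) {y : ℝ} (hy : 0 < y) : (x + y * Complex.I : ℂ) ≠ 0 :=
  norm_pos_iff.1 (hy.trans_le (le_norm_add_mul_I x y))

lemma inv_sq_add_sq_eq {y : ℝ} (hy : 0 < y) (x : ℝ) :
    (x ^ 2 + y ^ 2)⁻¹ = (y ^ 2)⁻¹ * (1 + (x / y) ^ 2)⁻¹ := by
  rw [← mul_inv]
  congr 1
  field_simp
  ring

lemma integrable_inv_sq_add_sq {y : ℝ} (hy : 0 < y) :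
    Integrable fun x : ℝ => (x ^ 2 + y ^ 2)⁻¹ := by
  simp only [inv_sq_add_sq_eq hy]
  exact (integrable_inv_one_add_sq.comp_div hy.ne').const_mul _

lemma integral_inv_sq_add_sq {y : ℝ} (hy : 0 < y) :
    ∫ x : ℝ, (x ^ 2 + y ^ 2)⁻¹ = Real.pi / y := by
  simp only [inv_sq_add_sq_eq hy]
  rw [integral_const_mul, Measure.integral_comp_div (fun x : ℝ => (1 + x ^ 2)⁻¹) y,
    integral_univ_inv_one_add_sq, abs_of_pos hy, smul_eq_mul]
  field_simp

lemma norm_inv_pow_le {y : ℝ} (hy : 0 < y) (x : ℝ) (n : ℕ) :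
    ‖((x + y * Complex.I : ℂ) ^ (2 + n))⁻¹‖ ≤ (y ^ n)⁻¹ * (x ^ 2 + y ^ 2)⁻¹ := by
  have h := le_norm_add_mul_I x y
  rw [norm_inv, norm_pow, pow_add, normSq_add_mul_I', mul_inv, mul_comm]
  gcongr

lemma norm_exp_neg_mul (m x y : ℝ) :
    ‖Complex.exp (-(2 * Real.pi * Complex.I * m * (x + y * Complex.I)))‖
      = Real.exp (2 * Real.pi * m * y) := by
  rw [Complex.norm_exp]
  congr 1
  simp

lemma integrable_inv_pow_mul_exp {y : ℝ} (hy : 0 < y) (m : ℝ) (n : ℕ) :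
    Integrable fun x : ℝ => ((x + y * Complex.I : ℂ) ^ (2 + n))⁻¹ *
      Complex.exp (-(2 * Real.pi * Complex.I * m * (x + y * Complex.I))) := by
  refine Integrable.mono' (((integrable_inv_sq_add_sq hy).const_mul ((y ^ n)⁻¹)).mul_const
    (Real.exp (2 * Real.pi * m * y))) ?_ (Filter.Eventually.of_forall fun x => ?_)
  · refine Continuous.aestronglyMeasurable (Continuous.mul (Continuous.inv₀ (by fun_prop) ?_)
      (by fun_prop))
    exact fun x => pow_ne_zero _ (add_mul_I_ne_zero x hy)
  · rw [norm_mul, norm_exp_neg_mul]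
    gcongr
    exact norm_inv_pow_le hy x n

lemma integral_mul_exp_neg_Ioi {r : ℂ} (hr : 0 < r.re) :
    IntegrableOn (fun t : ℝ => (t : ℂ) * Complex.exp (-(r * t))) (Ioi 0) ∧
    ∫ t : ℝ in Ioi 0, (t : ℂ) * Complex.exp (-(r * t)) = (r ^ 2)⁻¹ := by
  have hr0 : r ≠ 0 := fun h => by simp [h] at hr
  have hnorm : ∀ t : ℝ, ‖Complex.exp (-(r * t))‖ = Real.exp (-(r.re * t)) := fun t => by
    rw [Complex.norm_exp]; simp
  have hint : IntegrableOn (fun t : ℝ => (t : ℂ) * Complex.exp (-(r * t))) (Ioi 0) := by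
    have h := integrableOn_rpow_mul_exp_neg_mul_rpow (p := 1) (s := 1) (by norm_num) one_pos hr
    refine Integrable.mono' h (by fun_prop) ?_
    filter_upwards [ae_restrict_mem measurableSet_Ioi] with t ht
    rw [norm_mul, hnorm, Complex.norm_real, Real.norm_of_nonneg (le_of_lt ht), Real.rpow_one,
      neg_mul]
  refine ⟨hint, ?_⟩
  have htend : Filter.Tendsto (fun t : ℝ => -((t : ℂ) / r + (r ^ 2)⁻¹) * Complex.exp (-(r * t)))
      Filter.atTop (nhds 0) := by
    have h1 : Filter.Tendsto (fun t : ℝ => (t / ‖r‖ + (‖r‖ ^ 2)⁻¹) * Real.exp (-(r.re * t)))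
        Filter.atTop (nhds 0) := by
      have a1 := (tendsto_rpow_mul_exp_neg_mul_atTop_nhds_zero 1 r.re hr).const_mul (‖r‖⁻¹)
      have a2 := (tendsto_rpow_mul_exp_neg_mul_atTop_nhds_zero 0 r.re hr).const_mul
        ((‖r‖ ^ 2)⁻¹)
      have a3 := a1.add a2
      simp only [mul_zero, add_zero, Real.rpow_one, Real.rpow_zero, one_mul] at a3
      refine a3.congr fun t => ?_
      rw [neg_mul]
      ring
    refine squeeze_zero_norm' ?_ h1
    filter_upwards [Filter.eventually_ge_atTop 0] with t ht
    rw [norm_mul, hnorm, norm_neg]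
    gcongr
    refine (norm_add_le _ _).trans ?_
    rw [norm_div, norm_inv, norm_pow, Complex.norm_real, Real.norm_of_nonneg ht]
  have := integral_Ioi_of_hasDerivAt_of_tendsto' (a := 0)
    (f := fun t : ℝ => -((t : ℂ) / r + (r ^ 2)⁻¹) * Complex.exp (-(r * t)))
    (f' := fun t : ℝ => (t : ℂ) * Complex.exp (-(r * t))) (fun t _ => ?_) hint htend
  · rw [this]; simp
  · have d1 : HasDerivAt (fun t : ℝ => (t : ℂ)) 1 t := Complex.ofRealCLM.hasDerivAt
    have d2 : HasDerivAt (fun t : ℝ => Complex.exp (-(r * t))) (Complex.exp (-(r * t)) * -(r * 1)) t :=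
      ((d1.const_mul r).neg).cexp
    have d3 := (((d1.div_const r).add_const ((r ^ 2)⁻¹)).neg).mul d2
    convert! d3 using 1
    simp only [Pi.neg_apply]
    field_simp
    ring

/-- Fourier inversion for the function t·e^{−2πyt} on t > 0, extended by zero, whose transform is a
multiple of (w − iy)⁻². The exponent 2 is the first for which both the function is continuous and
its transform integrable, hence the base of the induction below. -/
lemma integral_inv_sq_mul_exp {y : ℝ} (hy : 0 < y) {m : ℝ} (hm : 0 ≤ m) :
    ∫ x : ℝ, ((x + y * Complex.I : ℂ) ^ 2)⁻¹ *
      Complex.exp (-(2 * Real.pi * Complex.I * m * (x + y * Complex.I)))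
      = -(4 * Real.pi ^ 2 * m) := by
  have hpi := Real.pi_pos
  set f : ℝ → ℂ := fun t => (max t 0 : ℝ) * Complex.exp (-(2 * Real.pi * y * t)) with hf
  have hfc : Continuous f := by fun_prop
  have hfind : f = (Ioi (0 : ℝ)).indicator fun t : ℝ =>
      (t : ℂ) * Complex.exp (-(((2 * Real.pi * y : ℝ) : ℂ) * t)) := by
    funext t
    simp only [hf, indicator, mem_Ioi]
    split_ifs with h
    · rw [max_eq_left h.le]; push_cast; rfl
    · rw [max_eq_right (not_lt.1 h)]; simp
  have hfi : Integrable f := by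
    rw [hfind, integrable_indicator_iff measurableSet_Ioi]
    exact (integral_mul_exp_neg_Ioi (by rw [Complex.ofReal_re]; positivity)).1
  have hF : ∀ w : ℝ, FourierTransform.fourier f w
      = -(1 / (4 * Real.pi ^ 2)) * ((w + (-y : ℝ) * Complex.I : ℂ) ^ 2)⁻¹ := by
    intro w
    have hr : 0 < ((2 * Real.pi * (y + w * Complex.I) : ℂ)).re := by
      have : ((2 * Real.pi * (y + w * Complex.I) : ℂ)).re = 2 * Real.pi * y := by simp
      rw [this]; positivity
    rw [Real.fourier_real_eq_integral_exp_smul, hfind]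
    have e : (fun v : ℝ => Complex.exp (((-2 * Real.pi * v * w : ℝ) : ℂ) * Complex.I) •
        (Ioi (0 : ℝ)).indicator (fun t : ℝ =>
          (t : ℂ) * Complex.exp (-(((2 * Real.pi * y : ℝ) : ℂ) * t))) v)
        = (Ioi (0 : ℝ)).indicator fun t : ℝ =>
          (t : ℂ) * Complex.exp (-((2 * Real.pi * (y + w * Complex.I)) * t)) := by
      funext t
      simp only [indicator]
      split_ifs
      · rw [smul_eq_mul, mul_left_comm, ← Complex.exp_add]
        congr 2
        push_cast
        ring
      · simp
    rw [e, integral_indicator measurableSet_Ioi, (integral_mul_exp_neg_Ioi hr).2]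
    have e2 : (2 * Real.pi * (y + w * Complex.I) : ℂ) ^ 2
        = -(4 * Real.pi ^ 2 * (w + (-y : ℝ) * Complex.I) ^ 2) := by
      push_cast
      linear_combination (4 * (Real.pi : ℂ) ^ 2) * (w ^ 2 + y ^ 2) * Complex.I_sq
    rw [e2, inv_neg, mul_inv]
    ring
  have hFi : Integrable (FourierTransform.fourier f) := by
    rw [show FourierTransform.fourier f = fun w : ℝ =>
      -(1 / (4 * (Real.pi : ℂ) ^ 2)) * ((w + (-y : ℝ) * Complex.I : ℂ) ^ 2)⁻¹ from funext hF]
    refine Integrable.const_mul ?_ _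
    have h1 := (integrable_inv_pow_mul_exp hy 0 0).comp_neg
    refine h1.congr (Filter.Eventually.of_forall fun x => ?_)
    simp only [Complex.ofReal_zero, mul_zero, zero_mul, neg_zero, Complex.exp_zero, mul_one]
    congr 1
    push_cast
    ring
  have hinv := congrFun (hfc.fourierInv_fourier_eq hfi hFi) m
  rw [Real.fourierInv_eq'] at hinv
  have e : ∫ v : ℝ, Complex.exp (((2 * Real.pi * inner ℝ v m : ℝ) : ℂ) * Complex.I) •
      FourierTransform.fourier f v = -(1 / (4 * Real.pi ^ 2)) * ∫ x : ℝ,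
        ((x + y * Complex.I : ℂ) ^ 2)⁻¹ * Complex.exp (-(2 * Real.pi * Complex.I * m * x)) := by
    rw [← integral_const_mul, ← integral_neg_eq_self]
    refine integral_congr_ae (Filter.Eventually.of_forall fun x => ?_)
    simp only [hF, smul_eq_mul, RCLike.inner_apply, conj_trivial]
    have e1 : (((-x : ℝ) : ℂ) + (-y : ℝ) * Complex.I) ^ 2 = (x + y * Complex.I) ^ 2 := by
      push_cast
      ring
    rw [e1, mul_comm, mul_assoc]
    congr 3
    push_cast
    ring
  rw [e] at hinv
  have e3 : ∫ x : ℝ, ((x + y * Complex.I : ℂ) ^ 2)⁻¹ *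
      Complex.exp (-(2 * Real.pi * Complex.I * m * (x + y * Complex.I)))
      = Complex.exp (2 * Real.pi * y * m) * ∫ x : ℝ, ((x + y * Complex.I : ℂ) ^ 2)⁻¹ *
        Complex.exp (-(2 * Real.pi * Complex.I * m * x)) := by
    rw [← integral_const_mul]
    refine integral_congr_ae (Filter.Eventually.of_forall fun x => ?_)
    simp only
    rw [mul_left_comm, ← Complex.exp_add]
    congr 2
    linear_combination (-2 * Real.pi * m * y : ℂ) * Complex.I_sq
  have hpi0 : (Real.pi : ℂ) ≠ 0 := by exact_mod_cast hpi.ne'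
  have e4 : ∫ x : ℝ, ((x + y * Complex.I : ℂ) ^ 2)⁻¹ *
        Complex.exp (-(2 * Real.pi * Complex.I * m * x)) = -(4 * Real.pi ^ 2) * f m := by
    rw [← hinv, ← mul_assoc]
    have : -(4 * (Real.pi : ℂ) ^ 2) * -(1 / (4 * Real.pi ^ 2)) = 1 := by field_simp
    rw [this, one_mul]
  rw [e3, e4, hf]
  simp only [max_eq_left hm]
  rw [Complex.exp_neg]
  have := Complex.exp_ne_zero (2 * Real.pi * y * m)
  field_simp

/-- The Fourier coefficients of negative powers on a horizontal line. -/
theorem integral_inv_pow_mul_exp {y : ℝ} (hy : 0 < y) {m : ℝ} (hm : 0 ≤ m) (n : ℕ) :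
    ∫ x : ℝ, ((x + y * Complex.I : ℂ) ^ (2 + n))⁻¹ *
      Complex.exp (-(2 * Real.pi * Complex.I * m * (x + y * Complex.I)))
      = -(2 * Real.pi * Complex.I) * (-(2 * Real.pi * Complex.I * m)) ^ (n + 1) /
        (n + 1).factorial := by
  induction n with
  | zero =>
    rw [add_zero, integral_inv_sq_mul_exp hy hm]
    simp only [zero_add, pow_one, Nat.factorial_one, Nat.cast_one, div_one]
    linear_combination (-4 * Real.pi ^ 2 * m : ℂ) * Complex.I_sq
  | succ n ih =>
    have hi := integrable_inv_pow_mul_exp hy m n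
    have hi' := integrable_inv_pow_mul_exp hy m (n + 1)
    -- The integral of this derivative over the line vanishes, which is the recursion (n +
    -- 2)·I_{n+1} = −2πim·I_n.
    have hd : ∀ x : ℝ, HasDerivAt (fun x : ℝ => ((x + y * Complex.I : ℂ) ^ (2 + n))⁻¹ *
        Complex.exp (-(2 * Real.pi * Complex.I * m * (x + y * Complex.I))))
        (-(2 + n : ℂ) * (((x + y * Complex.I : ℂ) ^ (2 + (n + 1)))⁻¹ *
          Complex.exp (-(2 * Real.pi * Complex.I * m * (x + y * Complex.I)))) +
        -(2 * Real.pi * Complex.I * m) * (((x + y * Complex.I : ℂ) ^ (2 + n))⁻¹ *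
          Complex.exp (-(2 * Real.pi * Complex.I * m * (x + y * Complex.I))))) x := by
      intro x
      have hz := add_mul_I_ne_zero x hy
      have d1 : HasDerivAt (fun t : ℝ => ((t : ℂ) + y * Complex.I)) 1 x :=
        Complex.ofRealCLM.hasDerivAt.add_const _
      have d2 := ((d1.pow (2 + n)).fun_inv (pow_ne_zero _ hz)).mul
        ((d1.const_mul (2 * Real.pi * Complex.I * m)).fun_neg.cexp)
      convert! d2 using 1
      simp only [Pi.pow_apply, show 2 + n - 1 = n + 1 by omega]
      push_cast
      field_simp
      ring
    have h0 := integral_eq_zero_of_hasDerivAt_of_integrable hd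
      ((hi'.const_mul _).add (hi.const_mul _)) hi
    rw [integral_add (hi'.const_mul _) (hi.const_mul _), integral_const_mul, integral_const_mul,
      ih] at h0
    have hn : (2 + n : ℂ) ≠ 0 := by
      have : ((2 + n : ℕ) : ℂ) ≠ 0 := by exact_mod_cast (by omega)
      simpa using this
    apply mul_left_cancel₀ hn
    rw [Nat.factorial_succ (n + 1)]
    have hf : ((n + 1).factorial : ℂ) ≠ 0 := by exact_mod_cast Nat.factorial_ne_zero _
    have hn' : ((n + 1 + 1 : ℕ) : ℂ) ≠ 0 := Nat.cast_ne_zero.2 (by omega)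
    have e : (2 + n : ℂ) * (-(2 * Real.pi * Complex.I) * (-(2 * Real.pi * Complex.I * m)) ^
        (n + 1 + 1) / (((n + 1 + 1) * (n + 1).factorial : ℕ) : ℂ))
        = -(2 * Real.pi * Complex.I) * (-(2 * Real.pi * Complex.I * m)) ^ (n + 1 + 1) /
          (n + 1).factorial := by
      push_cast at hn' ⊢
      field_simp
      ring
    rw [e]
    linear_combination -h0

/-- The archimedean integral of the Petersson formula is a Bessel integral. -/
theorem integral_inv_pow_mul_exp_mul_exp {y : ℝ} (hy : 0 < y) {m : ℝ} (hm : 0 ≤ m) {c : ℝ}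
    (hc : 0 < c) (n : ℕ) :
    ∫ x : ℝ, ((c * (x + y * Complex.I) : ℂ) ^ (2 + n))⁻¹ *
      Complex.exp (-(2 * Real.pi * Complex.I * m / (c ^ 2 * (x + y * Complex.I)))) *
      Complex.exp (-(2 * Real.pi * Complex.I * m * (x + y * Complex.I)))
      = -(2 * Complex.I) * (-1) ^ (n + 1) * (1 / c * besselInt (n + 1) (4 * Real.pi * m / c)) := by
  have hpi := Real.pi_pos
  have hc' : (c : ℂ) ≠ 0 := by exact_mod_cast hc.ne'
  set a : ℂ := -(2 * Real.pi * Complex.I * m / c ^ 2) with ha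
  -- The first exponential, exp(a/z), is expanded in powers of 1/z and integrated term by term. The
  -- result matches the power series of the Bessel integral of index n + 1.
  set F : ℕ → ℝ → ℂ := fun j x => (((c : ℂ) ^ (2 + n))⁻¹ * (a ^ j / j.factorial)) *
    (((x + y * Complex.I : ℂ) ^ (2 + (n + j)))⁻¹ *
      Complex.exp (-(2 * Real.pi * Complex.I * m * (x + y * Complex.I)))) with hF
  have hFi : ∀ j, Integrable (F j) := fun j =>
    (integrable_inv_pow_mul_exp hy m (n + j)).const_mul _
  have hbound : ∀ j, ∫ x, ‖F j x‖ ≤ ((‖a‖ / y) ^ j / j.factorial) *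
      ((c ^ (2 + n))⁻¹ * ((y ^ n)⁻¹ * (Real.pi / y) * Real.exp (2 * Real.pi * m * y))) := by
    intro j
    calc ∫ x, ‖F j x‖ ≤ ∫ x : ℝ, ((c ^ (2 + n))⁻¹ * (‖a‖ ^ j / j.factorial)) *
          ((y ^ (n + j))⁻¹ * (x ^ 2 + y ^ 2)⁻¹ * Real.exp (2 * Real.pi * m * y)) := by
          refine integral_mono_of_nonneg (Filter.Eventually.of_forall fun x => norm_nonneg _)
            ((((integrable_inv_sq_add_sq hy).const_mul _).mul_const _).const_mul _)
            (Filter.Eventually.of_forall fun x => ?_)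
          simp only [hF]
          have h := norm_inv_pow_le hy x (n + j)
          rw [norm_mul, norm_mul, norm_mul, norm_exp_neg_mul, norm_inv ((c : ℂ) ^ (2 + n)), norm_div,
            norm_pow, norm_pow, Complex.norm_real, Real.norm_of_nonneg hc.le, Complex.norm_natCast]
          gcongr
      _ = _ := by
          rw [integral_const_mul, integral_mul_const, integral_const_mul,
            integral_inv_sq_add_sq hy, pow_add y, div_pow]
          field_simp
  have hsummable : Summable fun j => ∫ x, ‖F j x‖ :=
    Summable.of_nonneg_of_le (fun j => integral_nonneg fun x => norm_nonneg _) hbound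
      ((Real.summable_pow_div_factorial (‖a‖ / y)).mul_right _)
  have hsum := hasSum_integral_of_summable_integral_norm hFi hsummable
  have htsum : ∀ x : ℝ, ∑' j, F j x = ((c * (x + y * Complex.I) : ℂ) ^ (2 + n))⁻¹ *
      Complex.exp (-(2 * Real.pi * Complex.I * m / (c ^ 2 * (x + y * Complex.I)))) *
      Complex.exp (-(2 * Real.pi * Complex.I * m * (x + y * Complex.I))) := by
    intro x
    have hz := add_mul_I_ne_zero x hy
    have h1 : HasSum (fun j : ℕ => (a / (x + y * Complex.I)) ^ j / j.factorial)
        (Complex.exp (a / (x + y * Complex.I))) := by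
      rw [Complex.exp_eq_exp_ℂ]
      exact NormedSpace.expSeries_div_hasSum_exp _
    have h2 := h1.mul_left (((c * (x + y * Complex.I) : ℂ) ^ (2 + n))⁻¹ *
      Complex.exp (-(2 * Real.pi * Complex.I * m * (x + y * Complex.I))))
    have e1 : a / (x + y * Complex.I)
        = -(2 * Real.pi * Complex.I * m / (c ^ 2 * (x + y * Complex.I))) := by
      rw [ha, neg_div, div_div]
    rw [e1] at h2
    have h3 : HasSum (fun j => F j x) (((c * (x + y * Complex.I) : ℂ) ^ (2 + n))⁻¹ *
      Complex.exp (-(2 * Real.pi * Complex.I * m * (x + y * Complex.I))) *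
      Complex.exp (-(2 * Real.pi * Complex.I * m / (c ^ 2 * (x + y * Complex.I))))) := by
      convert! h2 using 1
      funext j
      simp only [hF]
      rw [← e1, div_pow, mul_pow, ← add_assoc, pow_add _ (2 + n) j, mul_inv, mul_inv]
      ring
    rw [h3.tsum_eq]
    ring
  simp only [htsum] at hsum
  refine hsum.unique ?_
  have hB := (hasSum_besselInt (n + 1) (4 * Real.pi * m / c)).mul_left
    (-(2 * Complex.I) * (-1) ^ (n + 1) * (1 / c))
  rw [mul_assoc] at hB
  convert! hB using 1
  · funext j
    simp only [hF]
    rw [integral_const_mul, integral_inv_pow_mul_exp hy hm, ha]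
    have hf1 : (j.factorial : ℂ) ≠ 0 := by exact_mod_cast Nat.factorial_ne_zero _
    have hf2 : ((n + j + 1).factorial : ℂ) ≠ 0 := by exact_mod_cast Nat.factorial_ne_zero _
    rw [show n + 1 + j = n + j + 1 by ring,
      show (Complex.I * ((4 * Real.pi * m / c : ℝ) : ℂ) / 2)
        = (2 * Real.pi * Complex.I * m) / c by push_cast; field_simp; ring]
    rw [neg_pow (2 * Real.pi * Complex.I * m / c ^ 2 : ℂ), neg_pow (2 * Real.pi * Complex.I * m : ℂ),
      show n + 1 + 2 * j = n + j + 1 + j by ring, pow_add _ (n + j + 1) j, div_pow, div_pow, div_pow]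
    have hs : ((-1 : ℂ) ^ j) * (-1) ^ (n + j + 1) = (-1) ^ (n + 1) := by
      rw [show n + j + 1 = n + 1 + j by ring, pow_add _ (n + 1) j]
      have : ((-1 : ℂ) ^ j) * (-1) ^ j = 1 := by rw [← mul_pow]; norm_num
      linear_combination (-1 : ℂ) ^ (n + 1) * this
    rw [← hs]
    field_simp
    ring
  · ring

end PoincareMoment

end


open scoped MatrixGroups ContDiff UpperHalfPlane

noncomputable section

namespace PoincareMoment

open MeasureTheory Set
open scoped Pointwise

/-! ### The Ford domain and unfolding -/

instance instContinuousConstSMulSL : ContinuousConstSMul SL(2, ℤ) ℍ where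
  continuous_const_smul γ := continuous_const_smul (γ : GL (Fin 2) ℝ)

instance instMeasurableConstSMulSL : MeasurableConstSMul SL(2, ℤ) ℍ where
  measurable_const_smul γ := (continuous_const_smul γ).measurable

instance instSMulInvariantMeasureSL : SMulInvariantMeasure SL(2, ℤ) ℍ volume where
  measure_preimage_smul γ _ hs := measure_preimage_smul_of_nullMeasurableSet (G := GL (Fin 2) ℝ)
    hs.nullMeasurableSet (γ : GL (Fin 2) ℝ)

instance instCountableSL : Countable SL(2, ℤ) :=
  Function.Injective.countable
    (f := fun γ : SL(2, ℤ) => (fun i j => γ i j : Fin 2 → Fin 2 → ℤ)) Subtype.val_injective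

instance instCountableCosetsInf (q : ℕ) : Countable (CosetsInf q) :=
  inferInstanceAs (Countable (Quotient _))

lemma im_SL_smul (γ : SL(2, ℤ)) (z : ℍ) :
    (γ • z).im = z.im / Complex.normSq ((γ 1 0 : ℂ) * z + (γ 1 1 : ℂ)) := by
  rw [ModularGroup.im_smul_eq_div_normSq, ModularGroup.denom_apply]

lemma normSq_bottom_pos (γ : SL(2, ℤ)) (z : ℍ) :
    0 < Complex.normSq ((γ 1 0 : ℂ) * z + (γ 1 1 : ℂ)) := by
  rw [← ModularGroup.denom_apply]
  exact UpperHalfPlane.normSq_denom_pos _ z.im_ne_zero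

lemma T_zpow_mem_Gamma0 (q : ℕ) (n : ℤ) : ModularGroup.T ^ n ∈ CongruenceSubgroup.Gamma0 q := by
  rw [CongruenceSubgroup.Gamma0_mem, ModularGroup.coe_T_zpow]
  simp

/-- Every orbit of `Γ₀(q)` meets the Ford domain. -/
theorem exists_smul_mem_fordDomain (q : ℕ) (z : ℍ) :
    ∃ γ ∈ CongruenceSubgroup.Gamma0 q, γ • z ∈ fordDomain q := by
  -- Maximal height in the orbit means minimal |cz + d| over coprime rows with q ∣ c. The minimum is
  -- attained because |cz + d| tends to infinity along such rows.
  let s : Set (Fin 2 → ℤ) := {cd | IsCoprime (cd 0) (cd 1) ∧ ((cd 0 : ℤ) : ZMod q) = 0}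
  have hs : s.Nonempty := ⟨![0, 1], by simp [s, isCoprime_one_right]⟩
  obtain ⟨p, hp, hmin⟩ := Filter.Tendsto.exists_within_forall_le hs
    (ModularGroup.tendsto_normSq_coprime_pair z)
  obtain ⟨g, -, hg⟩ := ModularGroup.bottom_row_surj hp.1
  have hgmem : g ∈ CongruenceSubgroup.Gamma0 q := by
    rw [CongruenceSubgroup.Gamma0_mem]
    have := hp.2
    rwa [← hg] at this
  set n : ℤ := -round (g • z).re with hn
  have hTg : ModularGroup.T ^ n * g ∈ CongruenceSubgroup.Gamma0 q :=
    mul_mem (T_zpow_mem_Gamma0 q n) hgmem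
  refine ⟨ModularGroup.T ^ n * g, hTg, ?_, fun γ hγ => ?_⟩
  · rw [mul_smul, ModularGroup.re_T_zpow_smul, hn]
    push_cast
    exact abs_sub_round _
  · have h1 : γ * (ModularGroup.T ^ n * g) ∈ CongruenceSubgroup.Gamma0 q := mul_mem hγ hTg
    rw [← mul_smul, mul_smul (ModularGroup.T ^ n), ModularGroup.im_T_zpow_smul]
    generalize γ * (ModularGroup.T ^ n * g) = g' at h1
    rw [im_SL_smul, im_SL_smul]
    refine div_le_div_of_nonneg_left z.im_pos.le (normSq_bottom_pos g z) ?_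
    have := hmin (g' 1) ⟨ModularGroup.bottom_row_coprime g', CongruenceSubgroup.Gamma0_mem.1 h1⟩
    rw [← hg] at this
    simpa using this

lemma volume_eq_zero_of_image {s : Set ℍ} (h : volume (UpperHalfPlane.coe '' s) = 0) :
    volume s = 0 := by
  rw [UpperHalfPlane.volume_eq_lintegral, Measure.restrict_eq_zero.2 h, lintegral_zero_measure]

lemma volume_re_eq (t : ℝ) : volume {z : ℂ | z.re = t} = 0 := by
  have h := Complex.volume_preserving_equiv_real_prod.measure_preimage
    (s := ({t} : Set ℝ) ×ˢ (univ : Set ℝ))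
    (((measurableSet_singleton t).prod MeasurableSet.univ).nullMeasurableSet)
  have e : Complex.measurableEquivRealProd ⁻¹' (({t} : Set ℝ) ×ˢ (univ : Set ℝ))
      = {z : ℂ | z.re = t} := by
    ext z
    simp [Complex.measurableEquivRealProd]
  rw [e, Measure.volume_eq_prod, Measure.prod_prod] at h
  simpa using h

lemma eq_T_zpow_of_lower_left_eq_zero {g : SL(2, ℤ)} (hc : g 1 0 = 0) :
    ∃ n : ℤ, g = ModularGroup.T ^ n ∨ g = -ModularGroup.T ^ n := by
  have had := g.det_coe
  replace had : g 0 0 * g 1 1 = 1 := by rw [Matrix.det_fin_two, hc] at had; lia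
  rcases Int.eq_one_or_neg_one_of_mul_eq_one' had with (⟨ha, hd⟩ | ⟨ha, hd⟩)
  · refine ⟨g 0 1, Or.inl ?_⟩
    ext i j; fin_cases i <;> fin_cases j <;>
      simp [ha, hc, hd, ModularGroup.coe_T_zpow, show (1 : Fin (0 + 2)) = (1 : Fin 2) from rfl]
  · refine ⟨-(g 0 1), Or.inr ?_⟩
    ext i j; fin_cases i <;> fin_cases j <;>
      simp [ha, hc, hd, ModularGroup.coe_T_zpow, show (1 : Fin (0 + 2)) = (1 : Fin 2) from rfl]

/-- Two points of the Ford domain are equivalent only on a null set. -/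
theorem volume_fordDomain_inter_smul (q : ℕ) {δ : SL(2, ℤ)}
    (hδ : δ ∈ CongruenceSubgroup.Gamma0 q) (h1 : δ ≠ 1) (h2 : δ ≠ -1) :
    volume {z : ℍ | z ∈ fordDomain q ∧ δ • z ∈ fordDomain q} = 0 := by
  apply volume_eq_zero_of_image
  -- If c = 0 then δ is, up to sign, a nontrivial translation, and z lies on an edge Re z = ±1/2.
  -- Otherwise z and δz have equal height, so |cz + d| = 1 and z lies on a circle.
  by_cases hc : δ 1 0 = 0
  · obtain ⟨n, hn⟩ := eq_T_zpow_of_lower_left_eq_zero hc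
    have hn0 : n ≠ 0 := by
      rintro rfl
      rcases hn with hn | hn
      · exact h1 (by simpa using hn)
      · exact h2 (by simpa using hn)
    have hre : ∀ z : ℍ, (δ • z).re = z.re + n := by
      intro z
      rcases hn with rfl | rfl
      · exact ModularGroup.re_T_zpow_smul z n
      · rw [ModularGroup.SL_neg_smul]; exact ModularGroup.re_T_zpow_smul z n
    refine measure_mono_null (t := {z : ℂ | z.re = 1 / 2} ∪ {z : ℂ | z.re = -(1 / 2)}) ?_
      (measure_union_null (volume_re_eq _) (volume_re_eq _))
    rintro _ ⟨z, ⟨hz1, hz2⟩, rfl⟩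
    have a1 := abs_le.1 hz1.1
    have a2 := abs_le.1 hz2.1
    rw [hre] at a2
    have hzr : (z : ℂ).re = z.re := rfl
    simp only [mem_union, mem_ofPred_eq, hzr]
    rcases lt_or_gt_of_ne hn0 with hneg | hpos
    · left
      have : (n : ℝ) ≤ -1 := by exact_mod_cast (by omega : n ≤ -1)
      linarith
    · right
      have : (1 : ℝ) ≤ n := by exact_mod_cast (by omega : 1 ≤ n)
      linarith
  · have hcR : ((δ 1 0 : ℤ) : ℂ) ≠ 0 := by exact_mod_cast hc
    refine measure_mono_null (t := Metric.sphere (-(δ 1 1 : ℂ) / (δ 1 0 : ℂ))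
      (1 / ‖((δ 1 0 : ℤ) : ℂ)‖)) ?_ (Measure.addHaar_sphere _ _ _)
    rintro _ ⟨z, ⟨hz1, hz2⟩, rfl⟩
    have e1 := hz1.2 δ hδ
    have e2 := hz2.2 δ⁻¹ (inv_mem hδ)
    rw [inv_smul_smul] at e2
    have e3 := le_antisymm e1 e2
    rw [im_SL_smul, div_eq_iff (normSq_bottom_pos δ z).ne'] at e3
    have e4 : Complex.normSq ((δ 1 0 : ℂ) * z + (δ 1 1 : ℂ)) = 1 := by
      have := z.im_pos
      nlinarith
    rw [Complex.normSq_eq_norm_sq] at e4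
    have e5 : ‖((δ 1 0 : ℂ) * z + (δ 1 1 : ℂ))‖ = 1 := by
      nlinarith [norm_nonneg ((δ 1 0 : ℂ) * z + (δ 1 1 : ℂ))]
    rw [mem_sphere_iff_norm, ← e5, ← norm_div]
    congr 1
    field_simp
    ring

lemma isClosed_fordDomain (q : ℕ) : IsClosed (fordDomain q) := by
  have h : fordDomain q = {z : ℍ | |z.re| ≤ 1 / 2} ∩
      ⋂ γ ∈ CongruenceSubgroup.Gamma0 q, {z : ℍ | (γ • z).im ≤ z.im} := by
    ext z
    simp [fordDomain]
  rw [h]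
  refine IsClosed.inter ?_ (isClosed_biInter fun γ _ => ?_)
  · exact isClosed_le (UpperHalfPlane.continuous_re.abs) continuous_const
  · exact isClosed_le (UpperHalfPlane.continuous_im.comp (continuous_const_smul γ))
      UpperHalfPlane.continuous_im

lemma measurableSet_fordDomain (q : ℕ) : MeasurableSet (fordDomain q) :=
  (isClosed_fordDomain q).measurableSet

lemma aedisjoint_smul_fordDomain (q : ℕ) {g h : SL(2, ℤ)}
    (hg : g ∈ CongruenceSubgroup.Gamma0 q) (hh : h ∈ CongruenceSubgroup.Gamma0 q)
    (h1 : g ≠ h) (h2 : g ≠ -h) : AEDisjoint volume (g • fordDomain q) (h • fordDomain q) := by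
  have hnull := volume_fordDomain_inter_smul q (mul_mem (inv_mem hh) hg)
    (fun e => h1 (inv_mul_eq_one.1 e).symm) (fun e => h2 (by
      rw [inv_mul_eq_iff_eq_mul] at e
      simpa using e))
  have e : g • fordDomain q ∩ h • fordDomain q
      = g • {z : ℍ | z ∈ fordDomain q ∧ (h⁻¹ * g) • z ∈ fordDomain q} := by
    ext z
    simp only [mem_inter_iff, mem_smul_set_iff_inv_smul_mem, mem_ofPred_eq, ← mul_smul]
    simp
  rw [AEDisjoint, e, measure_smul, hnull]

/-- The strip `-1/2 ≤ Re z < 1/2`. -/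
def strip : Set ℍ := {z | -(1 / 2) ≤ z.re ∧ z.re < 1 / 2}

lemma measurableSet_strip : MeasurableSet strip :=
  (measurableSet_le measurable_const UpperHalfPlane.continuous_re.measurable).inter
    (measurableSet_lt UpperHalfPlane.continuous_re.measurable measurable_const)

lemma zpow_T_injective {a b : ℤ} (h : ModularGroup.T ^ a = ModularGroup.T ^ b) : a = b := by
  have := congrArg (fun g : SL(2, ℤ) => g 0 1) h
  simpa [ModularGroup.coe_T_zpow] using this

lemma T_zpow_ne_neg (a b : ℤ) : ModularGroup.T ^ a ≠ -ModularGroup.T ^ b := by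
  intro h
  have := congrArg (fun g : SL(2, ℤ) => g 0 0) h
  simp [ModularGroup.coe_T_zpow] at this

lemma isFundamentalDomain_strip :
    IsFundamentalDomain (Subgroup.zpowers ModularGroup.T) strip (volume : Measure ℍ) := by
  refine IsFundamentalDomain.mk' measurableSet_strip.nullMeasurableSet fun z => ?_
  obtain ⟨n, hn, huniq⟩ := existsUnique_add_zsmul_mem_Ico (one_pos : (0 : ℝ) < 1) z.re (-(1 / 2))
  simp only [zsmul_eq_mul, mul_one] at hn huniq
  refine ⟨⟨ModularGroup.T ^ n, n, rfl⟩, ?_, ?_⟩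
  · change ModularGroup.T ^ n • z ∈ strip
    rw [strip, mem_ofPred_eq, ModularGroup.re_T_zpow_smul]
    exact ⟨hn.1, by linarith [hn.2]⟩
  · rintro ⟨_, l, rfl⟩ hl
    change ModularGroup.T ^ l • z ∈ strip at hl
    rw [strip, mem_ofPred_eq, ModularGroup.re_T_zpow_smul] at hl
    have := huniq l ⟨hl.1, by linarith [hl.2]⟩
    subst this
    rfl

/-- The chosen representative of a coset, as an element of `SL(2, ℤ)`. -/
def cosetRep {q : ℕ} (i : CosetsInf q) : SL(2, ℤ) := (i.out : CongruenceSubgroup.Gamma0 q)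

lemma cosetRep_mem {q : ℕ} (i : CosetsInf q) : cosetRep i ∈ CongruenceSubgroup.Gamma0 q :=
  i.out.2

lemma mk_eq_iff {q : ℕ} (g h : CongruenceSubgroup.Gamma0 q) :
    (Quotient.mk _ g : CosetsInf q) = Quotient.mk _ h ↔ (h : SL(2, ℤ)) * (g : SL(2, ℤ))⁻¹ ∈ GammaInf := by
  rw [Quotient.eq, QuotientGroup.rightRel_apply, Subgroup.mem_subgroupOf]
  rfl

lemma cosetRep_eq_of_mem {q : ℕ} {i j : CosetsInf q} (h : cosetRep j * (cosetRep i)⁻¹ ∈ GammaInf) :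
    i = j := by
  have := (mk_eq_iff i.out j.out).2 h
  rwa [Quotient.out_eq, Quotient.out_eq] at this

lemma exists_eq_mul_cosetRep {q : ℕ} {g : SL(2, ℤ)} (hg : g ∈ CongruenceSubgroup.Gamma0 q) :
    ∃ (i : CosetsInf q), ∃ δ ∈ GammaInf, g = δ * cosetRep i := by
  refine ⟨Quotient.mk _ ⟨g, hg⟩, g * (cosetRep (Quotient.mk _ ⟨g, hg⟩ : CosetsInf q))⁻¹, ?_, by
    simp⟩
  exact (mk_eq_iff _ ⟨g, hg⟩).1 (Quotient.out_eq _)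

/-- The union of the translates of the Ford domain by coset representatives. -/
def unfoldedDomain (q : ℕ) : Set ℍ := ⋃ i : CosetsInf q, cosetRep i • fordDomain q

/-- This is the geometric content of unfolding. Since −1 acts trivially, Γ_∞ may be replaced by the
group generated by T, for which the strip is also a fundamental domain. Invariant functions
therefore have the same integral over both. -/
lemma isFundamentalDomain_unfoldedDomain (q : ℕ) :
    IsFundamentalDomain (Subgroup.zpowers ModularGroup.T) (unfoldedDomain q)
      (volume : Measure ℍ) := by
  refine IsFundamentalDomain.mk'' ?_ (Filter.Eventually.of_forall fun z => ?_) ?_ ?_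
  · exact (MeasurableSet.iUnion fun i =>
      (measurableSet_fordDomain q).const_smul (cosetRep i)).nullMeasurableSet
  · obtain ⟨γ, hγ, hz⟩ := exists_smul_mem_fordDomain q z
    obtain ⟨i, δ, ⟨n, hδ⟩, he⟩ := exists_eq_mul_cosetRep (inv_mem hγ)
    refine ⟨⟨ModularGroup.T ^ (-n), -n, rfl⟩, ?_⟩
    refine mem_iUnion.2 ⟨i, ?_⟩
    rw [mem_smul_set_iff_inv_smul_mem]
    change (cosetRep i)⁻¹ • ModularGroup.T ^ (-n) • z ∈ fordDomain q
    have e : (cosetRep i)⁻¹ • ModularGroup.T ^ (-n) • z = γ • z := by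
      have e1 : z = γ⁻¹ • γ • z := by simp
      conv_lhs => rw [e1, he]
      rcases hδ with rfl | rfl
      · rw [zpow_neg, mul_smul, inv_smul_smul, inv_smul_smul]
      · rw [neg_mul, ModularGroup.SL_neg_smul, zpow_neg, mul_smul, inv_smul_smul, inv_smul_smul]
    rwa [e]
  · rintro ⟨_, n, rfl⟩ hn
    have hn0 : n ≠ 0 := by
      rintro rfl
      exact hn (by ext1; simp)
    change AEDisjoint volume (ModularGroup.T ^ n • unfoldedDomain q) (unfoldedDomain q)
    rw [unfoldedDomain, smul_set_iUnion, AEDisjoint.iUnion_left_iff]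
    intro i
    rw [AEDisjoint.iUnion_right_iff]
    intro j
    rw [smul_smul]
    have key : ∀ δ ∈ GammaInf, ModularGroup.T ^ n * cosetRep i = δ * cosetRep j →
        ModularGroup.T ^ n = δ := by
      intro δ hδ h
      have hij : i = j := by
        apply cosetRep_eq_of_mem
        have : cosetRep j * (cosetRep i)⁻¹ = δ⁻¹ * ModularGroup.T ^ n := by
          rw [mul_inv_eq_iff_eq_mul, mul_assoc, h]
          simp
        rw [this]
        exact mul_mem (inv_mem hδ) ⟨n, Or.inl rfl⟩
      subst hij
      exact mul_right_cancel h
    refine aedisjoint_smul_fordDomain q (mul_mem (T_zpow_mem_Gamma0 q n) (cosetRep_mem i))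
      (cosetRep_mem j) (fun h => ?_) fun h => ?_
    · have := key 1 (one_mem _) (by rw [h, one_mul])
      exact hn0 (zpow_T_injective (by simpa using this))
    · have := key (-1) ⟨0, Or.inr (by simp)⟩ (by rw [h]; simp)
      exact T_zpow_ne_neg n 0 (by simpa using this)
  · intro g
    exact (measurePreserving_smul g volume).quasiMeasurePreserving

lemma aedisjoint_cosetRep (q : ℕ) : Pairwise (Function.onFun (AEDisjoint (volume : Measure ℍ))
    fun i : CosetsInf q => cosetRep i • fordDomain q) := by
  intro i j hij
  refine aedisjoint_smul_fordDomain q (cosetRep_mem i) (cosetRep_mem j) (fun h => hij ?_)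
    fun h => hij ?_
  · apply cosetRep_eq_of_mem
    rw [h, mul_inv_cancel]
    exact one_mem _
  · apply cosetRep_eq_of_mem
    refine ⟨0, Or.inr ?_⟩
    rw [h, mul_inv_eq_iff_eq_mul]
    simp

lemma setIntegral_smul_fordDomain {E : Type*} [NormedAddCommGroup E] [NormedSpace ℝ E] (q : ℕ)
    (g : SL(2, ℤ)) (H : ℍ → E) :
    ∫ z in g • fordDomain q, H z = ∫ z in fordDomain q, H (g • z) :=
  (measurePreserving_smul g (volume : Measure ℍ)).setIntegral_image_emb
    (MeasurableEquiv.smul g).measurableEmbedding H _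

lemma hasSum_setIntegral_cosetRep {E : Type*} [NormedAddCommGroup E] [NormedSpace ℝ E] (q : ℕ)
    {H : ℍ → E} (hT : ∀ (n : ℤ) (z : ℍ), H (ModularGroup.T ^ n • z) = H z)
    (hH : IntegrableOn H strip) :
    HasSum (fun i : CosetsInf q => ∫ z in fordDomain q, H (cosetRep i • z)) (∫ z in strip, H z) := by
  have hinv : ∀ (g : Subgroup.zpowers ModularGroup.T) (z : ℍ), H (g • z) = H z := by
    rintro ⟨_, n, rfl⟩ z
    exact hT n z
  have hD := isFundamentalDomain_unfoldedDomain q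
  rw [isFundamentalDomain_strip.setIntegral_eq hD hinv]
  have hU := (isFundamentalDomain_strip.integrableOn_iff hD hinv).1 hH
  have := hasSum_integral_iUnion_ae (fun i : CosetsInf q =>
    ((measurableSet_fordDomain q).const_smul (cosetRep i)).nullMeasurableSet)
    (aedisjoint_cosetRep q) hU
  simp only [setIntegral_smul_fordDomain] at this
  exact this

/-- Unfolding over the cosets of `Γ_∞` in `Γ₀(q)`. -/
theorem setIntegral_tsum_cosetRep (q : ℕ) {H : ℍ → ℂ}
    (hT : ∀ (n : ℤ) (z : ℍ), H (ModularGroup.T ^ n • z) = H z) (hH : IntegrableOn H strip) :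
    ∫ z in fordDomain q, ∑' i : CosetsInf q, H (cosetRep i • z) = ∫ z in strip, H z := by
  have hinv : ∀ (g : Subgroup.zpowers ModularGroup.T) (z : ℍ), H (g • z) = H z := by
    rintro ⟨_, n, rfl⟩ z
    exact hT n z
  have hU := (isFundamentalDomain_strip.integrableOn_iff
    (isFundamentalDomain_unfoldedDomain q) hinv).1 hH
  have h1 := hasSum_setIntegral_cosetRep q hT hH
  -- Applied to ‖H‖, the decomposition yields the absolute summability that permits exchanging sum
  -- and integral.
  have h2 := hasSum_setIntegral_cosetRep q (H := fun z => ‖H z‖) (fun n z => by rw [hT]) hH.norm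
  have h3 := hasSum_integral_of_summable_integral_norm (μ := volume.restrict (fordDomain q))
    (F := fun (i : CosetsInf q) z => H (cosetRep i • z)) (fun i => ?_) h2.summable
  · exact h3.unique h1
  · have := hU.mono_set (subset_iUnion (fun i : CosetsInf q => cosetRep i • fordDomain q) i)
    exact ((measurePreserving_smul (cosetRep i) (volume : Measure ℍ)).integrableOn_image
      (MeasurableEquiv.smul (cosetRep i)).measurableEmbedding).1 this

end PoincareMoment

end


open scoped MatrixGroups ContDiff UpperHalfPlane

noncomputable section

namespace PoincareMoment

open MeasureTheory Set

/-! ### Representatives of the cosets of `Γ_∞` -/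

/-- A matrix with bottom row `(c, d)`, if there is one. -/
def rowRep (c d : ℤ) : SL(2, ℤ) :=
  open Classical in
  if h : ∃ g : SL(2, ℤ), g 1 0 = c ∧ g 1 1 = d then h.choose else 1

lemma rowRep_spec {c d : ℤ} (h : IsCoprime c d) : rowRep c d 1 0 = c ∧ rowRep c d 1 1 = d := by
  have hex : ∃ g : SL(2, ℤ), g 1 0 = c ∧ g 1 1 = d := by
    obtain ⟨g, -, hg⟩ := ModularGroup.bottom_row_surj (R := ℤ) (a := ![c, d]) (by simpa using h)
    have h0 := congrFun hg 0
    have h1 := congrFun hg 1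
    exact ⟨g, by simpa using h0, by simpa using h1⟩
  rw [rowRep, dif_pos hex]
  exact hex.choose_spec

lemma isCoprime_of_mem_unitRes {c d : ℕ} (h : d ∈ unitRes c) : IsCoprime (c : ℤ) (d : ℤ) := by
  rw [Nat.isCoprime_iff_coprime]
  exact ((mem_unitRes.1 h).2).symm

lemma mul_T_zpow_one_zero (g : SL(2, ℤ)) (l : ℤ) : (g * ModularGroup.T ^ l) 1 0 = g 1 0 := by
  rw [Matrix.SpecialLinearGroup.coe_mul, ModularGroup.coe_T_zpow, Matrix.mul_apply]
  simp

lemma mul_T_zpow_one_one (g : SL(2, ℤ)) (l : ℤ) :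
    (g * ModularGroup.T ^ l) 1 1 = g 1 1 + g 1 0 * l := by
  rw [Matrix.SpecialLinearGroup.coe_mul, ModularGroup.coe_T_zpow, Matrix.mul_apply]
  simp [add_comm]

lemma bottom_row_of_mul_inv_mem {g h : SL(2, ℤ)} (H : h * g⁻¹ ∈ GammaInf) :
    (h 1 0 = g 1 0 ∧ h 1 1 = g 1 1) ∨ (h 1 0 = -g 1 0 ∧ h 1 1 = -g 1 1) := by
  obtain ⟨n, hn | hn⟩ := H
  · rw [mul_inv_eq_iff_eq_mul] at hn
    have := ModularGroup.T_pow_mul_apply_one n g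
    left
    rw [hn, this]
    exact ⟨rfl, rfl⟩
  · rw [mul_inv_eq_iff_eq_mul] at hn
    have := ModularGroup.T_pow_mul_apply_one n g
    right
    rw [hn, neg_mul, Matrix.SpecialLinearGroup.coe_neg, Matrix.neg_apply, Matrix.neg_apply, this]
    exact ⟨rfl, rfl⟩

lemma mul_inv_mem_of_bottom_row {g h : SL(2, ℤ)} (h0 : h 1 0 = g 1 0) (h1 : h 1 1 = g 1 1) :
    h * g⁻¹ ∈ GammaInf := by
  apply eq_T_zpow_of_lower_left_eq_zero
  rw [Matrix.SpecialLinearGroup.coe_mul, Matrix.mul_apply, Fin.sum_univ_two, h0, h1,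
    Matrix.SpecialLinearGroup.SL2_inv_expl]
  simp
  ring

lemma neg_mem_Gamma0 {q : ℕ} {g : SL(2, ℤ)} (hg : g ∈ CongruenceSubgroup.Gamma0 q) :
    -g ∈ CongruenceSubgroup.Gamma0 q := by
  rw [CongruenceSubgroup.Gamma0_mem] at hg ⊢
  rw [Matrix.SpecialLinearGroup.coe_neg, Matrix.neg_apply, Int.cast_neg, hg, neg_zero]

/-- The pairs of a modulus `q (n + 1)` and a reduced residue. -/
abbrev Residues (q : ℕ) : Type := Σ n : ℕ, {d // d ∈ unitRes (q * (n + 1))}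

/-- A matrix attached to a modulus and a reduced residue. -/
def residueRep {q : ℕ} (b : Residues q) : SL(2, ℤ) := rowRep ((q * (b.1 + 1) : ℕ) : ℤ) (b.2 : ℕ)

lemma residueRep_one_zero {q : ℕ} (b : Residues q) :
    residueRep b 1 0 = ((q * (b.1 + 1) : ℕ) : ℤ) :=
  (rowRep_spec (isCoprime_of_mem_unitRes b.2.2)).1

lemma residueRep_one_one {q : ℕ} (b : Residues q) : residueRep b 1 1 = ((b.2 : ℕ) : ℤ) :=
  (rowRep_spec (isCoprime_of_mem_unitRes b.2.2)).2

/-- Representatives of the cosets of `Γ_∞` in `Γ₀(q)`. -/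
def indexRep {q : ℕ} : Option (Residues q × ℤ) → SL(2, ℤ)
  | none => 1
  | some (b, l) => residueRep b * ModularGroup.T ^ l

lemma indexRep_mem {q : ℕ} (j : Option (Residues q × ℤ)) :
    indexRep j ∈ CongruenceSubgroup.Gamma0 q := by
  rcases j with _ | ⟨b, l⟩
  · exact one_mem _
  · rw [CongruenceSubgroup.Gamma0_mem, indexRep, mul_T_zpow_one_zero, residueRep_one_zero]
    push_cast
    simp

/-- A coset is a bottom row (c, d) up to sign. The row with c = 0 is `none`; otherwise c = q(n + 1)
> 0, and d is uniquely a reduced residue plus cl. For c = 1 the only residue is 0. -/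
lemma indexRep_bijective {q : ℕ} (hq : 0 < q) : Function.Bijective
    fun j : Option (Residues q × ℤ) =>
      (Quotient.mk _ ⟨indexRep j, indexRep_mem j⟩ : CosetsInf q) := by
  have hpos : ∀ b : Residues q, (0 : ℤ) < ((q * (b.1 + 1) : ℕ) : ℤ) := fun b => by
    exact_mod_cast Nat.mul_pos hq (Nat.succ_pos _)
  have e10 : ∀ b : Residues q, ∀ l : ℤ, indexRep (some (b, l)) 1 0 = ((q * (b.1 + 1) : ℕ) : ℤ) :=
    fun b l => by rw [indexRep, mul_T_zpow_one_zero, residueRep_one_zero]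
  have e11 : ∀ b : Residues q, ∀ l : ℤ, indexRep (some (b, l)) 1 1
      = ((b.2 : ℕ) : ℤ) + ((q * (b.1 + 1) : ℕ) : ℤ) * l :=
    fun b l => by rw [indexRep, mul_T_zpow_one_one, residueRep_one_zero, residueRep_one_one]
  have e0 : indexRep (none : Option (Residues q × ℤ)) 1 0 = 0 := by simp [indexRep]
  constructor
  · intro i j hij
    have hb := bottom_row_of_mul_inv_mem ((mk_eq_iff _ _).1 hij)
    dsimp only at hb
    rcases i with _ | ⟨⟨n, d⟩, l⟩ <;> rcases j with _ | ⟨⟨n', d'⟩, l'⟩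
    · rfl
    · rw [e0, e10] at hb
      have := hpos ⟨n', d'⟩
      omega
    · rw [e0, e10] at hb
      have := hpos ⟨n, d⟩
      omega
    · rw [e10, e10, e11, e11] at hb
      have h1 := hpos ⟨n', d'⟩
      have h2 := hpos ⟨n, d⟩
      simp only at hb h1 h2
      have h3 := hb.resolve_right (by omega)
      have hn : q * (n' + 1) = q * (n + 1) := by exact_mod_cast h3.1
      have hn' : n' = n := by
        have := Nat.eq_of_mul_eq_mul_left hq hn
        omega
      subst hn'
      obtain ⟨d, hd⟩ := d
      obtain ⟨d', hd'⟩ := d'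
      have hlt := (mem_unitRes.1 hd).1
      have hlt' := (mem_unitRes.1 hd').1
      simp only at h3
      set c : ℕ := q * (n' + 1) with hc
      have hdd : (d' : ℤ) = d := by
        have := congrArg (· % (c : ℤ)) h3.2
        simp only [Int.add_mul_emod_self_left] at this
        rwa [Int.emod_eq_of_lt (by omega) (by omega), Int.emod_eq_of_lt (by omega) (by omega)] at this
      have hll : l' = l := by
        have h4 := h3.2
        rw [hdd] at h4
        exact mul_left_cancel₀ h2.ne' (add_left_cancel h4)
      subst hll
      have : d' = d := by exact_mod_cast hdd
      subst this
      rfl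
  · have key : ∀ g : CongruenceSubgroup.Gamma0 q, 0 < (g : SL(2, ℤ)) 1 0 →
        ∃ j : Option (Residues q × ℤ), (Quotient.mk _ ⟨indexRep j, indexRep_mem j⟩ : CosetsInf q)
          = Quotient.mk _ g := by
      rintro ⟨g, hg⟩ hpos'
      simp only at hpos'
      have hdvd : (q : ℤ) ∣ g 1 0 := (ZMod.intCast_zmod_eq_zero_iff_dvd _ _).1
        (CongruenceSubgroup.Gamma0_mem.1 hg)
      obtain ⟨r, hr⟩ := hdvd
      have hr0 : 0 < r := by
        by_contra h
        have : (q : ℤ) * r ≤ 0 := mul_nonpos_of_nonneg_of_nonpos (by positivity) (not_lt.1 h)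
        omega
      obtain ⟨n, rfl⟩ : ∃ n : ℕ, r = ((n + 1 : ℕ) : ℤ) := ⟨(r - 1).toNat, by omega⟩
      have hc : g 1 0 = ((q * (n + 1) : ℕ) : ℤ) := by rw [hr]; push_cast; ring
      set c : ℕ := q * (n + 1) with hcdef
      have hc0 : (0 : ℤ) < c := by rw [← hc]; exact hpos'
      have hcop := ModularGroup.bottom_row_coprime g
      rw [hc] at hcop
      set d : ℕ := (g 1 1 % (c : ℤ)).toNat with hd
      have hdZ : (d : ℤ) = g 1 1 % (c : ℤ) := Int.toNat_of_nonneg (Int.emod_nonneg _ hc0.ne')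
      have hdmem : d ∈ unitRes c := by
        rw [mem_unitRes]
        constructor
        · have := Int.emod_lt_of_pos (g 1 1) hc0
          omega
        · rw [← Nat.isCoprime_iff_coprime, hdZ, Int.emod_def, sub_eq_add_neg, ← mul_neg]
          exact (hcop.symm).add_mul_left_left _
      refine ⟨some (⟨n, ⟨d, hdmem⟩⟩, g 1 1 / (c : ℤ)), ?_⟩
      rw [mk_eq_iff]
      refine mul_inv_mem_of_bottom_row ?_ ?_
      · rw [e10, hc]
      · rw [e11]
        simp only
        rw [hdZ]
        exact (Int.emod_add_mul_ediv _ _).symm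
    intro x
    induction x using Quotient.inductionOn with
    | h g =>
      rcases lt_trichotomy ((g : SL(2, ℤ)) 1 0) 0 with h | h | h
      · obtain ⟨j, hj⟩ := key ⟨-(g : SL(2, ℤ)), neg_mem_Gamma0 g.2⟩ (by
          rw [Matrix.SpecialLinearGroup.coe_neg, Matrix.neg_apply]
          omega)
        refine ⟨j, hj.trans ?_⟩
        rw [mk_eq_iff]
        refine ⟨0, Or.inr ?_⟩
        rw [mul_inv_eq_iff_eq_mul]
        simp
      · refine ⟨none, ?_⟩
        simp only
        rw [mk_eq_iff]
        simp only [indexRep, inv_one, mul_one]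
        exact eq_T_zpow_of_lower_left_eq_zero h
      · exact key g h

/-- Enumeration of the cosets of `Γ_∞` in `Γ₀(q)`. -/
def indexEquiv {q : ℕ} (hq : 0 < q) : Option (Residues q × ℤ) ≃ CosetsInf q :=
  Equiv.ofBijective _ (indexRep_bijective hq)

/-- This passes from the representatives chosen by `Quotient.out` to the explicit ones, for any
Γ_∞-invariant expression. -/
lemma apply_cosetRep_indexEquiv {q : ℕ} (hq : 0 < q) {α : Type*} {F : SL(2, ℤ) → α}
    (hF : ∀ δ ∈ GammaInf, ∀ g, F (δ * g) = F g) (j : Option (Residues q × ℤ)) :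
    F (cosetRep (indexEquiv hq j)) = F (indexRep j) := by
  have h : (Quotient.mk _ (indexEquiv hq j).out : CosetsInf q)
      = Quotient.mk _ ⟨indexRep j, indexRep_mem j⟩ := Quotient.out_eq _
  have h2 := (mk_eq_iff _ _).1 h.symm
  have h3 := hF _ h2 (indexRep j)
  rw [← h3]
  simp only [inv_mul_cancel_right]
  rfl

end PoincareMoment

end


open scoped MatrixGroups ContDiff UpperHalfPlane

noncomputable section

namespace PoincareMoment

open MeasureTheory Set
open scoped Pointwise

/-! ### Sums of integrable functions and coordinates on the upper half-plane -/

/-- Tonelli for the norms. Unfolding requires integrability of the whole sum and not merely the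
value of its integral. -/
lemma ae_summable_norm_and_integrable_tsum {α ι E : Type*} [MeasurableSpace α] [Countable ι]
    [NormedAddCommGroup E] [CompleteSpace E] {μ : Measure α} {F : ι → α → E}
    (hF : ∀ i, Integrable (F i) μ) (hs : Summable fun i => ∫ a, ‖F i a‖ ∂μ) :
    (∀ᵐ a ∂μ, Summable fun i => ‖F i a‖) ∧ Integrable (fun a => ∑' i, F i a) μ := by
  have hfin : ∫⁻ a, ∑' i, ‖F i a‖ₑ ∂μ ≠ ⊤ := by
    rw [lintegral_tsum fun i => (hF i).1.enorm]
    have : ∀ i, ∫⁻ a, ‖F i a‖ₑ ∂μ = ENNReal.ofReal (∫ a, ‖F i a‖ ∂μ) := fun i =>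
      (ofReal_integral_norm_eq_lintegral_enorm (hF i)).symm
    simp only [this]
    rw [← ENNReal.ofReal_tsum_of_nonneg (fun i => integral_nonneg fun a => norm_nonneg _) hs]
    exact ENNReal.ofReal_ne_top
  have hae : ∀ᵐ a ∂μ, Summable fun i => ‖F i a‖ := by
    have := ae_lt_top' (AEMeasurable.tsum fun i => (hF i).1.enorm) hfin
    filter_upwards [this] with a ha
    have h2 : ∑' i, ((‖F i a‖₊ : NNReal) : ENNReal) ≠ ⊤ := ha.ne
    have h3 := ENNReal.tsum_coe_ne_top_iff_summable.1 h2
    exact NNReal.summable_coe.2 h3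
  refine ⟨hae, ?_, ?_⟩
  · refine aestronglyMeasurable_of_tendsto_ae (Filter.atTop : Filter (Finset ι))
      (f := fun s a => ∑ i ∈ s, F i a) (fun s => ?_) ?_
    · exact Finset.aestronglyMeasurable_fun_sum s fun i _ => (hF i).1
    · filter_upwards [hae] with a ha
      exact ha.of_norm.hasSum
  · rw [HasFiniteIntegral]
    refine lt_of_le_of_lt (lintegral_mono_ae ?_) (lt_top_iff_ne_top.2 hfin)
    filter_upwards [hae] with a ha
    have h1 := norm_tsum_le_tsum_norm ha
    rw [← ofReal_norm]
    refine (ENNReal.ofReal_le_ofReal h1).trans ?_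
    rw [ENNReal.ofReal_tsum_of_nonneg (fun i => norm_nonneg _) ha]
    simp only [ofReal_norm, le_refl]

lemma hasSum_option {ι E : Type*} [AddCommGroup E] [TopologicalSpace E] [IsTopologicalAddGroup E]
    {f : Option ι → E} {a : E} (h : HasSum (fun i => f (some i)) a) : HasSum f (f none + a) := by
  classical
  have h1 : HasSum (fun j : Option ι => if j = none then f none else 0) (f none) :=
    hasSum_ite_eq none (f none)
  have h2 : HasSum (fun j : Option ι => if j = none then 0 else f j) a := by
    rw [← (Option.some_injective ι).hasSum_iff]
    · simpa [Function.comp_def] using h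
    · intro x hx
      rcases x with _ | x
      · simp
      · exact absurd ⟨x, rfl⟩ hx
  convert! h1.add h2 using 1
  funext j
  by_cases hj : j = none <;> simp [hj]

/-- The map to real coordinates. -/
def realCoord (z : ℍ) : ℝ × ℝ := (z.re, z.im)

lemma measurableEmbedding_realCoord : MeasurableEmbedding realCoord :=
  Complex.measurableEquivRealProd.measurableEmbedding.comp UpperHalfPlane.measurableEmbedding_coe

/-- The point of the upper half-plane with given real coordinates. -/
def ofCoord (p : ℝ × ℝ) : ℍ := UpperHalfPlane.ofComplex (p.1 + p.2 * Complex.I)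

lemma ofCoord_realCoord (z : ℍ) : ofCoord (realCoord z) = z := by
  rw [ofCoord, realCoord]
  have : ((z.re : ℂ) + z.im * Complex.I) = z := Complex.re_add_im _
  rw [this, UpperHalfPlane.ofComplex_apply]

lemma coe_ofCoord {x y : ℝ} (hy : 0 < y) : ((ofCoord (x, y) : ℍ) : ℂ) = x + y * Complex.I := by
  rw [ofCoord, UpperHalfPlane.ofComplex_apply_of_im_pos (by simpa using hy)]

lemma im_ofCoord {x y : ℝ} (hy : 0 < y) : (ofCoord (x, y)).im = y := by
  rw [← UpperHalfPlane.coe_im, coe_ofCoord hy]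
  simp

lemma range_realCoord : range realCoord = univ ×ˢ Ioi 0 := by
  ext ⟨x, y⟩
  simp only [mem_range, mem_prod, mem_univ, mem_Ioi, true_and]
  constructor
  · rintro ⟨z, hz⟩
    have : z.im = y := congrArg Prod.snd hz
    exact this ▸ z.im_pos
  · intro hy
    refine ⟨⟨x + y * Complex.I, by simpa using hy⟩, ?_⟩
    ext
    · simp [realCoord, UpperHalfPlane.re]
    · simp [realCoord, UpperHalfPlane.im]

/-- The points with real part in `A`. -/
def reSet (A : Set ℝ) : Set ℍ := {z | z.re ∈ A}

lemma image_realCoord_reSet (A : Set ℝ) : realCoord '' reSet A = A ×ˢ Ioi 0 := by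
  have h : reSet A = realCoord ⁻¹' (A ×ˢ univ) := by
    ext z
    simp [reSet, realCoord]
  rw [h, image_preimage_eq_inter_range, range_realCoord, prod_inter_prod, inter_univ, univ_inter]

lemma measurePreserving_realCoord : MeasurePreserving realCoord
    ((volume : Measure ℂ).comap UpperHalfPlane.coe) (volume.restrict (univ ×ˢ Ioi 0)) := by
  refine ⟨measurableEmbedding_realCoord.measurable, ?_⟩
  have h1 : realCoord = Complex.measurableEquivRealProd ∘ UpperHalfPlane.coe := rfl
  rw [h1, ← Measure.map_map (Complex.measurableEquivRealProd.measurable)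
    UpperHalfPlane.measurable_coe, UpperHalfPlane.measurableEmbedding_coe.map_comap]
  have h2 : range UpperHalfPlane.coe = Complex.measurableEquivRealProd ⁻¹' (univ ×ˢ Ioi 0) := by
    rw [← range_realCoord, h1, range_comp]
    exact (preimage_image_eq _ Complex.measurableEquivRealProd.injective).symm
  rw [h2]
  exact ((Complex.volume_preserving_equiv_real_prod).restrict_preimage
    (MeasurableSet.univ.prod measurableSet_Ioi)).map_eq

lemma measurable_invSq : Measurable fun z : ℍ =>
    ((1 / NNReal.mk z.im z.im_pos.le : NNReal) ^ 2) := by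
  refine Measurable.pow_const (Measurable.div measurable_const ?_) 2
  exact (UpperHalfPlane.continuous_im.subtype_mk _).measurable

lemma invSq_smul {E : Type*} [NormedAddCommGroup E] [NormedSpace ℝ E] (f : ℍ → E) :
    (fun z : ℍ => ((1 / NNReal.mk z.im z.im_pos.le : NNReal) ^ 2) • f z)
      = (fun p : ℝ × ℝ => (p.2 ^ 2)⁻¹ • f (ofCoord p)) ∘ realCoord := by
  funext z
  simp only [Function.comp, ofCoord_realCoord]
  rw [NNReal.smul_def]
  congr 1
  simp [realCoord]

lemma restrict_prod_Ioi (A : Set ℝ) :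
    ((volume : Measure (ℝ × ℝ)).restrict (univ ×ˢ Ioi 0)).restrict (A ×ˢ Ioi 0)
      = (volume.restrict A).prod (volume.restrict (Ioi 0)) := by
  rw [Measure.restrict_restrict_of_subset (prod_mono (subset_univ _) subset_rfl),
    Measure.prod_restrict, Measure.volume_eq_prod]

lemma measurableSet_reSet {A : Set ℝ} (hA : MeasurableSet A) : MeasurableSet (reSet A) :=
  UpperHalfPlane.continuous_re.measurable hA

lemma integrableOn_reSet_iff {E : Type*} [NormedAddCommGroup E] [NormedSpace ℝ E] {A : Set ℝ}
    (hA : MeasurableSet A) (f : ℍ → E) :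
    IntegrableOn f (reSet A) ↔ Integrable (fun p : ℝ × ℝ => (p.2 ^ 2)⁻¹ • f (ofCoord p))
      ((volume.restrict A).prod (volume.restrict (Ioi 0))) := by
  rw [IntegrableOn, UpperHalfPlane.volume_def, restrict_withDensity (measurableSet_reSet hA),
    integrable_withDensity_iff_integrable_smul measurable_invSq, invSq_smul, ← IntegrableOn,
    ← measurePreserving_realCoord.integrableOn_image measurableEmbedding_realCoord,
    image_realCoord_reSet, IntegrableOn, restrict_prod_Ioi]

lemma setIntegral_reSet {E : Type*} [NormedAddCommGroup E] [NormedSpace ℝ E] {A : Set ℝ}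
    (hA : MeasurableSet A) {f : ℍ → E} (hf : IntegrableOn f (reSet A)) :
    ∫ z in reSet A, f z = ∫ y in Ioi (0 : ℝ), (y ^ 2)⁻¹ • ∫ x in A, f (ofCoord (x, y)) := by
  have h := (integrableOn_reSet_iff hA f).1 hf
  rw [UpperHalfPlane.volume_def, restrict_withDensity (measurableSet_reSet hA),
    integral_withDensity_eq_integral_smul measurable_invSq, invSq_smul]
  have := measurePreserving_realCoord.setIntegral_image_emb measurableEmbedding_realCoord
    (fun p : ℝ × ℝ => (p.2 ^ 2)⁻¹ • f (ofCoord p)) (reSet A)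
  refine this.symm.trans ?_
  rw [image_realCoord_reSet, restrict_prod_Ioi, integral_prod_symm _ h]
  refine integral_congr_ae (Filter.Eventually.of_forall fun y => ?_)
  exact integral_smul ((y ^ 2)⁻¹ : ℝ) (fun x => f (ofCoord (x, y)))

lemma reSet_univ : reSet univ = univ := by
  ext z
  simp [reSet]

lemma strip_eq_reSet : strip = reSet (Ico (-(1 / 2)) (1 / 2)) := rfl

/-- Summing over integral translates of the strip. -/
lemma hasSum_setIntegral_strip {E : Type*} [NormedAddCommGroup E] [NormedSpace ℝ E] {f : ℍ → E}
    (hf : Integrable f) :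
    HasSum (fun l : ℤ => ∫ z in strip, f (ModularGroup.T ^ l • z)) (∫ z, f z) := by
  have hU : (⋃ l : ℤ, ModularGroup.T ^ l • strip) = univ := by
    rw [eq_univ_iff_forall]
    intro z
    obtain ⟨n, hn, -⟩ := existsUnique_add_zsmul_mem_Ico (one_pos : (0 : ℝ) < 1) z.re (-(1 / 2))
    simp only [zsmul_eq_mul, mul_one] at hn
    refine mem_iUnion.2 ⟨-n, ?_⟩
    rw [mem_smul_set_iff_inv_smul_mem, zpow_neg, inv_inv, strip, mem_ofPred_eq,
      ModularGroup.re_T_zpow_smul]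
    exact ⟨hn.1, by linarith [hn.2]⟩
  have hdis : Pairwise (Function.onFun Disjoint fun l : ℤ => ModularGroup.T ^ l • strip) := by
    intro a b hab
    refine Set.disjoint_left.2 fun z hz hz' => hab ?_
    rw [mem_smul_set_iff_inv_smul_mem, ← zpow_neg, strip, mem_ofPred_eq,
      ModularGroup.re_T_zpow_smul] at hz hz'
    obtain ⟨n, -, huniq⟩ := existsUnique_add_zsmul_mem_Ico (one_pos : (0 : ℝ) < 1) z.re (-(1 / 2))
    simp only [zsmul_eq_mul, mul_one] at huniq
    have e1 := huniq (-a) ⟨hz.1, by linarith [hz.2]⟩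
    have e2 := huniq (-b) ⟨hz'.1, by linarith [hz'.2]⟩
    omega
  have := hasSum_integral_iUnion (μ := (volume : Measure ℍ)) (f := f)
    (fun l : ℤ => measurableSet_strip.const_smul (ModularGroup.T ^ l)) hdis
    (by rw [hU]; exact hf.integrableOn)
  rw [hU, setIntegral_univ] at this
  convert! this using 1
  funext l
  exact ((measurePreserving_smul (ModularGroup.T ^ l) (volume : Measure ℍ)).setIntegral_image_emb
    (MeasurableEquiv.smul (ModularGroup.T ^ l)).measurableEmbedding f _).symm

end PoincareMoment

end


open scoped MatrixGroups ContDiff UpperHalfPlane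

noncomputable section

namespace PoincareMoment

open MeasureTheory Set

/-! ### The terms of the Petersson formula -/

/-- A term of the Poincaré series against the conjugate of `e(mz)`, with the weight `y^k`. -/
def pairTerm (k m q : ℕ) (χ : DirichletCharacter ℂ q) (γ : SL(2, ℤ)) (z : ℍ) : ℂ :=
  (starRingEnd ℂ) (Complex.exp (2 * Real.pi * Complex.I * m * (z : ℂ))) *
    poincareTerm k m q χ z γ * ((z.im ^ k : ℝ) : ℂ)

lemma exp_T_zpow_smul (m : ℕ) (l : ℤ) (z : ℍ) :
    Complex.exp (2 * Real.pi * Complex.I * m * ((ModularGroup.T ^ l • z : ℍ) : ℂ))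
      = Complex.exp (2 * Real.pi * Complex.I * m * (z : ℂ)) := by
  rw [ModularGroup.coe_T_zpow_smul_eq, mul_add, Complex.exp_add]
  have : Complex.exp (2 * Real.pi * Complex.I * m * (l : ℂ)) = 1 := by
    rw [Complex.exp_eq_one_iff]
    exact ⟨m * l, by push_cast; ring⟩
  rw [this, mul_one]

lemma poincareTerm_mul_T_zpow (k m q : ℕ) (χ : DirichletCharacter ℂ q) {γ : SL(2, ℤ)}
    (hγ : γ ∈ CongruenceSubgroup.Gamma0 q) (l : ℤ) (z : ℍ) :
    poincareTerm k m q χ z (γ * ModularGroup.T ^ l)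
      = poincareTerm k m q χ (ModularGroup.T ^ l • z) γ := by
  rw [CongruenceSubgroup.Gamma0_mem] at hγ
  simp only [poincareTerm, mul_T_zpow_one_zero, mul_T_zpow_one_one, mul_smul,
    ModularGroup.coe_T_zpow_smul_eq]
  push_cast
  rw [hγ, zero_mul, add_zero]
  congr 3
  ring

lemma pairTerm_mul_T_zpow (k m q : ℕ) (χ : DirichletCharacter ℂ q) {γ : SL(2, ℤ)}
    (hγ : γ ∈ CongruenceSubgroup.Gamma0 q) (l : ℤ) (z : ℍ) :
    pairTerm k m q χ (γ * ModularGroup.T ^ l) z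
      = pairTerm k m q χ γ (ModularGroup.T ^ l • z) := by
  rw [pairTerm, pairTerm, exp_T_zpow_smul, poincareTerm_mul_T_zpow k m q χ hγ,
    ModularGroup.im_T_zpow_smul]

lemma denom_ne_zero' (γ : SL(2, ℤ)) (z : ℍ) : ((γ 1 0 : ℂ) * z + (γ 1 1 : ℂ)) ≠ 0 :=
  Complex.normSq_pos.1 (normSq_bottom_pos γ z)

lemma continuous_poincareTerm (k m q : ℕ) (χ : DirichletCharacter ℂ q) (γ : SL(2, ℤ)) :
    Continuous fun z : ℍ => poincareTerm k m q χ z γ := by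
  unfold poincareTerm
  have hc := UpperHalfPlane.continuous_coe
  refine (continuous_const.mul (Continuous.zpow₀ ?_ _ fun z => Or.inl (denom_ne_zero' γ z))).mul
    (Complex.continuous_exp.comp ?_)
  · exact (continuous_const.mul hc).add continuous_const
  · exact continuous_const.mul (hc.comp (continuous_const_smul γ))

lemma continuous_pairTerm (k m q : ℕ) (χ : DirichletCharacter ℂ q) (γ : SL(2, ℤ)) :
    Continuous (pairTerm k m q χ γ) := by
  unfold pairTerm
  have hc := UpperHalfPlane.continuous_coe
  refine ((Complex.continuous_conj.comp (Complex.continuous_exp.comp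
    (continuous_const.mul hc))).mul (continuous_poincareTerm k m q χ γ)).mul ?_
  exact Complex.continuous_ofReal.comp (UpperHalfPlane.continuous_im.pow k)

lemma coe_SL_smul_eq {γ : SL(2, ℤ)} (hc : γ 1 0 ≠ 0) (z : ℍ) :
    ((γ • z : ℍ) : ℂ) = (γ 0 0 : ℂ) / (γ 1 0 : ℂ)
      - 1 / ((γ 1 0 : ℂ) * ((γ 1 0 : ℂ) * z + (γ 1 1 : ℂ))) := by
  have hdet : (γ 0 0 : ℂ) * (γ 1 1 : ℂ) - (γ 0 1 : ℂ) * (γ 1 0 : ℂ) = 1 := by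
    have := γ.det_coe
    rw [Matrix.det_fin_two] at this
    exact_mod_cast this
  have hc' : (γ 1 0 : ℂ) ≠ 0 := by exact_mod_cast hc
  have hd := denom_ne_zero' γ z
  rw [UpperHalfPlane.coe_specialLinearGroup_apply]
  simp only [algebraMap_int_eq, eq_intCast, Complex.ofReal_intCast]
  rw [div_sub_div _ _ hc' (mul_ne_zero hc' hd), div_eq_div_iff hd (mul_ne_zero hc' (mul_ne_zero hc' hd))]
  linear_combination (-(γ 1 0 : ℂ) * ((γ 1 0 : ℂ) * z + (γ 1 1 : ℂ))) * hdet

lemma exp_neg_le_rpow {X : ℝ} (hX : 0 < X) : Real.exp (-X) ≤ X ^ (-(1 / 4) : ℝ) := by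
  rw [Real.exp_neg, Real.rpow_neg hX.le]
  refine inv_anti₀ (by positivity) ?_
  rcases le_total X 1 with h | h
  · exact (Real.rpow_le_one hX.le h (by norm_num)).trans (Real.one_le_exp hX.le)
  · calc X ^ (1 / 4 : ℝ) ≤ X ^ (1 : ℝ) := Real.rpow_le_rpow_of_exponent_le h (by norm_num)
      _ = X := Real.rpow_one X
      _ ≤ Real.exp X := by linarith [Real.add_one_le_exp X]

/-- The elementary inequality behind absolute convergence. -/
lemma inv_pow_mul_exp_mul_pow_le {c R y : ℝ} (hc : 1 ≤ c) (hy : 0 < y) (hR : y ≤ R) {k : ℕ}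
    (hk : 3 ≤ k) : ((c * R) ^ k)⁻¹ * Real.exp (-(y / (c * R) ^ 2)) * y ^ k
      ≤ c ^ (-(5 / 2) : ℝ) * (y ^ (9 / 4 : ℝ) * (R ^ 2)⁻¹) := by
  have hR0 : 0 < R := hy.trans_le hR
  have hc0 : 0 < c := by linarith
  set Q := c * R with hQ
  have hQ0 : 0 < Q := by positivity
  have hQy : y ≤ Q := hR.trans (by rw [hQ]; nlinarith)
  obtain ⟨n, rfl⟩ := Nat.exists_eq_add_of_le hk
  -- For k = 3 the bound without the exponential leaves ∫ dy/y near 0. Trading the exponential for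
  -- (y/Q²)^{−1/4} changes this to the integrable y^{−3/4}. The price is c^{−5/2} in place of
  -- c^{−3}, still summable against the at most c residues modulo c.
  have hA : Real.exp (-(y / Q ^ 2)) ≤ y ^ (-(1 / 4) : ℝ) * Q ^ (1 / 2 : ℝ) := by
    refine (exp_neg_le_rpow (by positivity)).trans (le_of_eq ?_)
    rw [Real.div_rpow hy.le (by positivity), ← Real.rpow_natCast Q 2, ← Real.rpow_mul hQ0.le,
      div_eq_mul_inv, ← Real.rpow_neg hQ0.le]
    norm_num
  have hB : (Q ^ 3)⁻¹ * Q ^ (1 / 2 : ℝ) = Q ^ (-(5 / 2) : ℝ) := by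
    rw [← Real.rpow_natCast, ← Real.rpow_neg hQ0.le, ← Real.rpow_add hQ0]
    norm_num
  have hC : Q ^ (-(5 / 2) : ℝ) ≤ c ^ (-(5 / 2) : ℝ) * ((R ^ 2)⁻¹ * y ^ (-(1 / 2) : ℝ)) := by
    rw [hQ, Real.mul_rpow hc0.le hR0.le]
    gcongr
    have : R ^ (-(5 / 2) : ℝ) = (R ^ 2)⁻¹ * R ^ (-(1 / 2) : ℝ) := by
      rw [← Real.rpow_natCast, ← Real.rpow_neg hR0.le, ← Real.rpow_add hR0]
      norm_num
    rw [this]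
    gcongr ?_ * ?_
    exact Real.rpow_le_rpow_of_nonpos hy hR (by norm_num)
  have hD : (y ^ n)⁻¹ * y ^ (3 + n) * y ^ (-(1 / 4) : ℝ) * y ^ (-(1 / 2) : ℝ) = y ^ (9 / 4 : ℝ) := by
    have e1 : (y ^ n)⁻¹ * y ^ (3 + n) = y ^ (3 : ℝ) := by
      rw [pow_add, show (3 : ℝ) = ((3 : ℕ) : ℝ) by norm_num, Real.rpow_natCast]
      field_simp
    rw [e1, ← Real.rpow_add hy, ← Real.rpow_add hy]
    norm_num
  calc (Q ^ (3 + n))⁻¹ * Real.exp (-(y / Q ^ 2)) * y ^ (3 + n)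
      ≤ ((y ^ n)⁻¹ * (Q ^ 3)⁻¹) * (y ^ (-(1 / 4) : ℝ) * Q ^ (1 / 2 : ℝ)) * y ^ (3 + n) := by
        gcongr
        rw [pow_add, mul_inv, mul_comm]
        gcongr
    _ = Q ^ (-(5 / 2) : ℝ) * ((y ^ n)⁻¹ * y ^ (3 + n) * y ^ (-(1 / 4) : ℝ)) := by
        rw [← hB]; ring
    _ ≤ c ^ (-(5 / 2) : ℝ) * ((R ^ 2)⁻¹ * y ^ (-(1 / 2) : ℝ)) *
          ((y ^ n)⁻¹ * y ^ (3 + n) * y ^ (-(1 / 4) : ℝ)) := by gcongr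
    _ = _ := by rw [← hD]; ring

/-- A majorant for the terms. -/
def majorant (m s : ℝ) (p : ℝ × ℝ) : ℝ :=
  Real.exp (-(2 * Real.pi * m * p.2)) * (p.2 ^ (9 / 4 : ℝ) * ((p.1 + s) ^ 2 + p.2 ^ 2)⁻¹)

/-- The integral of the majorant over the upper half-plane. -/
def majorantMass (m : ℝ) : ℝ :=
  ∫ y in Ioi (0 : ℝ), (y ^ 2)⁻¹ * (Real.exp (-(2 * Real.pi * m * y)) *
    (y ^ (9 / 4 : ℝ) * (Real.pi / y)))

lemma integral_majorant (m s : ℝ) {y : ℝ} (hy : 0 < y) :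
    Integrable (fun x => (y ^ 2)⁻¹ * majorant m s (x, y)) ∧
    ∫ x, (y ^ 2)⁻¹ * majorant m s (x, y) = (y ^ 2)⁻¹ * (Real.exp (-(2 * Real.pi * m * y)) *
      (y ^ (9 / 4 : ℝ) * (Real.pi / y))) := by
  simp only [majorant]
  have h := (integrable_inv_sq_add_sq hy).comp_add_right s
  refine ⟨((h.const_mul _).const_mul _).const_mul _, ?_⟩
  rw [integral_const_mul, integral_const_mul, integral_const_mul,
    integral_add_right_eq_self (fun x : ℝ => (x ^ 2 + y ^ 2)⁻¹) s, integral_inv_sq_add_sq hy]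

lemma integrableOn_majorantMass {m : ℝ} (hm : 0 < m) :
    IntegrableOn (fun y : ℝ => (y ^ 2)⁻¹ * (Real.exp (-(2 * Real.pi * m * y)) *
      (y ^ (9 / 4 : ℝ) * (Real.pi / y)))) (Ioi 0) := by
  have hpi := Real.pi_pos
  have h := (integrableOn_rpow_mul_exp_neg_mul_rpow (p := 1) (s := -(3 / 4)) (b := 2 * Real.pi * m)
    (by norm_num) one_pos (by positivity)).const_mul Real.pi
  refine IntegrableOn.congr_fun h (fun y hy => ?_) measurableSet_Ioi
  have hy : 0 < y := hy
  have e : y ^ (-(3 / 4) : ℝ) = (y ^ 2)⁻¹ * y ^ (9 / 4 : ℝ) * y⁻¹ := by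
    rw [← Real.rpow_natCast, ← Real.rpow_neg hy.le, ← Real.rpow_neg_one, ← Real.rpow_add hy,
      ← Real.rpow_add hy]
    norm_num
  simp only [Real.rpow_one, e]
  rw [neg_mul]
  ring

lemma integrable_majorant {m : ℝ} (hm : 0 < m) (s : ℝ) :
    Integrable (fun p : ℝ × ℝ => (p.2 ^ 2)⁻¹ * majorant m s p)
      (volume.prod (volume.restrict (Ioi 0))) := by
  have hmeas : Measurable fun p : ℝ × ℝ => (p.2 ^ 2)⁻¹ * majorant m s p := by
    unfold majorant
    fun_prop
  rw [integrable_prod_iff' hmeas.aestronglyMeasurable]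
  constructor
  · filter_upwards [ae_restrict_mem measurableSet_Ioi] with y hy
    exact (integral_majorant m s hy).1
  · refine (integrableOn_majorantMass hm).congr ?_
    filter_upwards [ae_restrict_mem measurableSet_Ioi] with y hy
    rw [← (integral_majorant m s hy).2]
    refine integral_congr_ae (Filter.Eventually.of_forall fun x => ?_)
    have hy : 0 < y := hy
    simp only
    rw [Real.norm_of_nonneg]
    unfold majorant
    positivity

lemma norm_poincareTerm_le (k m q : ℕ) (χ : DirichletCharacter ℂ q) (γ : SL(2, ℤ)) (z : ℍ) :
    ‖poincareTerm k m q χ z γ‖ ≤ (‖(γ 1 0 : ℂ) * z + (γ 1 1 : ℂ)‖ ^ k)⁻¹ *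
      Real.exp (-(2 * Real.pi * m * (z.im / ‖(γ 1 0 : ℂ) * z + (γ 1 1 : ℂ)‖ ^ 2))) := by
  rw [poincareTerm, norm_mul, norm_mul, RCLike.norm_conj, zpow_neg, zpow_natCast, norm_inv,
    norm_pow]
  have h1 := χ.norm_le_one ((γ 1 1 : ℤ) : ZMod q)
  have h2 : ‖Complex.exp (2 * Real.pi * Complex.I * m * ((γ • z : ℍ) : ℂ))‖
      = Real.exp (-(2 * Real.pi * m * (z.im / ‖(γ 1 0 : ℂ) * z + (γ 1 1 : ℂ)‖ ^ 2))) := by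
    rw [← Complex.normSq_eq_norm_sq, ← im_SL_smul, Complex.norm_exp]
    congr 1
    rw [← UpperHalfPlane.coe_im]
    simp
  rw [h2]
  gcongr
  exact mul_le_of_le_one_left (by positivity) h1

lemma norm_conj_exp (m : ℕ) (z : ℍ) :
    ‖(starRingEnd ℂ) (Complex.exp (2 * Real.pi * Complex.I * m * (z : ℂ)))‖
      = Real.exp (-(2 * Real.pi * m * z.im)) := by
  rw [RCLike.norm_conj, Complex.norm_exp]
  congr 1
  rw [← UpperHalfPlane.coe_im]
  simp

lemma norm_pairTerm_le {k m : ℕ} (hk : 3 ≤ k) (hm : 0 < m) (q : ℕ) (χ : DirichletCharacter ℂ q)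
    {γ : SL(2, ℤ)} (hc : 0 < γ 1 0) (z : ℍ) :
    ‖pairTerm k m q χ γ z‖ ≤ (γ 1 0 : ℝ) ^ (-(5 / 2) : ℝ) *
      majorant m (γ 1 1 / γ 1 0) (realCoord z) := by
  have hcR : (1 : ℝ) ≤ (γ 1 0 : ℝ) := by exact_mod_cast hc
  have hc0 : (0 : ℝ) < (γ 1 0 : ℝ) := by linarith
  have hcC : ((γ 1 0 : ℤ) : ℂ) ≠ 0 := by exact_mod_cast hc.ne'
  have hy := z.im_pos
  set R : ℝ := ‖((z.re + γ 1 1 / γ 1 0 : ℝ) : ℂ) + z.im * Complex.I‖ with hR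
  have hQ : ‖(γ 1 0 : ℂ) * z + (γ 1 1 : ℂ)‖ = (γ 1 0 : ℝ) * R := by
    have e : (γ 1 0 : ℂ) * z + (γ 1 1 : ℂ)
        = ((γ 1 0 : ℝ) : ℂ) * (((z.re + γ 1 1 / γ 1 0 : ℝ) : ℂ) + z.im * Complex.I) := by
      have hz : (z : ℂ) = z.re + z.im * Complex.I := (Complex.re_add_im _).symm
      rw [hz]
      push_cast
      field_simp
      ring
    rw [e, norm_mul, Complex.norm_real, Real.norm_of_nonneg hc0.le]
  have h1 := norm_poincareTerm_le k m q χ γ z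
  rw [hQ] at h1
  have hRy : z.im ≤ R := le_norm_add_mul_I _ _
  have hR0 : 0 < R := hy.trans_le hRy
  have h2 := inv_pow_mul_exp_mul_pow_le hcR hy hRy hk
  have h3 : Real.exp (-(2 * Real.pi * m * (z.im / ((γ 1 0 : ℝ) * R) ^ 2)))
      ≤ Real.exp (-(z.im / ((γ 1 0 : ℝ) * R) ^ 2)) := by
    apply Real.exp_le_exp.2
    have hm1 : (1 : ℝ) ≤ m := by exact_mod_cast hm
    have : (1 : ℝ) ≤ 2 * Real.pi * m := by nlinarith [Real.pi_gt_three]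
    have h4 : 0 ≤ z.im / ((γ 1 0 : ℝ) * R) ^ 2 := by positivity
    nlinarith
  have hRsq : R ^ 2 = (z.re + γ 1 1 / γ 1 0) ^ 2 + z.im ^ 2 := normSq_add_mul_I' _ _
  rw [pairTerm, norm_mul, norm_mul, norm_conj_exp, Complex.norm_real,
    Real.norm_of_nonneg (by positivity), majorant, realCoord]
  simp only
  rw [← hRsq]
  calc Real.exp (-(2 * Real.pi * m * z.im)) * ‖poincareTerm k m q χ z γ‖ * z.im ^ k
      ≤ Real.exp (-(2 * Real.pi * m * z.im)) * ((((γ 1 0 : ℝ) * R) ^ k)⁻¹ *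
          Real.exp (-(z.im / ((γ 1 0 : ℝ) * R) ^ 2))) * z.im ^ k := by
        gcongr
        exact h1.trans (by gcongr)
    _ = Real.exp (-(2 * Real.pi * m * z.im)) * ((((γ 1 0 : ℝ) * R) ^ k)⁻¹ *
          Real.exp (-(z.im / ((γ 1 0 : ℝ) * R) ^ 2)) * z.im ^ k) := by ring
    _ ≤ Real.exp (-(2 * Real.pi * m * z.im)) * ((γ 1 0 : ℝ) ^ (-(5 / 2) : ℝ) *
          (z.im ^ (9 / 4 : ℝ) * (R ^ 2)⁻¹)) := by gcongr
    _ = _ := by ring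

lemma integrable_majorant_realCoord {m : ℝ} (hm : 0 < m) (s : ℝ) :
    Integrable (fun z : ℍ => majorant m s (realCoord z)) ∧
    ∫ z : ℍ, majorant m s (realCoord z) = majorantMass m := by
  have hco : ∀ {x y : ℝ}, 0 < y → realCoord (ofCoord (x, y)) = (x, y) := by
    intro x y hy
    rw [realCoord, im_ofCoord hy, ← UpperHalfPlane.coe_re, coe_ofCoord hy]
    simp
  have h1 : IntegrableOn (fun z : ℍ => majorant m s (realCoord z)) (reSet univ) := by
    rw [integrableOn_reSet_iff MeasurableSet.univ, Measure.restrict_univ]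
    refine (integrable_majorant hm s).congr ?_
    have : ∀ᵐ p : ℝ × ℝ ∂(volume.prod (volume.restrict (Ioi 0))), 0 < p.2 := by
      have h := (Measure.quasiMeasurePreserving_snd (μ := (volume : Measure ℝ))
        (ν := (volume : Measure ℝ).restrict (Ioi 0))).ae (ae_restrict_mem measurableSet_Ioi)
      exact h
    filter_upwards [this] with p hp
    obtain ⟨x, y⟩ := p
    simp only [smul_eq_mul, hco hp]
  have h2 := setIntegral_reSet MeasurableSet.univ h1
  rw [reSet_univ, integrableOn_univ] at h1
  rw [reSet_univ, setIntegral_univ] at h2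
  refine ⟨h1, h2.trans ?_⟩
  rw [majorantMass]
  refine setIntegral_congr_fun measurableSet_Ioi fun y hy => ?_
  have hy : 0 < y := hy
  simp only [smul_eq_mul, hco hy, Measure.restrict_univ]
  rw [← (integral_majorant m s hy).2, integral_const_mul]

lemma integrable_pairTerm {k m : ℕ} (hk : 3 ≤ k) (hm : 0 < m) (q : ℕ)
    (χ : DirichletCharacter ℂ q) {γ : SL(2, ℤ)} (hc : 0 < γ 1 0) :
    Integrable (pairTerm k m q χ γ) ∧
    ∫ z, ‖pairTerm k m q χ γ z‖ ≤ (γ 1 0 : ℝ) ^ (-(5 / 2) : ℝ) * majorantMass m := by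
  have hm' : (0 : ℝ) < m := by exact_mod_cast hm
  obtain ⟨h1, h2⟩ := integrable_majorant_realCoord hm' (γ 1 1 / γ 1 0)
  have h3 := h1.const_mul ((γ 1 0 : ℝ) ^ (-(5 / 2) : ℝ))
  have hi : Integrable (pairTerm k m q χ γ) :=
    h3.mono' (continuous_pairTerm k m q χ γ).aestronglyMeasurable
      (Filter.Eventually.of_forall (norm_pairTerm_le hk hm q χ hc))
  refine ⟨hi, ?_⟩
  rw [← h2, ← integral_const_mul]
  exact integral_mono hi.norm h3 (norm_pairTerm_le hk hm q χ hc)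

end PoincareMoment

end


open scoped MatrixGroups ContDiff UpperHalfPlane

noncomputable section

namespace PoincareMoment

open MeasureTheory Set

/-! ### The integrals of the terms -/

lemma conj_exp_eq (m : ℕ) (z : ℍ) :
    (starRingEnd ℂ) (Complex.exp (2 * Real.pi * Complex.I * m * (z : ℂ)))
      = (Real.exp (-(4 * Real.pi * m * z.im)) : ℝ) *
        Complex.exp (-(2 * Real.pi * Complex.I * m * (z : ℂ))) := by
  rw [← Complex.exp_conj, Complex.ofReal_exp, ← Complex.exp_add]
  congr 1
  simp only [map_mul, Complex.conj_ofReal, Complex.conj_I, map_natCast, map_ofNat]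
  have hz : (z : ℂ) = z.re + z.im * Complex.I := (Complex.re_add_im _).symm
  rw [hz]
  simp only [map_add, map_mul, Complex.conj_ofReal, Complex.conj_I]
  push_cast
  linear_combination (4 * Real.pi * m * z.im : ℂ) * Complex.I_sq

/-- The shifted integrand of the archimedean integral. -/
def lineIntegrand (n : ℕ) (m c y : ℝ) (x : ℝ) : ℂ :=
  ((c * (x + y * Complex.I) : ℂ) ^ (2 + n))⁻¹ *
    Complex.exp (-(2 * Real.pi * Complex.I * m / (c ^ 2 * (x + y * Complex.I)))) *
    Complex.exp (-(2 * Real.pi * Complex.I * m * (x + y * Complex.I)))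

/-- Since γz = a/c − 1/(c²(z + d/c)), shifting x by d/c separates the arithmetic phase e(m(a + d)/c)
from an integrand depending only on c. -/
lemma pairTerm_ofCoord (n m q : ℕ) (χ : DirichletCharacter ℂ q) {γ : SL(2, ℤ)}
    (hc : 0 < γ 1 0) {x y : ℝ} (hy : 0 < y) :
    pairTerm (2 + n) m q χ γ (ofCoord (x, y)) =
      ((y ^ (2 + n) * Real.exp (-(4 * Real.pi * m * y)) : ℝ) : ℂ) *
      ((starRingEnd ℂ) (χ ((γ 1 1 : ℤ) : ZMod q)) *
        eChar (m * (γ 0 0 + γ 1 1 : ℤ) / (γ 1 0 : ℤ))) *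
      lineIntegrand n m (γ 1 0) y (x + γ 1 1 / γ 1 0) := by
  have hcC : ((γ 1 0 : ℤ) : ℂ) ≠ 0 := by exact_mod_cast hc.ne'
  have hz' := add_mul_I_ne_zero (x + γ 1 1 / γ 1 0) hy
  set w : ℂ := ((x + γ 1 1 / γ 1 0 : ℝ) : ℂ) + y * Complex.I with hw
  have hden : (γ 1 0 : ℂ) * (ofCoord (x, y) : ℂ) + (γ 1 1 : ℂ) = (γ 1 0 : ℂ) * w := by
    rw [coe_ofCoord hy, hw]
    push_cast
    field_simp
    ring
  have hzw : (ofCoord (x, y) : ℂ) = w - (γ 1 1 : ℂ) / (γ 1 0 : ℂ) := by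
    rw [coe_ofCoord hy, hw]
    push_cast
    ring
  rw [pairTerm, poincareTerm, conj_exp_eq, im_ofCoord hy, coe_SL_smul_eq hc.ne', hden, hzw, zpow_neg,
    zpow_natCast, lineIntegrand, eChar, ← hw]
  have e : Complex.exp (-(2 * Real.pi * Complex.I * m * (w - (γ 1 1 : ℂ) / (γ 1 0 : ℂ)))) *
      Complex.exp (2 * Real.pi * Complex.I * m * ((γ 0 0 : ℂ) / (γ 1 0 : ℂ)
        - 1 / ((γ 1 0 : ℂ) * ((γ 1 0 : ℂ) * w))))
      = Complex.exp (2 * Real.pi * Complex.I *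
          ((m * (γ 0 0 + γ 1 1 : ℤ) / (γ 1 0 : ℤ) : ℝ) : ℂ)) *
        Complex.exp (-(2 * Real.pi * Complex.I * (m : ℝ) / (((γ 1 0 : ℝ) : ℂ) ^ 2 * w))) *
        Complex.exp (-(2 * Real.pi * Complex.I * (m : ℝ) * w)) := by
    rw [← Complex.exp_add, ← Complex.exp_add, ← Complex.exp_add]
    congr 1
    push_cast
    field_simp
    ring
  push_cast at e ⊢
  linear_combination (y ^ (2 + n) * Complex.exp (-(4 * Real.pi * m * y))) *
    (starRingEnd ℂ) (χ ((γ 1 1 : ℤ) : ZMod q)) * (((γ 1 0 : ℂ) * w) ^ (2 + n))⁻¹ * e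

/-- The determinant gives ad ≡ 1 modulo c, so a + d is the trace d + d⁻¹. -/
lemma eChar_resTrace {c d : ℕ} (hd : d ∈ unitRes c) {γ : SL(2, ℤ)} (h0 : γ 1 0 = c) (h1 : γ 1 1 = d)
    (m : ℕ) : eChar (m * (γ 0 0 + γ 1 1 : ℤ) / (γ 1 0 : ℤ)) = eChar (m * resTrace c d / c) := by
  obtain ⟨hlt, hcop⟩ := mem_unitRes.1 hd
  have hc0 : c ≠ 0 := by omega
  have : NeZero c := ⟨hc0⟩
  have hdet := γ.det_coe
  rw [Matrix.det_fin_two, h0, h1] at hdet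
  have hz : ((γ 0 0 : ℤ) : ZMod c) * (d : ZMod c) = 1 := by
    have := congrArg (Int.cast : ℤ → ZMod c) hdet
    push_cast at this
    simpa using this
  have hinv : ((γ 0 0 : ℤ) : ZMod c) = (d : ZMod c)⁻¹ := by
    have h2 := ZMod.coe_mul_inv_eq_one d hcop
    calc ((γ 0 0 : ℤ) : ZMod c) = (γ 0 0 : ℤ) * ((d : ZMod c) * (d : ZMod c)⁻¹) := by rw [h2, mul_one]
      _ = (d : ZMod c)⁻¹ := by rw [← mul_assoc, hz, one_mul]
  have hcong : ((γ 0 0 + γ 1 1 : ℤ) : ZMod c) = ((resTrace c d : ℤ) : ZMod c) := by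
    rw [resTrace, h1]
    push_cast
    rw [hinv, ZMod.natCast_zmod_val]
    ring
  rw [ZMod.intCast_eq_intCast_iff_dvd_sub] at hcong
  obtain ⟨t, ht⟩ := hcong
  have hcR : (c : ℝ) ≠ 0 := by exact_mod_cast hc0
  have e : (m : ℝ) * resTrace c d / c = m * (γ 0 0 + γ 1 1 : ℤ) / (γ 1 0 : ℤ) + ((m * t : ℤ) : ℝ) := by
    have ht' : (resTrace c d : ℝ) = ((γ 0 0 + γ 1 1 : ℤ) : ℝ) + c * t := by
      have := congrArg (Int.cast : ℤ → ℝ) ht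
      push_cast at this ⊢
      linarith
    rw [ht', h0]
    push_cast
    field_simp
  rw [e, eChar_add, eChar_intCast, mul_one]

/-- The square of the normalizing factor. -/
def normFactor (k m : ℕ) : ℝ := Real.Gamma ((k : ℝ) - 1) / (4 * Real.pi * m) ^ ((k : ℝ) - 1)

lemma normFactor_pos {k m : ℕ} (hk : 2 ≤ k) (hm : 0 < m) : 0 < normFactor k m := by
  have hk' : (2 : ℝ) ≤ k := by exact_mod_cast hk
  have hm' : (0 : ℝ) < m := by exact_mod_cast hm
  have := Real.Gamma_pos_of_pos (show (0 : ℝ) < (k : ℝ) - 1 by linarith)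
  have := Real.pi_pos
  unfold normFactor
  positivity

lemma integral_pow_mul_exp (n : ℕ) {m : ℕ} (hm : 0 < m) :
    ∫ y in Ioi (0 : ℝ), (y ^ 2)⁻¹ * (y ^ (2 + n) * Real.exp (-(4 * Real.pi * m * y)))
      = normFactor (2 + n) m := by
  have hm' : (0 : ℝ) < m := by exact_mod_cast hm
  have hpi := Real.pi_pos
  have h := Real.integral_rpow_mul_exp_neg_mul_Ioi (a := (n : ℝ) + 1) (r := 4 * Real.pi * m)
    (by positivity) (by positivity)
  have e : (((2 + n : ℕ) : ℝ) - 1) = n + 1 := by push_cast; ring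
  rw [normFactor, e, div_eq_mul_inv, mul_comm (Real.Gamma _), ← Real.inv_rpow (by positivity), ← one_div, ← h]
  refine setIntegral_congr_fun measurableSet_Ioi fun y hy => ?_
  have hy : 0 < y := hy
  simp only [add_sub_cancel_right, Real.rpow_natCast]
  rw [pow_add]
  field_simp

/-- The integral over each horizontal line does not depend on its height. The remaining integral
over y is therefore the same Gamma integral for every γ, and it is the one in the normalization. -/
lemma integral_pairTerm (n : ℕ) {m : ℕ} (hm : 0 < m) {q : ℕ} (χ : DirichletCharacter ℂ q)
    {γ : SL(2, ℤ)} (hc : 0 < γ 1 0) (hi : Integrable (pairTerm (2 + n) m q χ γ)) :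
    ∫ z, pairTerm (2 + n) m q χ γ z = normFactor (2 + n) m *
      ((starRingEnd ℂ) (χ ((γ 1 1 : ℤ) : ZMod q)) *
        eChar (m * (γ 0 0 + γ 1 1 : ℤ) / (γ 1 0 : ℤ)) *
      (-(2 * Complex.I) * (-1) ^ (n + 1) *
        (1 / (γ 1 0 : ℂ) * besselInt (n + 1) (4 * Real.pi * m / (γ 1 0 : ℤ))))) := by
  have h := setIntegral_reSet MeasurableSet.univ (f := pairTerm (2 + n) m q χ γ)
    (by rw [reSet_univ]; exact hi.integrableOn)
  rw [reSet_univ, setIntegral_univ] at h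
  rw [h, ← integral_pow_mul_exp n hm, ← integral_complex_ofReal, ← integral_mul_const]
  refine setIntegral_congr_fun measurableSet_Ioi fun y hy => ?_
  have hy : 0 < y := hy
  have hcR : (0 : ℝ) < (γ 1 0 : ℤ) := by exact_mod_cast hc
  have hm' : (0 : ℝ) ≤ m := by positivity
  simp only [Measure.restrict_univ, pairTerm_ofCoord n m q χ hc hy]
  rw [integral_const_mul, integral_add_right_eq_self (lineIntegrand n m (γ 1 0) y)]
  have := integral_inv_pow_mul_exp_mul_exp hy hm' hcR n
  simp only [lineIntegrand]
  rw [this, Complex.real_smul]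
  push_cast
  ring

lemma pairTerm_one (k m q : ℕ) (χ : DirichletCharacter ℂ q) (z : ℍ) :
    pairTerm k m q χ 1 z = ((z.im ^ k * Real.exp (-(4 * Real.pi * m * z.im)) : ℝ) : ℂ) := by
  rw [pairTerm, poincareTerm, conj_exp_eq]
  simp only [one_smul, Matrix.SpecialLinearGroup.coe_one, Matrix.one_apply_eq, Int.cast_one, map_one]
  rw [Matrix.one_apply_ne (by decide)]
  have e : Complex.exp (-(2 * Real.pi * Complex.I * m * (z : ℂ))) *
      Complex.exp (2 * Real.pi * Complex.I * m * (z : ℂ)) = 1 := by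
    rw [← Complex.exp_add]; simp
  push_cast
  simp only [zero_mul, zero_add, one_zpow, one_mul]
  linear_combination (Complex.exp (-(4 * Real.pi * m * z.im)) * z.im ^ k) * e

lemma integral_pairTerm_one (n : ℕ) {m : ℕ} (hm : 0 < m) {q : ℕ} (χ : DirichletCharacter ℂ q) :
    IntegrableOn (pairTerm (2 + n) m q χ 1) strip ∧
    ∫ z in strip, pairTerm (2 + n) m q χ 1 z = normFactor (2 + n) m := by
  have hm' : (0 : ℝ) < m := by exact_mod_cast hm
  have hpi := Real.pi_pos
  have hint : IntegrableOn (fun y : ℝ => (y ^ 2)⁻¹ * (y ^ (2 + n) * Real.exp (-(4 * Real.pi * m * y))))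
      (Ioi 0) := by
    -- A nonintegrable function would have integral 0 by convention, whereas the known value is
    -- positive.
    by_contra h
    have h1 := integral_undef h
    rw [integral_pow_mul_exp n hm] at h1
    exact (normFactor_pos (by omega) hm).ne' h1
  have hI : IntegrableOn (pairTerm (2 + n) m q χ 1) strip := by
    rw [strip_eq_reSet, integrableOn_reSet_iff measurableSet_Ico]
    have h1 : Integrable (fun p : ℝ × ℝ => (1 : ℂ) * (((p.2 ^ 2)⁻¹ * (p.2 ^ (2 + n) *
        Real.exp (-(4 * Real.pi * m * p.2))) : ℝ) : ℂ))
        ((volume.restrict (Ico (-(1 / 2) : ℝ) (1 / 2))).prod (volume.restrict (Ioi 0))) :=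
      Integrable.mul_prod (f := fun _ : ℝ => (1 : ℂ))
        (integrableOn_const (by simp) (by simp)) hint.ofReal
    refine h1.congr ?_
    have : ∀ᵐ p : ℝ × ℝ ∂((volume.restrict (Ico (-(1 / 2) : ℝ) (1 / 2))).prod
        (volume.restrict (Ioi 0))), 0 < p.2 :=
      (Measure.quasiMeasurePreserving_snd (μ := (volume : Measure ℝ).restrict _)
        (ν := (volume : Measure ℝ).restrict (Ioi 0))).ae (ae_restrict_mem measurableSet_Ioi)
    filter_upwards [this] with p hp
    obtain ⟨x, y⟩ := p
    simp only [pairTerm_one, im_ofCoord hp, Complex.real_smul]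
    push_cast
    ring
  refine ⟨hI, ?_⟩
  rw [strip_eq_reSet, setIntegral_reSet measurableSet_Ico (strip_eq_reSet ▸ hI),
    ← integral_pow_mul_exp n hm, ← integral_complex_ofReal]
  refine setIntegral_congr_fun measurableSet_Ioi fun y hy => ?_
  have hy : 0 < y := hy
  simp only [pairTerm_one, im_ofCoord hy]
  rw [setIntegral_const, Real.volume_real_Ico_of_le (by norm_num)]
  norm_num

end PoincareMoment

end


open scoped MatrixGroups ContDiff UpperHalfPlane

noncomputable section

namespace PoincareMoment

open MeasureTheory Set

/-! ### The Petersson formula -/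

lemma apply_cosetRep_mk {q : ℕ} {α : Type*} {F : SL(2, ℤ) → α}
    (hF : ∀ δ ∈ GammaInf, ∀ g, F (δ * g) = F g) (g : CongruenceSubgroup.Gamma0 q) :
    F (cosetRep (Quotient.mk _ g : CosetsInf q)) = F g := by
  have h2 := (mk_eq_iff _ _).1 (Quotient.out_eq (Quotient.mk _ g : CosetsInf q)).symm
  have h3 := hF _ h2 g
  rw [← h3]
  simp only [inv_mul_cancel_right]
  rfl

/-- Right multiplication on the cosets. -/
def cosetMulRight {q : ℕ} (γ : CongruenceSubgroup.Gamma0 q) (i : CosetsInf q) : CosetsInf q :=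
  Quotient.mk _ (i.out * γ)

lemma cosetMulRight_bijective {q : ℕ} (γ : CongruenceSubgroup.Gamma0 q) :
    Function.Bijective (cosetMulRight γ) := by
  constructor
  · intro i j hij
    have h := (mk_eq_iff _ _).1 hij
    apply cosetRep_eq_of_mem
    simpa [mul_assoc, cosetRep] using h
  · intro j
    refine ⟨Quotient.mk _ (j.out * γ⁻¹), ?_⟩
    rw [cosetMulRight]
    conv_rhs => rw [← Quotient.out_eq j]
    have h := (mk_eq_iff _ _).1 (Quotient.out_eq (Quotient.mk _ (j.out * γ⁻¹) : CosetsInf q))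
    rw [mk_eq_iff]
    simpa [mul_assoc] using h

lemma poincareTerm_mul (k m q : ℕ) (χ : DirichletCharacter ℂ q) (δ : SL(2, ℤ)) {γ : SL(2, ℤ)}
    (hδ : δ ∈ CongruenceSubgroup.Gamma0 q) (z : ℍ) :
    poincareTerm k m q χ z (δ * γ) = poincareTerm k m q χ (γ • z) δ *
      ((starRingEnd ℂ) (χ ((γ 1 1 : ℤ) : ZMod q)) *
        ((γ 1 0 : ℂ) * z + (γ 1 1 : ℂ)) ^ (-(k : ℤ))) := by
  rw [CongruenceSubgroup.Gamma0_mem] at hδ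
  have e0 : (δ * γ) 1 0 = δ 1 0 * γ 0 0 + δ 1 1 * γ 1 0 := by
    rw [Matrix.SpecialLinearGroup.coe_mul, Matrix.mul_apply, Fin.sum_univ_two]
  have e1 : (δ * γ) 1 1 = δ 1 0 * γ 0 1 + δ 1 1 * γ 1 1 := by
    rw [Matrix.SpecialLinearGroup.coe_mul, Matrix.mul_apply, Fin.sum_univ_two]
  have hd := denom_ne_zero' γ z
  have hj : ((δ * γ) 1 0 : ℂ) * z + ((δ * γ) 1 1 : ℂ)
      = ((δ 1 0 : ℂ) * ((γ • z : ℍ) : ℂ) + (δ 1 1 : ℂ)) * ((γ 1 0 : ℂ) * z + (γ 1 1 : ℂ)) := by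
    rw [e0, e1, UpperHalfPlane.coe_specialLinearGroup_apply]
    simp only [algebraMap_int_eq, eq_intCast, Complex.ofReal_intCast]
    push_cast
    field_simp
    ring
  rw [poincareTerm, poincareTerm, hj, mul_zpow, mul_smul, e1]
  push_cast
  rw [hδ, zero_mul, zero_add, map_mul, map_mul]
  ring

lemma poincareSeries_eq (k m q : ℕ) (χ : DirichletCharacter ℂ q) (z : ℍ) :
    poincareSeries k m q χ z = ∑' i : CosetsInf q, poincareTerm k m q χ z (cosetRep i) := rfl

/-- Right multiplication by γ permutes the cosets. Reindexing a `tsum` and extracting a scalar need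
no summability, so the identity holds at every z. -/
lemma poincareSeries_smul {k m q : ℕ} {χ : DirichletCharacter ℂ q} (hχ : χ (-1) = (-1) ^ k)
    {γ : SL(2, ℤ)} (hγ : γ ∈ CongruenceSubgroup.Gamma0 q) (z : ℍ) :
    poincareSeries k m q χ z = poincareSeries k m q χ (γ • z) *
      ((starRingEnd ℂ) (χ ((γ 1 1 : ℤ) : ZMod q)) *
        ((γ 1 0 : ℂ) * z + (γ 1 1 : ℂ)) ^ (-(k : ℤ))) := by
  have hF : ∀ δ ∈ GammaInf, ∀ g, poincareTerm k m q χ z (δ * g) = poincareTerm k m q χ z g :=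
    fun δ hδ g => poincareTerm_mul_left k m q χ hχ z δ g hδ
  have h1 : ∀ i : CosetsInf q, poincareTerm k m q χ z (cosetRep (cosetMulRight ⟨γ, hγ⟩ i))
      = poincareTerm k m q χ (γ • z) (cosetRep i) *
      ((starRingEnd ℂ) (χ ((γ 1 1 : ℤ) : ZMod q)) *
        ((γ 1 0 : ℂ) * z + (γ 1 1 : ℂ)) ^ (-(k : ℤ))) := by
    intro i
    have h2 := apply_cosetRep_mk hF (i.out * ⟨γ, hγ⟩)
    have h3 := poincareTerm_mul k m q χ (cosetRep i) (γ := γ) (cosetRep_mem i) z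
    rw [cosetMulRight, h2, ← h3]
    rfl
  have h4 : ∑' i : CosetsInf q, poincareTerm k m q χ z (cosetRep (cosetMulRight ⟨γ, hγ⟩ i))
      = ∑' i : CosetsInf q, poincareTerm k m q χ z (cosetRep i) :=
    (Equiv.ofBijective _ (cosetMulRight_bijective ⟨γ, hγ⟩)).tsum_eq
      fun i : CosetsInf q => poincareTerm k m q χ z (cosetRep i)
  rw [poincareSeries_eq, poincareSeries_eq, ← h4, ← tsum_mul_right]
  exact tsum_congr h1

/-- The integrand of the unfolded Petersson product. -/
def unfolded (k m q : ℕ) (χ : DirichletCharacter ℂ q) (z : ℍ) : ℂ :=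
  (starRingEnd ℂ) (Complex.exp (2 * Real.pi * Complex.I * m * (z : ℂ))) *
    poincareSeries k m q χ z * ((z.im ^ k : ℝ) : ℂ)

lemma norm_apply_Gamma0 {q : ℕ} (χ : DirichletCharacter ℂ q) {γ : SL(2, ℤ)}
    (hγ : γ ∈ CongruenceSubgroup.Gamma0 q) :
    χ ((γ 1 1 : ℤ) : ZMod q) * (starRingEnd ℂ) (χ ((γ 1 1 : ℤ) : ZMod q)) = 1 := by
  rw [CongruenceSubgroup.Gamma0_mem] at hγ
  have hdet := γ.det_coe
  rw [Matrix.det_fin_two] at hdet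
  have h1 := congrArg (Int.cast : ℤ → ZMod q) hdet
  push_cast at h1
  rw [hγ, mul_zero, sub_zero] at h1
  have hu : IsUnit ((γ 1 1 : ℤ) : ZMod q) := IsUnit.of_mul_eq_one_right _ h1
  obtain ⟨u, hu⟩ := hu
  rw [← hu, Complex.mul_conj, Complex.normSq_eq_norm_sq, χ.unit_norm_eq_one u]
  norm_num

/-- The factor |cz + d|^{−2k} from the height and |χ(d)| = 1 leave the conjugate of one term of the
series. Summed over cosets these terms rebuild the conjugate of P, hence |P|²y^k. -/
lemma unfolded_smul {k m q : ℕ} {χ : DirichletCharacter ℂ q} (hχ : χ (-1) = (-1) ^ k)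
    {γ : SL(2, ℤ)} (hγ : γ ∈ CongruenceSubgroup.Gamma0 q) (z : ℍ) :
    unfolded k m q χ (γ • z) = (starRingEnd ℂ) (poincareTerm k m q χ z γ) *
      (poincareSeries k m q χ z * ((z.im ^ k : ℝ) : ℂ)) := by
  rw [poincareSeries_smul hχ hγ z, unfolded, poincareTerm, im_SL_smul]
  simp only [map_mul, Complex.conj_conj, map_zpow₀]
  have hd := denom_ne_zero' γ z
  have h1 := norm_apply_Gamma0 χ hγ
  rw [div_pow]
  set j : ℂ := (γ 1 0 : ℂ) * z + (γ 1 1 : ℂ) with hj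
  have h2 : ((Complex.normSq j ^ k : ℝ) : ℂ)⁻¹ = (starRingEnd ℂ) j ^ (-(k : ℤ)) * j ^ (-(k : ℤ)) := by
    rw [← mul_zpow, mul_comm ((starRingEnd ℂ) j), Complex.mul_conj, zpow_neg, zpow_natCast]
    push_cast
    rfl
  rw [Complex.ofReal_div, div_eq_mul_inv, h2]
  linear_combination (-(starRingEnd ℂ) j ^ (-(k : ℤ)) * (starRingEnd ℂ)
    (Complex.exp (2 * Real.pi * Complex.I * m * ((γ • z : ℍ) : ℂ))) *
    poincareSeries k m q χ (γ • z) * j ^ (-(k : ℤ)) * ((z.im ^ k : ℝ) : ℂ)) * h1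

lemma tsum_unfolded_smul {k m q : ℕ} {χ : DirichletCharacter ℂ q} (hχ : χ (-1) = (-1) ^ k) (z : ℍ) :
    ∑' i : CosetsInf q, unfolded k m q χ (cosetRep i • z)
      = ((‖poincareSeries k m q χ z‖ ^ 2 * z.im ^ k : ℝ) : ℂ) := by
  simp only [unfolded_smul hχ (cosetRep_mem _)]
  rw [tsum_mul_right, ← Complex.conj_tsum]
  change (starRingEnd ℂ) (poincareSeries k m q χ z) * _ = _
  rw [← mul_assoc, mul_comm ((starRingEnd ℂ) _), Complex.mul_conj, Complex.normSq_eq_norm_sq]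
  push_cast
  rfl

lemma unfolded_T_zpow_smul {k m q : ℕ} {χ : DirichletCharacter ℂ q} (hχ : χ (-1) = (-1) ^ k)
    (n : ℤ) (z : ℍ) : unfolded k m q χ (ModularGroup.T ^ n • z) = unfolded k m q χ z := by
  have h := poincareSeries_smul (m := m) hχ (T_zpow_mem_Gamma0 q n) z
  rw [unfolded, unfolded, exp_T_zpow_smul, ModularGroup.im_T_zpow_smul, h]
  simp [ModularGroup.coe_T_zpow]

lemma unfolded_eq_tsum {k m q : ℕ} (hq : 0 < q) {χ : DirichletCharacter ℂ q}
    (hχ : χ (-1) = (-1) ^ k) (z : ℍ) :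
    unfolded k m q χ z = ∑' j : Option (Residues q × ℤ), pairTerm k m q χ (indexRep j) z := by
  rw [unfolded, poincareSeries, ← tsum_mul_left, ← tsum_mul_right, ← (indexEquiv hq).tsum_eq]
  refine tsum_congr fun j => ?_
  exact apply_cosetRep_indexEquiv hq (F := fun g => pairTerm k m q χ g z)
    (fun δ hδ g => by rw [pairTerm, pairTerm, poincareTerm_mul_left k m q χ hχ z δ g hδ]) j

lemma residueRep_mem {q : ℕ} (b : Residues q) : residueRep b ∈ CongruenceSubgroup.Gamma0 q := by
  have := indexRep_mem (some (b, 0))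
  simpa [indexRep] using this

lemma residueRep_pos {q : ℕ} (hq : 0 < q) (b : Residues q) : 0 < residueRep b 1 0 := by
  rw [residueRep_one_zero]
  exact_mod_cast Nat.mul_pos hq (Nat.succ_pos _)

lemma pairTerm_indexRep_some {k m q : ℕ} (χ : DirichletCharacter ℂ q) (b : Residues q) (l : ℤ) :
    pairTerm k m q χ (indexRep (some (b, l)))
      = fun z => pairTerm k m q χ (residueRep b) (ModularGroup.T ^ l • z) := by
  funext z
  rw [indexRep, pairTerm_mul_T_zpow k m q χ (residueRep_mem b)]

/-- There are at most c residues for each modulus c = q(n + 1), and the sum of c·c^{−5/2} converges.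
-/
lemma summable_residues {q : ℕ} (hq : 0 < q) {K : ℝ} {f : Residues q → ℝ} (hf : ∀ b, 0 ≤ f b)
    (h : ∀ b : Residues q, f b ≤ (residueRep b 1 0 : ℝ) ^ (-(5 / 2) : ℝ) * K) : Summable f := by
  rw [summable_sigma_of_nonneg hf]
  refine ⟨fun n => (hasSum_fintype _).summable, ?_⟩
  have hK : ∀ n : ℕ, ∑' d, f ⟨n, d⟩ ≤ ((n + 1 : ℕ) : ℝ) ^ (-(3 / 2) : ℝ) * |K| := by
    intro n
    have hn0 : (0 : ℝ) < ((n + 1 : ℕ) : ℝ) := by positivity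
    have hc1 : ((n + 1 : ℕ) : ℝ) ≤ ((q * (n + 1) : ℕ) : ℝ) := by
      exact_mod_cast Nat.le_mul_of_pos_left _ hq
    have hc0 := hn0.trans_le hc1
    rw [tsum_fintype]
    calc ∑ d, f ⟨n, d⟩ ≤ ∑ d : {d // d ∈ unitRes (q * (n + 1))},
          ((q * (n + 1) : ℕ) : ℝ) ^ (-(5 / 2) : ℝ) * |K| := by
          refine Finset.sum_le_sum fun d _ => ?_
          have h1 := h ⟨n, d⟩
          rw [residueRep_one_zero, Int.cast_natCast] at h1
          refine h1.trans ?_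
          gcongr
          exact le_abs_self K
      _ = ((unitRes (q * (n + 1))).card : ℝ) * (((q * (n + 1) : ℕ) : ℝ) ^ (-(5 / 2) : ℝ) * |K|) := by
          rw [Finset.sum_const, Finset.card_univ, Fintype.card_coe, nsmul_eq_mul]
      _ ≤ ((q * (n + 1) : ℕ) : ℝ) * (((q * (n + 1) : ℕ) : ℝ) ^ (-(5 / 2) : ℝ) * |K|) := by
          gcongr
          exact (Finset.card_filter_le _ _).trans (by simp)
      _ = ((q * (n + 1) : ℕ) : ℝ) ^ (-(3 / 2) : ℝ) * |K| := by
          rw [← mul_assoc]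
          congr 1
          nth_rewrite 1 [← Real.rpow_one ((q * (n + 1) : ℕ) : ℝ)]
          rw [← Real.rpow_add hc0]
          norm_num
      _ ≤ _ := by
          gcongr ?_ * _
          exact Real.rpow_le_rpow_of_nonpos hn0 hc1 (by norm_num)
  refine Summable.of_nonneg_of_le (fun n => tsum_nonneg fun d => hf _) hK ?_
  refine Summable.mul_right _ ?_
  exact (summable_nat_add_iff 1 (f := fun n : ℕ => (n : ℝ) ^ (-(3 / 2) : ℝ))).2
    (Real.summable_nat_rpow.2 (by norm_num))

/-- The trivial coset gives the diagonal term. For every other class the strip integrals over its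
T-translates recombine into one integral over ℍ. -/
lemma hasSum_unfolded {n m q : ℕ} (hn : 1 ≤ n) (hm : 0 < m) (hq : 0 < q)
    {χ : DirichletCharacter ℂ q} (hχ : χ (-1) = (-1) ^ (2 + n)) :
    IntegrableOn (unfolded (2 + n) m q χ) strip ∧
    ∃ S : ℂ, ∫ z in strip, unfolded (2 + n) m q χ z = normFactor (2 + n) m + S ∧
      HasSum (fun b : Residues q => ∫ z, pairTerm (2 + n) m q χ (residueRep b) z) S := by
  set F : Option (Residues q × ℤ) → ℍ → ℂ := fun j => pairTerm (2 + n) m q χ (indexRep j) with hF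
  obtain ⟨hone, hone'⟩ := integral_pairTerm_one n hm χ
  have hb : ∀ b : Residues q, _ := fun b =>
    integrable_pairTerm (k := 2 + n) (by omega) hm q χ (residueRep_pos hq b)
  have hFi : ∀ j, Integrable (F j) (volume.restrict strip) := by
    rintro (_ | ⟨b, l⟩)
    · exact hone
    · simp only [hF, pairTerm_indexRep_some]
      exact ((measurePreserving_smul (ModularGroup.T ^ l) (volume : Measure ℍ)).integrable_comp_of_integrable
        (hb b).1).integrableOn
  have hT : ∀ b : Residues q, HasSum (fun l : ℤ => ∫ z in strip, ‖F (some (b, l)) z‖)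
      (∫ z, ‖pairTerm (2 + n) m q χ (residueRep b) z‖) := by
    intro b
    simp only [hF, pairTerm_indexRep_some]
    exact hasSum_setIntegral_strip (hb b).1.norm
  have hs1 : Summable fun p : Residues q × ℤ => ∫ z in strip, ‖F (some p) z‖ := by
    rw [summable_prod_of_nonneg (fun p => integral_nonneg fun z => norm_nonneg _)]
    refine ⟨fun b => (hT b).summable, ?_⟩
    simp only [(hT _).tsum_eq]
    exact summable_residues hq (fun b => integral_nonneg fun z => norm_nonneg _) fun b => (hb b).2
  have hs : Summable fun j => ∫ z in strip, ‖F j z‖ := (hasSum_option hs1.hasSum).summable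
  have hi := (ae_summable_norm_and_integrable_tsum hFi hs).2
  have he : (fun z => ∑' j, F j z) = unfolded (2 + n) m q χ :=
    funext fun z => (unfolded_eq_tsum hq hχ z).symm
  have hsum := hasSum_integral_of_summable_integral_norm hFi hs
  rw [he] at hi
  have he' : ∫ z in strip, ∑' j, F j z = ∫ z in strip, unfolded (2 + n) m q χ z := by
    rw [← he]
  rw [he'] at hsum
  have hs2 : Summable fun p : Residues q × ℤ => ∫ z in strip, F (some p) z :=
    hs1.of_norm_bounded fun p => norm_integral_le_integral_norm _
  have hopt := hasSum_option (f := fun j => ∫ z in strip, F j z) hs2.hasSum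
  refine ⟨hi, ∑' p : Residues q × ℤ, ∫ z in strip, F (some p) z, ?_, ?_⟩
  · rw [← hone']
    exact hsum.unique hopt
  · refine hs2.hasSum.prod_fiberwise fun b => ?_
    simp only [hF, pairTerm_indexRep_some]
    exact hasSum_setIntegral_strip (hb b).1

/-- The conjugate character as a function on natural numbers. -/
def conjWeight {q : ℕ} (χ : DirichletCharacter ℂ q) (x : ℕ) : ℂ := (starRingEnd ℂ) (χ (x : ZMod q))

lemma norm_conjWeight_le {q : ℕ} (χ : DirichletCharacter ℂ q) (x : ℕ) : ‖conjWeight χ x‖ ≤ 1 := by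
  rw [conjWeight, RCLike.norm_conj]
  exact χ.norm_le_one _

/-- The Petersson formula for the norm of a Poincaré series. -/
theorem exists_hasSum_petersson {k m q : ℕ} (hk : 3 ≤ k) (hm : 0 < m) (hq : 0 < q)
    {χ : DirichletCharacter ℂ q} (hχ : χ (-1) = (-1) ^ k) :
    ∃ S : ℂ, HasSum (fun n : ℕ => 1 / ((q * (n + 1) : ℕ) : ℂ) *
        kloosterman (conjWeight χ) (q * (n + 1)) m *
        besselInt (k - 1) (4 * Real.pi * m / (q * (n + 1) : ℕ))) S ∧
      |peterssonNormSq k q (normalizedPoincareSeries k m q χ) - 1| = 2 * ‖S‖ := by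
  obtain ⟨n, rfl⟩ := Nat.exists_eq_add_of_le (show 2 ≤ k by omega)
  obtain ⟨hI, S, hS, hsum⟩ := hasSum_unfolded (n := n) (by omega) hm hq hχ
  have hN := normFactor_pos (k := 2 + n) (by omega) hm
  set N := normFactor (2 + n) m with hNdef
  have hNC : (N : ℂ) ≠ 0 := by exact_mod_cast hN.ne'
  -- As `besselInt` is π·i^ν·J_ν, the modulus 2 of κ corresponds to the usual factor 2π of the
  -- Petersson formula.
  set κ : ℂ := -(2 * Complex.I) * (-1) ^ (n + 1) with hκ
  have hκn : ‖κ‖ = 2 := by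
    rw [hκ]
    simp
  have hκ0 : κ ≠ 0 := norm_ne_zero_iff.1 (by rw [hκn]; norm_num)
  have hP : ((∫ z in fordDomain q, ‖poincareSeries (2 + n) m q χ z‖ ^ 2 * z.im ^ (2 + n) : ℝ) : ℂ)
      = N + S := by
    rw [← hS, ← setIntegral_tsum_cosetRep q (unfolded_T_zpow_smul hχ) hI,
      ← integral_complex_ofReal]
    simp only [tsum_unfolded_smul hχ]
  have hnorm : peterssonNormSq (2 + n) q (normalizedPoincareSeries (2 + n) m q χ)
      = N⁻¹ * ∫ z in fordDomain q, ‖poincareSeries (2 + n) m q χ z‖ ^ 2 * z.im ^ (2 + n) := by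
    rw [peterssonNormSq, ← integral_const_mul]
    congr 1
    funext z
    rw [normalizedPoincareSeries, norm_mul, mul_pow, Complex.norm_real]
    change ‖N ^ (-(1 / 2) : ℝ)‖ ^ 2 * _ * _ = _
    rw [Real.norm_of_nonneg (by positivity), ← Real.rpow_natCast, ← Real.rpow_mul hN.le,
      mul_assoc]
    congr 1
    rw [show (-(1 / 2) : ℝ) * (2 : ℕ) = -1 by norm_num, Real.rpow_neg_one]
  have hval : ∀ b : Residues q, ∫ z, pairTerm (2 + n) m q χ (residueRep b) z = N * κ *
      (1 / ((q * (b.1 + 1) : ℕ) : ℂ) * (conjWeight χ b.2 *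
        eChar (m * resTrace (q * (b.1 + 1)) b.2 / (q * (b.1 + 1) : ℕ))) *
        besselInt (n + 1) (4 * Real.pi * m / (q * (b.1 + 1) : ℕ))) := by
    intro b
    rw [integral_pairTerm n hm χ (residueRep_pos hq b) (integrable_pairTerm (k := 2 + n) (by omega)
      hm q χ (residueRep_pos hq b)).1, eChar_resTrace b.2.2 (residueRep_one_zero b)
      (residueRep_one_one b), residueRep_one_zero, residueRep_one_one, conjWeight]
    push_cast
    ring
  have hsum2 : HasSum (fun l : ℕ => N * κ * (1 / ((q * (l + 1) : ℕ) : ℂ) *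
        kloosterman (conjWeight χ) (q * (l + 1)) m *
        besselInt (n + 1) (4 * Real.pi * m / (q * (l + 1) : ℕ)))) S := by
    refine hsum.sigma fun l => ?_
    simp only [hval]
    have h1 : HasSum (fun d : {d // d ∈ unitRes (q * (l + 1))} => N * κ *
      (1 / ((q * (l + 1) : ℕ) : ℂ) * (conjWeight χ d *
        eChar (m * resTrace (q * (l + 1)) d / (q * (l + 1) : ℕ))) *
        besselInt (n + 1) (4 * Real.pi * m / (q * (l + 1) : ℕ)))) _ := hasSum_fintype _
    convert! h1 using 1
    rw [← Finset.mul_sum, ← Finset.sum_mul, ← Finset.mul_sum, kloosterman, ← Finset.sum_coe_sort]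
  refine ⟨(N * κ)⁻¹ * S, ?_, ?_⟩
  · have h2 := hsum2.mul_left ((N * κ)⁻¹)
    convert! h2 using 1
    funext l
    rw [inv_mul_cancel_left₀ (mul_ne_zero hNC hκ0), show 2 + n - 1 = n + 1 by omega]
  · rw [← Real.norm_eq_abs, ← Complex.norm_real, hnorm]
    push_cast
    rw [hP, norm_mul, norm_inv, norm_mul, hκn]
    have : (N : ℂ)⁻¹ * (N + S) - 1 = (N : ℂ)⁻¹ * S := by field_simp; ring
    rw [this, norm_mul, norm_inv]
    field_simp

end PoincareMoment

end


open scoped MatrixGroups ContDiff UpperHalfPlane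

noncomputable section

namespace PoincareMoment

open MeasureTheory Set

/-! ### Splitting the sum over the moduli -/

lemma norm_kloosterman_le {w : ℕ → ℂ} (hw : ∀ x, ‖w x‖ ≤ 1) (c m : ℕ) :
    ‖kloosterman w c m‖ ≤ c := by
  rw [kloosterman]
  refine (norm_sum_le _ _).trans ?_
  calc ∑ x ∈ unitRes c, ‖w x * eChar ((m : ℝ) * resTrace c x / c)‖ ≤ ∑ _x ∈ unitRes c, (1 : ℝ) := by
        refine Finset.sum_le_sum fun x _ => ?_
        rw [norm_mul, norm_eChar, mul_one]
        exact hw x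
    _ = ((unitRes c).card : ℝ) := by simp
    _ ≤ c := by exact_mod_cast (Finset.card_filter_le _ _).trans (by simp)

/-- The value of `∑ 1 / n²`. -/
def sumInvSq : ℝ := ∑' n : ℕ, 1 / ((n + 1 : ℕ) : ℝ) ^ 2

lemma summable_inv_sq : Summable fun n : ℕ => 1 / ((n + 1 : ℕ) : ℝ) ^ 2 :=
  (summable_nat_add_iff 1 (f := fun n : ℕ => 1 / (n : ℝ) ^ 2)).2
    (Real.summable_one_div_nat_pow.2 one_lt_two)

/-- Here 4πm/c ≤ 38M/c ≤ k/5, below the transition range, and the trivial bound |S| ≤ c suffices.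
The constant covers 1000·38². -/
lemma norm_summand_le {w : ℕ → ℂ} (hw : ∀ x, ‖w x‖ ≤ 1) {k q m n : ℕ} (hk : 3 ≤ k) (hq : 0 < q)
    (hn : 0 < n) {M : ℝ} (hM : 0 < M) (hm : (m : ℝ) ≤ 3 * M) (hc : 200 * M ≤ k * (q * n : ℕ)) :
    ‖1 / ((q * n : ℕ) : ℂ) * kloosterman w (q * n) m *
      besselInt (k - 1) (4 * Real.pi * m / (q * n : ℕ))‖
      ≤ 1500000 * M ^ 2 * Real.exp (-k) * (1 / (n : ℝ) ^ 2) := by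
  have hcpos : (0 : ℝ) < (q * n : ℕ) := by exact_mod_cast Nat.mul_pos hq hn
  have hn0 : (0 : ℝ) < n := by exact_mod_cast hn
  have hcn : (n : ℝ) ≤ (q * n : ℕ) := by exact_mod_cast Nat.le_mul_of_pos_left _ hq
  set c : ℝ := ((q * n : ℕ) : ℝ) with hcdef
  set x : ℝ := 4 * Real.pi * m / c with hx
  have hpi := Real.pi_pos
  have hpi' := Real.pi_lt_d2
  have hx0 : 0 ≤ x := by positivity
  have hx1 : x ≤ 38 * M / c := by
    rw [hx]
    refine div_le_div_of_nonneg_right ?_ hcpos.le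
    calc 4 * Real.pi * m ≤ 4 * 3.15 * (3 * M) := by gcongr
      _ ≤ 38 * M := by linarith
  have hkν : ((k - 1 : ℕ) : ℝ) + 1 = k := by
    rw [Nat.cast_sub (by omega)]
    simp
  have hxk : x ≤ (((k - 1 : ℕ) : ℝ) + 1) / 5 := by
    rw [hkν]
    refine hx1.trans ?_
    rw [div_le_div_iff₀ hcpos (by norm_num)]
    linarith
  have hB := norm_besselInt_le_exp (ν := k - 1) (by omega) hx0 hxk
  rw [hkν] at hB
  have hK := norm_kloosterman_le hw (q * n) m
  have h1 : ‖1 / ((q * n : ℕ) : ℂ) * kloosterman w (q * n) m‖ ≤ 1 := by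
    rw [norm_mul, norm_div, norm_one, Complex.norm_natCast, one_div, inv_mul_le_iff₀ hcpos, mul_one]
    exact hK
  rw [norm_mul]
  calc _ ≤ 1 * (1000 * x ^ 2 * Real.exp (-k)) := by gcongr
    _ ≤ 1 * (1000 * (38 * M / n) ^ 2 * Real.exp (-k)) := by
        gcongr
        exact hx1.trans (by gcongr)
    _ = 1444000 * M ^ 2 * Real.exp (-k) * (1 / (n : ℝ) ^ 2) := by
        field_simp
        norm_num
    _ ≤ _ := by
        gcongr
        norm_num

/-- The tail of the sum over the moduli is negligible. -/
theorem norm_le_kloostermanPart_add_tail {w : ℕ → ℂ} (hw : ∀ x, ‖w x‖ ≤ 1) {k q m N : ℕ}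
    (hk : 3 ≤ k) (hq : 0 < q) {M : ℝ} (hM : 0 < M) (hm : (m : ℝ) ≤ 3 * M)
    (hN : 200 * M ≤ k * (q * (N + 1) : ℕ)) {S : ℂ}
    (hS : HasSum (fun n : ℕ => 1 / ((q * (n + 1) : ℕ) : ℂ) * kloosterman w (q * (n + 1)) m *
        besselInt (k - 1) (4 * Real.pi * m / (q * (n + 1) : ℕ))) S) :
    ‖S‖ ≤ ‖kloostermanPart w (k - 1) q m (Finset.Ico 1 (N + 1))‖ +
      1500000 * M ^ 2 * Real.exp (-k) * sumInvSq := by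
  set a : ℕ → ℂ := fun n => 1 / ((q * (n + 1) : ℕ) : ℂ) * kloosterman w (q * (n + 1)) m *
        besselInt (k - 1) (4 * Real.pi * m / (q * (n + 1) : ℕ)) with ha
  rw [← hS.tsum_eq, ← hS.summable.sum_add_tsum_nat_add N]
  refine (norm_add_le _ _).trans ?_
  have h1 : ∑ i ∈ Finset.range N, a i
      = kloostermanPart w (k - 1) q m (Finset.Ico 1 (N + 1)) := by
    rw [kloostermanPart, Finset.sum_Ico_eq_sum_range]
    simp only [ha, Nat.add_sub_cancel, add_comm 1]
  rw [h1]
  gcongr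
  refine tsum_of_norm_bounded (summable_inv_sq.hasSum.mul_left _) fun i => ?_
  refine (norm_summand_le hw hk hq (Nat.succ_pos _) hM hm (hN.trans ?_)).trans ?_
  · gcongr
    omega
  · gcongr
    omega

lemma kloostermanPart_union (w : ℕ → ℂ) (ν q m : ℕ) {a b c : ℕ} (hab : a ≤ b) (hbc : b ≤ c) :
    kloostermanPart w ν q m (Finset.Ico a c) = kloostermanPart w ν q m (Finset.Ico a b) +
      kloostermanPart w ν q m (Finset.Ico b c) := by
  rw [kloostermanPart, kloostermanPart, kloostermanPart, Finset.sum_Ico_consecutive _ hab hbc]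

lemma kloostermanPart_dyadic (w : ℕ → ℂ) (ν q m Y J : ℕ) :
    kloostermanPart w ν q m (Finset.Ico Y (2 ^ J * Y)) = ∑ i ∈ Finset.range J,
      kloostermanPart w ν q m (Finset.Ico (2 ^ i * Y) (2 * (2 ^ i * Y))) := by
  induction J with
  | zero => simp [kloostermanPart]
  | succ J ih =>
    rw [Finset.sum_range_succ, ← ih, kloostermanPart_union w ν q m (b := 2 ^ J * Y)
      (Nat.le_mul_of_pos_left _ (by positivity)) (by gcongr <;> omega), pow_succ']
    congr 3
    ring

lemma sqrt_facts {k q : ℕ} (hk : 3 ≤ k) (hq : 0 < q) {M : ℝ} (hM : 0 < M)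
    (hkq : (k : ℝ) * q ≤ 200 * M) : 1 ≤ √(k : ℝ) ∧ √(k : ℝ) ^ 2 = k ∧ 0 < √M ∧ √M ^ 2 = M ∧
      √(k : ℝ) ≤ 15 * √M := by
  have hk' : (3 : ℝ) ≤ k := by exact_mod_cast hk
  have hq' : (1 : ℝ) ≤ q := by exact_mod_cast hq
  have ha2 : √(k : ℝ) ^ 2 = k := Real.sq_sqrt (by linarith)
  have hb2 : √M ^ 2 = M := Real.sq_sqrt hM.le
  refine ⟨Real.one_le_sqrt.2 (by linarith), ha2, Real.sqrt_pos.2 hM, hb2, ?_⟩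
  refine le_of_sq_le_sq ?_ (by positivity)
  rw [mul_pow, ha2, hb2]
  nlinarith

/-- The moduli here are at most D = √M/(10√k). Up to divisor factors the bound is D²/q², which √k ≤
15√M turns into the first main term. The same inequality gives kD ≤ 2M, the condition for the
oscillatory Bessel bound. -/
lemma sum_norm_sq_kloostermanPart_initial_le {w : ℕ → ℂ} (hw : ∀ x, ‖w x‖ ≤ 1) {k q Y : ℕ}
    (hk : 3 ≤ k) (hq : 0 < q) {M T : ℝ} (hM : 0 < M) (hkq : (k : ℝ) * q ≤ 200 * M)
    (S : Finset ℕ) (hS : ∀ m ∈ S, M / 2 ≤ m ∧ (m : ℝ) ≤ 3 * M)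
    (hY : Y = ⌊√M / (10 * √k) / q⌋₊ + 1) (hT1 : 1 ≤ T) (hH : 1 + Real.log Y ≤ T)
    (hT : ∀ n, 0 < n → n < Y → ((q * n).divisors.card : ℝ) ≤ T) :
    ∑ m ∈ S, ‖kloostermanPart w (k - 1) q m (Finset.Ico 1 Y)‖ ^ 2
      ≤ 9000 * T ^ 5 * M * (√M / (k * √k * q)) := by
  obtain ⟨ha1, ha2, hb0, hb2, hab⟩ := sqrt_facts hk hq hM hkq
  have hq' : (1 : ℝ) ≤ q := by exact_mod_cast hq
  set a : ℝ := √k with ha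
  set b : ℝ := √M with hb
  have ha0 : 0 < a := by linarith
  set D : ℝ := b / (10 * a) with hD
  have hD0 : 0 < D := by positivity
  have hmem : ∀ n ∈ Finset.Ico 1 Y, 0 < n ∧ ((q * n : ℕ) : ℝ) ≤ D := by
    intro n hn
    rw [Finset.mem_Ico] at hn
    refine ⟨hn.1, ?_⟩
    have h1 : n ≤ ⌊D / q⌋₊ := by omega
    have h2 := (Nat.le_floor_iff (by positivity)).1 h1
    rw [le_div_iff₀ (by linarith)] at h2
    push_cast
    linarith
  have hDν' : a ^ 2 * D ≤ 2 * M := by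
    have : a ^ 2 * D = a * b / 10 := by rw [hD]; field_simp
    rw [this, ← hb2]
    nlinarith
  have hDM : D ≤ 3 * M := by
    have : D ≤ a ^ 2 * D := le_mul_of_one_le_left hD0.le (one_le_pow₀ ha1)
    linarith
  have hDν : ((k - 1 : ℕ) : ℝ) * D ≤ 2 * M := by
    refine le_trans ?_ hDν'
    gcongr
    rw [ha2]
    exact_mod_cast Nat.sub_le _ _
  have h := sum_norm_sq_kloostermanPart_small_le hw (ν := k - 1) hq hM S hS (Finset.Ico 1 Y)
    (fun n hn => (hmem n hn).1) (fun n hn => (hmem n hn).2) hDM hDν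
    (fun n hn => hT n (hmem n hn).1 (Finset.mem_Ico.1 hn).2)
  have hharm : ∑ n ∈ Finset.Ico 1 Y, 1 / ((q * n : ℕ) : ℝ) ≤ T / q := by
    have h1 : ∑ n ∈ Finset.Ico 1 Y, 1 / ((q * n : ℕ) : ℝ)
        = (1 / q) * ∑ n ∈ Finset.Ico 1 Y, ((n : ℝ))⁻¹ := by
      rw [Finset.mul_sum]
      refine Finset.sum_congr rfl fun n _ => ?_
      push_cast
      rw [one_div, one_div, mul_inv]
    have h2 : ∑ n ∈ Finset.Ico 1 Y, ((n : ℝ))⁻¹ ≤ 1 + Real.log Y := by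
      have h3 := harmonic_le_one_add_log Y
      rw [harmonic_eq_sum_Icc] at h3
      push_cast at h3
      refine le_trans (Finset.sum_le_sum_of_subset_of_nonneg ?_ fun n _ _ => by positivity) h3
      intro n hn
      rw [Finset.mem_Ico] at hn
      rw [Finset.mem_Icc]
      omega
    rw [h1, one_div, inv_mul_eq_div]
    gcongr
    exact h2.trans hH
  have hcard : ((Finset.Ico 1 Y).card : ℝ) ≤ D / q := by
    rw [Nat.card_Ico, hY, Nat.add_sub_cancel]
    exact Nat.floor_le (by positivity)
  have hT0 : 0 ≤ T := by linarith
  refine h.trans ?_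
  calc _ ≤ T / q * (D / q * (60000 * D * T ^ 4)) := by gcongr
    _ = 600 * T ^ 5 * M * (a / (a ^ 3 * q ^ 2)) := by
        rw [hD, ← hb2]
        field_simp
        ring
    _ ≤ 600 * T ^ 5 * M * (15 * b / (a ^ 3 * q)) := by
        gcongr
        exact le_self_pow₀ hq' (by norm_num)
    _ = _ := by
        rw [← ha2]
        field_simp
        ring

/-- The part of the row sums carrying the gcd contributes a multiple of 1/(q·qZ), and qZ ≥ D makes
this the first main term. The part carrying Z/√ν is independent of Z and gives the second. -/
lemma sum_norm_sq_kloostermanPart_block_le {w : ℕ → ℂ} (hw : ∀ x, ‖w x‖ ≤ 1) {k q Z : ℕ}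
    (hk : 3 ≤ k) (hq : 0 < q) (hZ : 0 < Z) {M T : ℝ} (hM : 0 < M)
    (hkq : (k : ℝ) * q ≤ 200 * M) (S : Finset ℕ) (hS : ∀ m ∈ S, M / 2 ≤ m ∧ (m : ℝ) ≤ 3 * M)
    (hZD : √M / (10 * √k) ≤ q * Z) (hT1 : 1 ≤ T)
    (hT : ∀ n, 0 < n → n < 2 * Z → ((q * n).divisors.card : ℝ) ≤ T) :
    ∑ m ∈ S, ‖kloostermanPart w (k - 1) q m (Finset.Ico Z (2 * Z))‖ ^ 2
      ≤ 300000000 * T ^ 4 * M * (√M / (k * √k * q) + M / (k ^ 2 * √k * q ^ 2)) := by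
  obtain ⟨ha1, ha2, hb0, hb2, hab⟩ := sqrt_facts hk hq hM hkq
  have hk' : (3 : ℝ) ≤ k := by exact_mod_cast hk
  have hq' : (1 : ℝ) ≤ q := by exact_mod_cast hq
  set a : ℝ := √k with ha
  set b : ℝ := √M with hb
  have ha0 : 0 < a := by linarith
  set D : ℝ := b / (10 * a) with hD
  have hD0 : 0 < D := by positivity
  have hZ0 : (0 : ℝ) < Z := by exact_mod_cast hZ
  have hνR : ((k - 1 : ℕ) : ℝ) = k - 1 := by
    rw [Nat.cast_sub (by omega)]
    simp
  have h := sum_norm_sq_kloostermanPart_dyadic_le hw (ν := k - 1) (q := q) (Y := Z) (M := M)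
    (T := T) (by omega) hq hZ S (fun m hm => by
      have h1 : (0 : ℝ) < m := by linarith [(hS m hm).1]
      exact ⟨by exact_mod_cast h1, (hS m hm).2⟩) (fun n hn => by
      rw [Finset.mem_Ico] at hn
      exact hT n (by omega) hn.2)
  refine h.trans ?_
  have hν1 : 2 / 3 * (k : ℝ) ≤ ((k - 1 : ℕ) : ℝ) := by rw [hνR]; linarith
  have hsν : 2 / 3 * a ≤ √((k - 1 : ℕ) : ℝ) := by
    refine Real.le_sqrt_of_sq_le ?_
    rw [mul_pow, ha2]
    linarith
  have hpi := Real.pi_pos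
  have hpi2 : Real.pi ^ 2 ≤ 10 := by nlinarith [Real.pi_lt_d2]
  have hMν : (6 * Real.pi * M / ((k - 1 : ℕ) : ℝ)) ^ 2 ≤ 810 * M ^ 2 / k ^ 2 := by
    calc (6 * Real.pi * M / ((k - 1 : ℕ) : ℝ)) ^ 2 ≤ (6 * Real.pi * M / (2 / 3 * k)) ^ 2 := by
          gcongr
      _ = 81 * Real.pi ^ 2 * M ^ 2 / k ^ 2 := by field_simp; ring
      _ ≤ 81 * 10 * M ^ 2 / k ^ 2 := by gcongr
      _ = _ := by ring
  have hT0 : 0 ≤ T := by linarith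
  have hpos : 0 ≤ T ^ 4 * M * (b / (k * a * q) + M / (k ^ 2 * a * q ^ 2)) := by positivity
  have hR1 : 0 ≤ b / (k * a * q) := by positivity
  calc (6 * Real.pi * M / ((k - 1 : ℕ) : ℝ)) ^ 2 * (5 * (16 * T ^ 4 * Z / (q * Z : ℝ) ^ 2 *
        (12 + 3000 * (Z / √((k - 1 : ℕ) : ℝ)))))
      ≤ 810 * M ^ 2 / k ^ 2 * (5 * (16 * T ^ 4 * Z / (q * Z : ℝ) ^ 2 *
        (12 + 3000 * (Z / (2 / 3 * a))))) := by gcongr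
    _ = 64800 * T ^ 4 * M ^ 2 / k ^ 2 * (12 * (1 / (q * (q * Z))) + 4500 * (1 / (q ^ 2 * a))) := by
        field_simp
        ring
    _ ≤ 64800 * T ^ 4 * M ^ 2 / k ^ 2 * (12 * (1 / (q * D)) + 4500 * (1 / (q ^ 2 * a))) := by
        gcongr
    _ = 64800 * T ^ 4 * M * (120 * (b / (k * a * q)) + 4500 * (M / (k ^ 2 * a * q ^ 2))) := by
        rw [hD, ← ha2, ← hb2]
        field_simp
        ring
    _ ≤ 64800 * T ^ 4 * M * (4500 * (b / (k * a * q)) + 4500 * (M / (k ^ 2 * a * q ^ 2))) := by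
        gcongr
        norm_num
    _ = 291600000 * (T ^ 4 * M * (b / (k * a * q) + M / (k ^ 2 * a * q ^ 2))) := by ring
    _ ≤ 300000000 * (T ^ 4 * M * (b / (k * a * q) + M / (k ^ 2 * a * q ^ 2))) := by
        gcongr
        norm_num
    _ = _ := by ring

/-- The main mean square over all moduli that are not negligible. -/
theorem sum_norm_sq_kloostermanPart_le {w : ℕ → ℂ} (hw : ∀ x, ‖w x‖ ≤ 1) {k q J Y : ℕ}
    (hk : 3 ≤ k) (hq : 0 < q) {M T : ℝ} (hM : 0 < M) (hkq : (k : ℝ) * q ≤ 200 * M)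
    (S : Finset ℕ) (hS : ∀ m ∈ S, M / 2 ≤ m ∧ (m : ℝ) ≤ 3 * M)
    (hY : Y = ⌊√M / (10 * √k) / q⌋₊ + 1) (hT1 : 1 ≤ T) (hJ : (J : ℝ) ≤ T)
    (hH : 1 + Real.log Y ≤ T)
    (hT : ∀ n, 0 < n → n < 2 ^ J * Y → ((q * n).divisors.card : ℝ) ≤ T) :
    ∑ m ∈ S, ‖kloostermanPart w (k - 1) q m (Finset.Ico 1 (2 ^ J * Y))‖ ^ 2
      ≤ 700000000 * T ^ 6 * M * (√M / (k * √k * q) + M / (k ^ 2 * √k * q ^ 2)) := by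
  have hq' : (0 : ℝ) < q := by exact_mod_cast hq
  have hY1 : 1 ≤ Y := by omega
  have hYD : √M / (10 * √k) ≤ q * Y := by
    have h := Nat.lt_floor_add_one (√M / (10 * √k) / q)
    rw [div_lt_iff₀ hq'] at h
    rw [hY]
    push_cast
    linarith
  have hYJ : Y ≤ 2 ^ J * Y := Nat.le_mul_of_pos_left _ (by positivity)
  have hsmall := sum_norm_sq_kloostermanPart_initial_le hw hk hq hM hkq S hS hY hT1 hH
    (fun n h0 h1 => hT n h0 (h1.trans_le hYJ))
  set R1 : ℝ := √M / (k * √k * q) with hR1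
  set R2 : ℝ := M / (k ^ 2 * √k * q ^ 2) with hR2
  have hR10 : 0 ≤ R1 := by positivity
  have hR20 : 0 ≤ R2 := by positivity
  have hblock : ∀ i ∈ Finset.range J, ∑ m ∈ S,
      ‖kloostermanPart w (k - 1) q m (Finset.Ico (2 ^ i * Y) (2 * (2 ^ i * Y)))‖ ^ 2
      ≤ 300000000 * T ^ 4 * M * (R1 + R2) := by
    intro i hi
    have hiJ : 2 * 2 ^ i ≤ 2 ^ J := by
      rw [← pow_succ']
      exact Nat.pow_le_pow_right (by norm_num) (Finset.mem_range.1 hi)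
    have hYZ : Y ≤ 2 ^ i * Y := Nat.le_mul_of_pos_left _ (by positivity)
    refine sum_norm_sq_kloostermanPart_block_le hw hk hq (by omega) hM hkq S hS
      (hYD.trans (by gcongr)) hT1 fun n h0 h1 => hT n h0 (h1.trans_le ?_)
    rw [← mul_assoc]
    gcongr
  have hT0 : 0 ≤ T := by linarith
  have hpos : 0 ≤ T ^ 6 * M * (R1 + R2) := by positivity
  -- Cauchy–Schwarz over the J blocks followed by their summation costs J² ≤ T².
  have hmid : ∑ m ∈ S, ‖kloostermanPart w (k - 1) q m (Finset.Ico Y (2 ^ J * Y))‖ ^ 2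
      ≤ 300000000 * T ^ 6 * M * (R1 + R2) := by
    calc ∑ m ∈ S, ‖kloostermanPart w (k - 1) q m (Finset.Ico Y (2 ^ J * Y))‖ ^ 2
        ≤ ∑ m ∈ S, J * ∑ i ∈ Finset.range J,
          ‖kloostermanPart w (k - 1) q m (Finset.Ico (2 ^ i * Y) (2 * (2 ^ i * Y)))‖ ^ 2 := by
          refine Finset.sum_le_sum fun m _ => ?_
          rw [kloostermanPart_dyadic]
          calc _ ≤ (∑ i ∈ Finset.range J, ‖kloostermanPart w (k - 1) q m
                (Finset.Ico (2 ^ i * Y) (2 * (2 ^ i * Y)))‖) ^ 2 := by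
                gcongr
                exact norm_sum_le _ _
            _ ≤ _ := by
                have := sq_sum_le_card_mul_sum_sq (s := Finset.range J) (f := fun i =>
                  ‖kloostermanPart w (k - 1) q m (Finset.Ico (2 ^ i * Y) (2 * (2 ^ i * Y)))‖)
                rwa [Finset.card_range] at this
      _ = J * ∑ i ∈ Finset.range J, ∑ m ∈ S,
          ‖kloostermanPart w (k - 1) q m (Finset.Ico (2 ^ i * Y) (2 * (2 ^ i * Y)))‖ ^ 2 := by
          rw [← Finset.mul_sum, Finset.sum_comm]
      _ ≤ J * ∑ i ∈ Finset.range J, 300000000 * T ^ 4 * M * (R1 + R2) := by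
          gcongr with i hi
          exact hblock i hi
      _ = (J : ℝ) ^ 2 * (300000000 * T ^ 4 * M * (R1 + R2)) := by
          rw [Finset.sum_const, Finset.card_range, nsmul_eq_mul]
          ring
      _ ≤ T ^ 2 * (300000000 * T ^ 4 * M * (R1 + R2)) := by gcongr
      _ = _ := by ring
  have hT56 : T ^ 5 ≤ T ^ 6 := pow_le_pow_right₀ hT1 (by norm_num)
  calc ∑ m ∈ S, ‖kloostermanPart w (k - 1) q m (Finset.Ico 1 (2 ^ J * Y))‖ ^ 2
      ≤ ∑ m ∈ S, 2 * (‖kloostermanPart w (k - 1) q m (Finset.Ico 1 Y)‖ ^ 2 +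
        ‖kloostermanPart w (k - 1) q m (Finset.Ico Y (2 ^ J * Y))‖ ^ 2) := by
        refine Finset.sum_le_sum fun m _ => ?_
        rw [kloostermanPart_union w (k - 1) q m hY1 hYJ]
        refine le_trans ?_ (add_sq_le (a := ‖_‖) (b := ‖_‖))
        gcongr
        exact norm_add_le _ _
    _ = 2 * (∑ m ∈ S, ‖kloostermanPart w (k - 1) q m (Finset.Ico 1 Y)‖ ^ 2 +
        ∑ m ∈ S, ‖kloostermanPart w (k - 1) q m (Finset.Ico Y (2 ^ J * Y))‖ ^ 2) := by
        rw [← Finset.mul_sum, Finset.sum_add_distrib]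
    _ ≤ 2 * (9000 * T ^ 5 * M * R1 + 300000000 * T ^ 6 * M * (R1 + R2)) := by gcongr
    _ ≤ 2 * (9000 * T ^ 6 * M * (R1 + R2) + 300000000 * T ^ 6 * M * (R1 + R2)) := by
        gcongr
        linarith
    _ = 600018000 * (T ^ 6 * M * (R1 + R2)) := by ring
    _ ≤ 700000000 * (T ^ 6 * M * (R1 + R2)) := by
        gcongr
        norm_num
    _ = _ := by ring

end PoincareMoment

end


open scoped MatrixGroups ContDiff UpperHalfPlane

noncomputable section

namespace PoincareMoment

open Set

/-! ### The second moment -/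

lemma exists_pow_mul_exp_le (n : ℕ) :
    ∃ C : ℝ, 0 < C ∧ ∀ x : ℝ, 0 ≤ x → x ^ n * Real.exp (-x) ^ 2 ≤ C := by
  refine ⟨n.factorial, by exact_mod_cast n.factorial_pos, fun x hx => ?_⟩
  have h1 := Real.pow_div_factorial_le_exp x hx n
  have hf : (0 : ℝ) < n.factorial := by exact_mod_cast n.factorial_pos
  rw [div_le_iff₀ hf] at h1
  have h2 : Real.exp (-x) ≤ 1 := Real.exp_le_one_iff.2 (by linarith)
  calc x ^ n * Real.exp (-x) ^ 2 ≤ (Real.exp x * n.factorial) * (Real.exp (-x) * 1) := by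
        rw [pow_two]
        gcongr
    _ = (Real.exp x * Real.exp (-x)) * n.factorial := by ring
    _ = n.factorial := by rw [← Real.exp_add]; simp

lemma one_le_largestSquareDivisor {q : ℕ} (hq : 0 < q) : 1 ≤ largestSquareDivisor q :=
  Finset.le_sup (f := id) (Finset.mem_filter.2 ⟨Nat.one_mem_divisors.2 hq.ne', IsSquare.one⟩)

/-- The range of the variable `m` in the second moment. -/
def momentRange (M : ℝ) : Finset ℕ := Finset.Icc ⌈M / 2⌉₊ ⌊3 * M⌋₊

lemma mem_momentRange {M : ℝ} (hM : 0 < M) {m : ℕ} :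
    m ∈ momentRange M ↔ M / 2 ≤ m ∧ (m : ℝ) ≤ 3 * M := by
  rw [momentRange, Finset.mem_Icc, Nat.ceil_le, Nat.le_floor_iff (by positivity)]

lemma card_momentRange_le {M : ℝ} (hM : 1 ≤ M) : ((momentRange M).card : ℝ) ≤ 4 * M := by
  rw [momentRange, Nat.card_Icc]
  have h1 := Nat.floor_le (show (0 : ℝ) ≤ 3 * M by positivity)
  have h2 : ((⌊3 * M⌋₊ + 1 - ⌈M / 2⌉₊ : ℕ) : ℝ) ≤ ((⌊3 * M⌋₊ + 1 : ℕ) : ℝ) := by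
    exact_mod_cast Nat.sub_le _ _
  push_cast at h2
  linarith

lemma abs_sigmaSq_le {u : ℝ → ℝ} (hu_supp : tsupport u ⊆ Icc (1 / 2) 3)
    (hu_bdd : ∀ x, 0 ≤ u x ∧ u x ≤ 1) (k q : ℕ) (χ : DirichletCharacter ℂ q) {M : ℝ} (hM : 0 < M) :
    |sigmaSq u k q χ M| ≤ 1 / M * ∑ m ∈ momentRange M,
      |peterssonNormSq k q (normalizedPoincareSeries k m q χ) - 1| ^ 2 := by
  rw [sigmaSq, tsum_eq_sum (s := momentRange M), abs_mul, abs_of_pos (by positivity : 0 < 1 / M)]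
  · gcongr
    refine (Finset.abs_sum_le_sum_abs _ _).trans (Finset.sum_le_sum fun m _ => ?_)
    rw [abs_mul, abs_pow, abs_of_nonneg (hu_bdd _).1]
    exact mul_le_of_le_one_left (by positivity) (hu_bdd _).2
  · intro m hm
    have : u (m / M) = 0 := by
      by_contra h
      have h1 := hu_supp (subset_tsupport u h)
      refine hm ((mem_momentRange hM).2 ⟨?_, ?_⟩)
      · have := (le_div_iff₀ hM).1 h1.1
        linarith
      · exact (div_le_iff₀ hM).1 h1.2
    rw [this, zero_mul]

/-- Divisor and logarithmic factors in the range of summation are at most `M^ε`. -/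
lemma exists_splitting {ε : ℝ} (hε : 0 < ε) : ∃ A : ℝ, 0 < A ∧ ∀ (k q : ℕ) (M : ℝ), 3 ≤ k →
    0 < q → 1 ≤ M → (k : ℝ) * q ≤ 200 * M → ∀ Y : ℕ, Y = ⌊√M / (10 * √k) / q⌋₊ + 1 →
    ∃ (J : ℕ) (T : ℝ), 200 * M ≤ 2 ^ J ∧ 1 ≤ T ∧ (J : ℝ) ≤ T ∧ 1 + Real.log Y ≤ T ∧
      (∀ n, 0 < n → n < 2 ^ J * Y → ((q * n).divisors.card : ℝ) ≤ T) ∧ T ^ 6 = A * M ^ ε := by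
  -- All integers whose divisors are counted are at most X = 160800·M³, and T is a multiple of X^δ.
  -- Thus T⁶ carries M^{18δ} = M^ε.
  set δ : ℝ := ε / 18 with hδ
  have hδ0 : 0 < δ := by positivity
  obtain ⟨B, hB0, hB⟩ := exists_card_divisors_le hδ0
  refine ⟨((B + 1 + 1 / δ) * 160800 ^ δ) ^ 6, by positivity,
    fun k q M hk hq hM hkq Y hY => ?_⟩
  have hk' : (3 : ℝ) ≤ k := by exact_mod_cast hk
  have hq' : (1 : ℝ) ≤ q := by exact_mod_cast hq
  have hM0 : 0 < M := by linarith
  obtain ⟨ha1, -, hb0, hb2, -⟩ := sqrt_facts hk hq hM0 hkq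
  set N : ℕ := ⌈200 * M⌉₊ with hN
  set J : ℕ := Nat.clog 2 N with hJ
  have hN1 : 200 * M ≤ N := Nat.le_ceil _
  have hN2 : (N : ℝ) < 200 * M + 1 := Nat.ceil_lt_add_one (by positivity)
  have hN3 : 1 < N := by
    have : (1 : ℝ) < N := by linarith
    exact_mod_cast this
  have hJ1 : (N : ℝ) ≤ 2 ^ J := by exact_mod_cast Nat.le_pow_clog one_lt_two N
  have hJ2 : (2 : ℝ) ^ J ≤ 402 * M := by
    have h1 := Nat.pow_pred_clog_lt_self one_lt_two hN3
    have hJpos : 0 < J := Nat.clog_pos one_lt_two hN3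
    have h2 : (2 : ℝ) ^ J = 2 * 2 ^ (J - 1) := by
      rw [← pow_succ', Nat.sub_add_cancel hJpos]
    have h3 : (2 : ℝ) ^ (J - 1) ≤ N := by exact_mod_cast h1.le
    linarith
  have hsqrtM : √M ≤ M := by
    rw [Real.sqrt_le_left hM0.le]
    nlinarith
  have hY2 : (Y : ℝ) ≤ 2 * M := by
    have h1 : √M / (10 * √k) / q ≤ M := by
      rw [div_div]
      refine (div_le_self hb0.le ?_).trans hsqrtM
      nlinarith
    have h2 := Nat.floor_le (show 0 ≤ √M / (10 * √(k : ℝ)) / q by positivity)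
    rw [hY]
    push_cast
    linarith
  have hqM : (q : ℝ) ≤ 200 * M := by nlinarith
  set X : ℝ := 160800 * M ^ 3 with hX
  have hX1 : 1 ≤ X := by
    have : 1 ≤ M ^ 3 := one_le_pow₀ hM
    linarith
  have hM3 : M ≤ M ^ 3 := le_self_pow₀ hM (by norm_num)
  have hXδ : 1 ≤ X ^ δ := Real.one_le_rpow hX1 hδ0.le
  have hδi : 0 < 1 / δ := by positivity
  have hBT : B * X ^ δ ≤ (B + 1 + 1 / δ) * X ^ δ := by
    gcongr
    linarith
  have hdiv : ∀ n : ℕ, 0 < n → (n : ℝ) ≤ X → (n.divisors.card : ℝ) ≤ (B + 1 + 1 / δ) * X ^ δ := by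
    intro n hn hnX
    refine (hB n hn).trans (le_trans ?_ hBT)
    gcongr
  refine ⟨J, (B + 1 + 1 / δ) * X ^ δ, hN1.trans hJ1, ?_, ?_, ?_, ?_, ?_⟩
  · nlinarith
  -- The divisor bound at 2^J, which has J + 1 divisors, bounds J itself.
  · have h1 := hdiv (2 ^ J) (by positivity) (by push_cast; linarith)
    rw [Nat.divisors_prime_pow Nat.prime_two, Finset.card_map, Finset.card_range] at h1
    push_cast at h1
    linarith
  · have hY1 : (0 : ℝ) ≤ Y := by positivity
    have h1 := Real.log_le_rpow_div hY1 hδ0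
    have h2 : (Y : ℝ) ^ δ ≤ X ^ δ := by
      gcongr
      linarith
    calc 1 + Real.log Y ≤ X ^ δ + X ^ δ / δ := by
          refine add_le_add hXδ (h1.trans ?_)
          gcongr
      _ = (1 + 1 / δ) * X ^ δ := by ring
      _ ≤ _ := by
          gcongr
          linarith
  · intro n hn hlt
    refine hdiv _ (Nat.mul_pos hq hn) ?_
    have h1 : (n : ℝ) ≤ 2 ^ J * Y := by exact_mod_cast hlt.le
    calc ((q * n : ℕ) : ℝ) = q * n := by push_cast; ring
      _ ≤ (200 * M) * ((402 * M) * (2 * M)) := by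
          gcongr
          exact h1.trans (by gcongr)
      _ = X := by rw [hX]; ring
  · rw [hX, Real.mul_rpow (by norm_num) (by positivity), ← mul_assoc, mul_pow]
    congr 1
    rw [← Real.rpow_natCast M 3, ← Real.rpow_mul hM0.le, ← Real.rpow_natCast, ← Real.rpow_mul hM0.le]
    congr 1
    rw [hδ]
    push_cast
    ring

/-- The bound for the second moment with explicit main terms. -/
theorem exists_abs_sigmaSq_le {u : ℝ → ℝ} (hu_supp : tsupport u ⊆ Icc (1 / 2) 3)
    (hu_bdd : ∀ x, 0 ≤ u x ∧ u x ≤ 1) {ε : ℝ} (hε : 0 < ε) :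
    ∃ C : ℝ, 0 < C ∧ ∀ (k q : ℕ) (χ : DirichletCharacter ℂ q) (M : ℝ),
      2 < k → 0 < q → χ (-1) = (-1) ^ k → 1 ≤ M → M ≤ (k : ℝ) ^ 1000 →
      |sigmaSq u k q χ M| ≤ C * (M ^ ε * (√M / (k * √k * q) + M / (k ^ 2 * √k * q ^ 2))
        + ((k : ℝ) ^ 1000)⁻¹) := by
  -- The exponent 5000 used next is 4·1000 + 1000: the squared tail carries M⁴ ≤ k^4000, and a
  -- further k^1000 is to be saved.
  obtain ⟨A, hA0, hA⟩ := exists_splitting hε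
  obtain ⟨B, hB0, hB⟩ := exists_pow_mul_exp_le 5000
  set c₁ : ℝ := 5600000000 * A with hc₁
  set c₂ : ℝ := 32 * ((1500000 * sumInvSq) ^ 2 * B) with hc₂
  refine ⟨c₁ + c₂, by positivity, fun k q χ M hk hq hχ hM hMk => ?_⟩
  have hk3 : 3 ≤ k := hk
  have hk' : (3 : ℝ) ≤ k := by exact_mod_cast hk3
  have hq' : (1 : ℝ) ≤ q := by exact_mod_cast hq
  have hM0 : 0 < M := by linarith
  set R : ℝ := √M / (k * √k * q) + M / (k ^ 2 * √k * q ^ 2) with hR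
  have hR0 : 0 ≤ R := by positivity
  have hw := norm_conjWeight_le χ
  have hS : ∀ m ∈ momentRange M, M / 2 ≤ m ∧ (m : ℝ) ≤ 3 * M := fun m hm =>
    (mem_momentRange hM0).1 hm
  obtain ⟨N, hN, hpart⟩ : ∃ N : ℕ, 200 * M ≤ k * (q * (N + 1) : ℕ) ∧
      ∑ m ∈ momentRange M, ‖kloostermanPart (conjWeight χ) (k - 1) q m (Finset.Ico 1 (N + 1))‖ ^ 2
        ≤ 700000000 * (A * M ^ ε) * M * R := by
    -- If kq ≥ 200M, every modulus lies in the exponentially small range and the main part is empty.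
    rcases le_total (200 * M) (k * q) with h | h
    · refine ⟨0, by simpa using h, ?_⟩
      have : 0 ≤ 700000000 * (A * M ^ ε) * M * R := by positivity
      simpa [kloostermanPart] using this
    · obtain ⟨J, T, hJ, hT1, hJT, hH, hT, hT6⟩ := hA k q M hk3 hq hM h _ rfl
      set Y : ℕ := ⌊√M / (10 * √k) / q⌋₊ + 1 with hY
      have hpos : 0 < 2 ^ J * Y := by positivity
      refine ⟨2 ^ J * Y - 1, ?_, ?_⟩
      · rw [Nat.sub_add_cancel hpos]
        have hY1 : (1 : ℝ) ≤ Y := by rw [hY]; push_cast; linarith [Nat.cast_nonneg (α := ℝ) ⌊√M / (10 * √(k : ℝ)) / q⌋₊]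
        push_cast
        calc 200 * M ≤ 1 * (1 * (2 ^ J * 1)) := by linarith
          _ ≤ (k : ℝ) * (q * (2 ^ J * Y)) := by
              gcongr
              linarith
      · rw [Nat.sub_add_cancel hpos, ← hT6]
        exact sum_norm_sq_kloostermanPart_le hw hk3 hq hM0 h _ hS hY hT1 hJT hH hT
  set t : ℝ := 1500000 * M ^ 2 * Real.exp (-k) * sumInvSq with ht
  have hE : ∀ m ∈ momentRange M, |peterssonNormSq k q (normalizedPoincareSeries k m q χ) - 1| ^ 2
      ≤ 8 * (‖kloostermanPart (conjWeight χ) (k - 1) q m (Finset.Ico 1 (N + 1))‖ ^ 2 + t ^ 2) := by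
    intro m hm
    have hm0 : 0 < m := by
      have : (0 : ℝ) < m := by linarith [(hS m hm).1]
      exact_mod_cast this
    obtain ⟨S, hsum, hval⟩ := exists_hasSum_petersson hk3 hm0 hq hχ
    have h1 := norm_le_kloostermanPart_add_tail hw hk3 hq hM0 (hS m hm).2 hN hsum
    rw [hval]
    calc (2 * ‖S‖) ^ 2 = 4 * ‖S‖ ^ 2 := by ring
      _ ≤ 4 * (‖kloostermanPart (conjWeight χ) (k - 1) q m (Finset.Ico 1 (N + 1))‖ + t) ^ 2 := by
          gcongr
      _ ≤ 4 * (2 * (‖kloostermanPart (conjWeight χ) (k - 1) q m (Finset.Ico 1 (N + 1))‖ ^ 2 + t ^ 2)) := by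
          gcongr
          exact add_sq_le
      _ = _ := by ring
  have ht2 : t ^ 2 ≤ (1500000 * sumInvSq) ^ 2 * B * ((k : ℝ) ^ 1000)⁻¹ := by
    have h1 : M ^ 4 * Real.exp (-(k : ℝ)) ^ 2 ≤ B * ((k : ℝ) ^ 1000)⁻¹ := by
      have hkp : (0 : ℝ) < (k : ℝ) ^ 1000 := by positivity
      rw [← div_eq_mul_inv, le_div_iff₀ hkp]
      calc M ^ 4 * Real.exp (-(k : ℝ)) ^ 2 * (k : ℝ) ^ 1000
          ≤ ((k : ℝ) ^ 1000) ^ 4 * Real.exp (-(k : ℝ)) ^ 2 * (k : ℝ) ^ 1000 := by gcongr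
        _ = (k : ℝ) ^ 5000 * Real.exp (-(k : ℝ)) ^ 2 := by
            rw [mul_right_comm, ← pow_mul, ← pow_add]
        _ ≤ B := hB k (by positivity)
    calc t ^ 2 = (1500000 * sumInvSq) ^ 2 * (M ^ 4 * Real.exp (-(k : ℝ)) ^ 2) := by
          rw [ht]; ring
      _ ≤ (1500000 * sumInvSq) ^ 2 * (B * ((k : ℝ) ^ 1000)⁻¹) := by gcongr
      _ = _ := by ring
  have hcard := card_momentRange_le hM
  calc |sigmaSq u k q χ M|
      ≤ 1 / M * ∑ m ∈ momentRange M,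
        |peterssonNormSq k q (normalizedPoincareSeries k m q χ) - 1| ^ 2 :=
        abs_sigmaSq_le hu_supp hu_bdd k q χ hM0
    _ ≤ 1 / M * ∑ m ∈ momentRange M,
        8 * (‖kloostermanPart (conjWeight χ) (k - 1) q m (Finset.Ico 1 (N + 1))‖ ^ 2 + t ^ 2) := by
        gcongr with m hm
        exact hE m hm
    _ = 1 / M * (8 * (∑ m ∈ momentRange M,
        ‖kloostermanPart (conjWeight χ) (k - 1) q m (Finset.Ico 1 (N + 1))‖ ^ 2 +
        (momentRange M).card * t ^ 2)) := by
        rw [← Finset.mul_sum, Finset.sum_add_distrib, Finset.sum_const, nsmul_eq_mul]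
    _ ≤ 1 / M * (8 * (700000000 * (A * M ^ ε) * M * R +
        4 * M * ((1500000 * sumInvSq) ^ 2 * B * ((k : ℝ) ^ 1000)⁻¹))) := by gcongr
    _ = c₁ * (M ^ ε * R) + c₂ * ((k : ℝ) ^ 1000)⁻¹ := by
        rw [hc₁, hc₂]
        field_simp
        ring
    _ ≤ (c₁ + c₂) * (M ^ ε * R) + (c₁ + c₂) * ((k : ℝ) ^ 1000)⁻¹ := by
        have h1 : 0 ≤ c₁ := by positivity
        have h2 : 0 ≤ c₂ := by positivity
        gcongr <;> linarith
    _ = _ := by ring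

end PoincareMoment

end

/-! ### The proposition in its stated form -/

open scoped MatrixGroups ContDiff UpperHalfPlane
theorem proposition3p2 (u : ℝ → ℝ) (hu_smooth : ContDiff ℝ ∞ u)
    (hu_supp : tsupport u ⊆ Set.Icc (1 / 2) 3) (hu_bdd : ∀ x, 0 ≤ u x ∧ u x ≤ 1)
    (hu_one : ∀ x ∈ Set.Icc (1 : ℝ) 2, u x = 1) (ε : ℝ) (hε : 0 < ε) :
    ∃ C : ℝ, 0 < C ∧ ∀ (k q : ℕ) (χ : DirichletCharacter ℂ q) (M : ℝ),
      2 < k → 0 < q → χ (-1) = (-1) ^ k → 1 ≤ M → M ≤ (k : ℝ) ^ 1000 →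
      |PoincareMoment.sigmaSq u k q χ M| ≤
        C * (M ^ (1 / 2 + ε) * (PoincareMoment.largestSquareDivisor q : ℝ) ^ (1 / 2 : ℝ)
              / ((k : ℝ) ^ (3 / 2 : ℝ) * q)
            + M ^ (1 + ε) * (PoincareMoment.largestSquareDivisor q : ℝ)
              / ((k : ℝ) ^ (5 / 2 : ℝ) * (q : ℝ) ^ 2)
            + ((k : ℝ) ^ 1000)⁻¹) := by
  obtain ⟨C, hC, h⟩ := PoincareMoment.exists_abs_sigmaSq_le hu_supp hu_bdd hε
  refine ⟨C, hC, fun k q χ M hk hq hχ hM hMk => (h k q χ M hk hq hχ hM hMk).trans ?_⟩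
  have hM0 : 0 < M := by linarith
  have hk0 : (0 : ℝ) < k := by exact_mod_cast (by lia : 0 < k)
  have hq0 : (0 : ℝ) < q := by exact_mod_cast hq
  -- The square divisor enters only through f(q) ≥ 1, since the bound already obtained holds without
  -- it.
  have hf : (1 : ℝ) ≤ PoincareMoment.largestSquareDivisor q := by
    exact_mod_cast PoincareMoment.one_le_largestSquareDivisor hq
  have hM1 : M ^ (1 / 2 + ε) = M ^ ε * √M := by
    rw [add_comm, Real.rpow_add hM0, Real.sqrt_eq_rpow]
  have hM2 : M ^ (1 + ε) = M ^ ε * M := by rw [add_comm, Real.rpow_add hM0, Real.rpow_one]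
  have hk1 : (k : ℝ) ^ (3 / 2 : ℝ) = k * √k := by
    rw [show (3 / 2 : ℝ) = 1 + 1 / 2 by norm_num, Real.rpow_add hk0, Real.rpow_one,
      Real.sqrt_eq_rpow]
  have hk2 : (k : ℝ) ^ (5 / 2 : ℝ) = k ^ 2 * √k := by
    rw [show (5 / 2 : ℝ) = 2 + 1 / 2 by norm_num, Real.rpow_add hk0, Real.rpow_two,
      Real.sqrt_eq_rpow]
  rw [hM1, hM2, hk1, hk2, mul_add (M ^ ε), ← mul_div_assoc, ← mul_div_assoc]
  refine mul_le_mul_of_nonneg_left (add_le_add_left (add_le_add ?_ ?_) _) hC.le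
  · exact div_le_div_of_nonneg_right
      (le_mul_of_one_le_right (by positivity) (Real.one_le_rpow hf (by norm_num))) (by positivity)
  · exact div_le_div_of_nonneg_right (le_mul_of_one_le_right (by positivity) hf) (by positivity)
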